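/- Proposition 3.5 (Characterization of $\mathcal{P}R$-products). Let $(\widetilde M,\widetilde g,\mathcal P)$ be a para-Kähler manifold, i.e. $\widetilde g$ is a pseudo-Riemannian metric and $\mathcal P\neq\pm I$ is a field of endomorphisms of $T\widetilde M$ with $\mathcal P^2=I$, $\widetilde g(\mathcal PX,\mathcal PY)=-\widetilde g(X,Y)$ and $\widetilde\nabla\mathcal P=0$ for the Levi-Civita connection $\widetilde\nabla$ of $\widetilde g$ (all data smooth). Let $(M,g)$ be a $\mathcal PR$-submanifold of $\widetilde M$: a pseudo-Riemannian manifold isometrically immersed in $\widetilde M$ whose tangent bundle is a direct sum $TM=\mathcal D\oplus\mathcal D^\perp$ of smooth distributions with $\mathcal P\mathcal D=\mathcal D$ and $\mathcal P\mathcal D^\perp_x\subseteq T_x^\perp M$ for every $x\in M$. Let $P$ be the tangential endomorphism of $TM$, $PX=\tan(\mathcal PX)$, where $\tan$ is the projection along the splitting $T_x\widetilde M=T_xM\oplus T_x^\perp M$. Then the following are equivalent: (i) $M$ is a $\mathcal PR$-product, i.e. every point of $M$ has an open neighbourhood which is isometric to a direct product $(N_\top,g_\top)\times(N_\perp,g_\perp)$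 of pseudo-Riemannian manifolds such that every leaf $N_\top\times\{b\}$ is an invariant submanifold of $\widetilde M$ ($\mathcal P$ maps each of its tangent spaces into itself) and every leaf $\{a\}\times N_\perp$ is an anti-invariant submanifold of $\widetilde M$ ($\mathcal P$ maps each of its tangent spaces into its normal space); (ii) $P$ is parallel, i.e. $(\nabla_UP)V=\nabla_U(PV)-P\nabla_UV=0$ for all vector fields $U,V$ on $M$, where $\nabla$ is the Levi-Civita connection of $g$. -/

import Mathlib

open Bundle VectorField
open scoped Manifold ContDiff Topology

noncomputable section

section Metric

/-- A smooth pseudo-Riemannian metric: a smooth family of symmetric nondegenerate bilinear forms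
on the tangent spaces (of arbitrary signature). -/
structure PseudoRiemannianMetric {E : Type*} [NormedAddCommGroup E] [NormedSpace ℝ E]
    {H : Type*} [TopologicalSpace H] (I : ModelWithCorners ℝ E H)
    (M : Type*) [TopologicalSpace M] [ChartedSpace H M] [IsManifold I ∞ M] where
  /-- The bilinear form on the tangent space at `x`. -/
  val (x : M) : TangentSpace I x →L[ℝ] TangentSpace I x →L[ℝ] ℝ
  symm (x : M) (v w : TangentSpace I x) : val x v w = val x w v
  nondegenerate (x : M) (v : TangentSpace I x)
    (hv : ∀ w : TangentSpace I x, val x v w = 0) : v = 0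
  contMDiff : ContMDiff I (I.prod 𝓘(ℝ, E →L[ℝ] E →L[ℝ] ℝ)) ∞
    (fun x ↦ TotalSpace.mk' (E →L[ℝ] E →L[ℝ] ℝ)
      (E := fun x : M ↦ TangentSpace I x →L[ℝ] TangentSpace I x →L[ℝ] ℝ) x (val x))

namespace PseudoRiemannianMetric

variable {E : Type*} [NormedAddCommGroup E] [NormedSpace ℝ E]
  {H : Type*} [TopologicalSpace H] {I : ModelWithCorners ℝ E H}
  {M : Type*} [TopologicalSpace M] [ChartedSpace H M] [IsManifold I ∞ M]
  (g : PseudoRiemannianMetric I M)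

/-- The function `x ↦ g(X, Y)(x)` of two vector fields. -/
def pair (X Y : Π x : M, TangentSpace I x) (x : M) : ℝ := g.val x (X x) (Y x)

lemma pair_comm (X Y : Π x : M, TangentSpace I x) : g.pair X Y = g.pair Y X := by
  funext x; exact g.symm x _ _

lemma mdifferentiableAt_pair {X Y : Π x : M, TangentSpace I x} {x : M}
    (hX : MDiffAt (T% X) x) (hY : MDiffAt (T% Y) x) : MDiffAt (g.pair X Y) x := by
  have : MDifferentiableAt I (I.prod 𝓘(ℝ))
      (fun m ↦ TotalSpace.mk' ℝ (E := Bundle.Trivial M ℝ) m (g.val m (X m) (Y m))) x := by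
    apply MDifferentiableAt.clm_bundle_apply₂ (F₁ := E) (F₂ := E)
    · exact g.contMDiff.mdifferentiableAt (by simp)
    · exact hX
    · exact hY
  simp only [mdifferentiableAt_totalSpace] at this
  exact this.2

lemma ext_val {x : M} {v w : TangentSpace I x}
    (h : ∀ z : TangentSpace I x, g.val x v z = g.val x w z) : v = w := by
  rw [← sub_eq_zero]
  refine g.nondegenerate x _ fun z ↦ ?_
  simp [h z]

lemma pair_smul_left (f : M → ℝ) (X Y : Π x : M, TangentSpace I x) :
    g.pair (f • X) Y = fun x ↦ f x * g.pair X Y x := by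
  funext x; simp [pair]

lemma pair_smul_right (f : M → ℝ) (X Y : Π x : M, TangentSpace I x) :
    g.pair X (f • Y) = fun x ↦ f x * g.pair X Y x := by
  funext x; simp [pair]

lemma pair_add_left (X X' Y : Π x : M, TangentSpace I x) :
    g.pair (X + X') Y = fun x ↦ g.pair X Y x + g.pair X' Y x := by
  funext x; simp [pair]

lemma pair_add_right (X Y Y' : Π x : M, TangentSpace I x) :
    g.pair X (Y + Y') = fun x ↦ g.pair X Y x + g.pair X Y' x := by
  funext x; simp [pair]

variable [FiniteDimensional ℝ E]

/-- The right-hand side of the Koszul formula for `2 g(∇_X Y, Z)`. -/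
def koszul (X Y Z : Π x : M, TangentSpace I x) (x : M) : ℝ :=
  d% (g.pair Y Z) x (X x) + d% (g.pair X Z) x (Y x) - d% (g.pair X Y) x (Z x)
    + g.val x (mlieBracket I X Y x) (Z x) - g.val x (mlieBracket I X Z x) (Y x)
    - g.val x (mlieBracket I Y Z x) (X x)

lemma tensorialAt_koszul_left {Y Z : Π x : M, TangentSpace I x} {x : M}
    (hY : MDiffAt (T% Y) x) (hZ : MDiffAt (T% Z) x) :
    TensorialAt I E (fun X ↦ g.koszul X Y Z x) x where
  smul {f X} hf hX := by
    simp only [koszul, pair_smul_left, mvfderiv_fun_mul hf (g.mdifferentiableAt_pair hX hZ),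
      mvfderiv_fun_mul hf (g.mdifferentiableAt_pair hX hY),
      mlieBracket_smul_left hf hX]
    simp [pair]
    ring
  add {X X'} hX hX' := by
    simp only [koszul, pair_add_left,
      mvfderiv_fun_add (g.mdifferentiableAt_pair hX hZ) (g.mdifferentiableAt_pair hX' hZ),
      mvfderiv_fun_add (g.mdifferentiableAt_pair hX hY) (g.mdifferentiableAt_pair hX' hY),
      mlieBracket_add_left hX hX']
    simp
    ring

lemma tensorialAt_koszul_right {X Y : Π x : M, TangentSpace I x} {x : M}
    (hX : MDiffAt (T% X) x) (hY : MDiffAt (T% Y) x) :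
    TensorialAt I E (fun Z ↦ g.koszul X Y Z x) x where
  smul {f Z} hf hZ := by
    simp only [koszul, pair_smul_right, mvfderiv_fun_mul hf (g.mdifferentiableAt_pair hX hZ),
      mvfderiv_fun_mul hf (g.mdifferentiableAt_pair hY hZ),
      mlieBracket_smul_right hf hZ]
    simp [pair, g.symm x (Z x)]
    ring
  add {Z Z'} hZ hZ' := by
    simp only [koszul, pair_add_right,
      mvfderiv_fun_add (g.mdifferentiableAt_pair hX hZ) (g.mdifferentiableAt_pair hX hZ'),
      mvfderiv_fun_add (g.mdifferentiableAt_pair hY hZ) (g.mdifferentiableAt_pair hY hZ'),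
      mlieBracket_add_right hZ hZ']
    simp
    ring

lemma koszul_smul_mid {X Y Z : Π x : M, TangentSpace I x} {f : M → ℝ} {x : M}
    (hf : MDiffAt f x) (hX : MDiffAt (T% X) x) (hY : MDiffAt (T% Y) x) (hZ : MDiffAt (T% Z) x) :
    g.koszul X (f • Y) Z x
      = f x * g.koszul X Y Z x + 2 * (d% f x (X x) * g.val x (Y x) (Z x)) := by
  simp only [koszul, pair_smul_left, pair_smul_right,
    mvfderiv_fun_mul hf (g.mdifferentiableAt_pair hY hZ),
    mvfderiv_fun_mul hf (g.mdifferentiableAt_pair hX hY),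
    mlieBracket_smul_left hf hY, mlieBracket_smul_right hf hY]
  simp [pair, g.symm x (Y x) (X x)]
  ring

lemma koszul_add_mid {X Y Y' Z : Π x : M, TangentSpace I x} {x : M}
    (hX : MDiffAt (T% X) x) (hY : MDiffAt (T% Y) x) (hY' : MDiffAt (T% Y') x)
    (hZ : MDiffAt (T% Z) x) :
    g.koszul X (Y + Y') Z x = g.koszul X Y Z x + g.koszul X Y' Z x := by
  simp only [koszul, pair_add_left, pair_add_right,
    mvfderiv_fun_add (g.mdifferentiableAt_pair hX hY) (g.mdifferentiableAt_pair hX hY'),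
    mvfderiv_fun_add (g.mdifferentiableAt_pair hY hZ) (g.mdifferentiableAt_pair hY' hZ),
    mlieBracket_add_left hY hY', mlieBracket_add_right hY hY']
  simp
  ring

/-- For `Y` differentiable at `x`, the Koszul expression as a bilinear form in `X x` and `Z x`. -/
def koszulForm (Y : Π x : M, TangentSpace I x) (x : M) (hY : MDiffAt (T% Y) x) :
    TangentSpace I x →L[ℝ] TangentSpace I x →L[ℝ] ℝ :=
  TensorialAt.mkHom₂ (fun X Z ↦ g.koszul X Y Z x) x
    (fun _ hZ ↦ g.tensorialAt_koszul_left hY hZ)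
    (fun _ hX ↦ g.tensorialAt_koszul_right hX hY)

lemma koszulForm_apply {X Y Z : Π x : M, TangentSpace I x} {x : M} (hY : MDiffAt (T% Y) x)
    (hX : MDiffAt (T% X) x) (hZ : MDiffAt (T% Z) x) :
    g.koszulForm Y x hY (X x) (Z x) = g.koszul X Y Z x :=
  TensorialAt.mkHom₂_apply _ _ hX hZ

lemma koszulForm_apply_extend {Y : Π x : M, TangentSpace I x} {x : M} (hY : MDiffAt (T% Y) x)
    (u w : TangentSpace I x) :
    g.koszulForm Y x hY u w = g.koszul (FiberBundle.extend E u) Y (FiberBundle.extend E w) x :=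
  rfl

/-- The musical isomorphism `v ↦ g(v, ·)`. -/
def flatEquiv (x : M) : TangentSpace I x ≃ₗ[ℝ] (TangentSpace I x →L[ℝ] ℝ) :=
  have : T2Space (TangentSpace I x) := inferInstanceAs (T2Space E)
  have : FiniteDimensional ℝ (TangentSpace I x) := inferInstanceAs (FiniteDimensional ℝ E)
  LinearMap.linearEquivOfInjective (g.val x).toLinearMap
    (by
      rw [← LinearMap.ker_eq_bot, LinearMap.ker_eq_bot']
      intro v hv
      refine g.nondegenerate x v fun w ↦ ?_
      exact congrArg (fun φ : TangentSpace I x →L[ℝ] ℝ ↦ φ w) hv)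
    (by
      rw [← LinearEquiv.finrank_eq
        (LinearMap.toContinuousLinearMap (𝕜 := ℝ) (E := TangentSpace I x) (F' := ℝ))]
      exact Subspace.dual_finrank_eq.symm)

/-- The inverse musical isomorphism: `g.sharp x φ` is the vector `v` with `g(v, ·) = φ`. -/
def sharp (x : M) : (TangentSpace I x →L[ℝ] ℝ) →L[ℝ] TangentSpace I x :=
  have : T2Space (TangentSpace I x) := inferInstanceAs (T2Space E)
  have : FiniteDimensional ℝ (TangentSpace I x) := inferInstanceAs (FiniteDimensional ℝ E)
  LinearMap.toContinuousLinearMap (g.flatEquiv x).symm.toLinearMap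

lemma val_sharp (x : M) (φ : TangentSpace I x →L[ℝ] ℝ) (w : TangentSpace I x) :
    g.val x (g.sharp x φ) w = φ w := by
  have h : (g.flatEquiv x) ((g.flatEquiv x).symm φ) = φ := (g.flatEquiv x).apply_symm_apply φ
  exact congrArg (fun ψ : TangentSpace I x →L[ℝ] ℝ ↦ ψ w) h

open Classical in
/-- The unbundled Levi-Civita derivative `∇ Y`, given by the Koszul formula at the points where `Y`
is differentiable (and by zero elsewhere). -/
def leviCivitaFun (Y : Π x : M, TangentSpace I x) (x : M) :
    TangentSpace I x →L[ℝ] TangentSpace I x :=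
  if hY : MDiffAt (T% Y) x then (1 / 2 : ℝ) • (g.sharp x ∘L g.koszulForm Y x hY) else 0

lemma val_leviCivitaFun {Y : Π x : M, TangentSpace I x} {x : M} (hY : MDiffAt (T% Y) x)
    (u w : TangentSpace I x) :
    2 * g.val x (g.leviCivitaFun Y x u) w
      = g.koszul (FiberBundle.extend E u) Y (FiberBundle.extend E w) x := by
  rw [← g.koszulForm_apply_extend hY]
  simp [leviCivitaFun, hY, val_sharp]

/-- The Levi-Civita connection; `g.leviCivita Y x u` is `∇_u Y` for `u` tangent at `x`. -/
def leviCivita : CovariantDerivative I E (TangentSpace I : M → Type _) where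
  toFun := g.leviCivitaFun
  isCovariantDerivativeOnUniv :=
    { add := by
        intro Y Y' x hY hY' _
        ext u
        refine g.ext_val fun w ↦ ?_
        have hu := FiberBundle.mdifferentiableAt_extend I E u
        have hw := FiberBundle.mdifferentiableAt_extend I E w
        have h := g.val_leviCivitaFun (mdifferentiableAt_add_section hY hY') u w
        rw [g.koszul_add_mid hu hY hY' hw, ← g.val_leviCivitaFun hY, ← g.val_leviCivitaFun hY'] at h
        simp only [_root_.add_apply, map_add]
        linarith
      leibniz := by
        intro Y f x hY hf _
        ext u
        refine g.ext_val fun w ↦ ?_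
        have hu := FiberBundle.mdifferentiableAt_extend I E u
        have hw := FiberBundle.mdifferentiableAt_extend I E w
        have h := g.val_leviCivitaFun (hf.smul_section hY) u w
        rw [g.koszul_smul_mid hf hu hY hw, ← g.val_leviCivitaFun hY] at h
        simp at h ⊢
        linarith }

lemma val_leviCivita {X Y Z : Π x : M, TangentSpace I x} {x : M}
    (hX : MDiffAt (T% X) x) (hY : MDiffAt (T% Y) x) (hZ : MDiffAt (T% Z) x) :
    2 * g.val x (g.leviCivita Y x (X x)) (Z x) = g.koszul X Y Z x := by
  rw [← g.koszulForm_apply hY hX hZ]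
  simp [leviCivita, leviCivitaFun, hY, val_sharp]

/-- The Levi-Civita connection is torsion free. -/
theorem torsion_leviCivita : g.leviCivita.torsion = 0 := by
  rw [CovariantDerivative.torsion_eq_zero_iff]
  intro X Y x hX hY
  refine g.ext_val fun w ↦ ?_
  have hw := FiberBundle.mdifferentiableAt_extend I E w
  have h1 := g.val_leviCivita hX hY hw
  have h2 := g.val_leviCivita hY hX hw
  rw [koszul] at h1 h2
  rw [mlieBracket_swap_apply (V := Y) (W := X), g.pair_comm Y X] at h2
  simp at h1 h2 ⊢
  linarith

/-- The Levi-Civita connection is compatible with the metric. -/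
theorem leviCivita_metric {X Y Z : Π x : M, TangentSpace I x} {x : M}
    (hX : MDiffAt (T% X) x) (hY : MDiffAt (T% Y) x) (hZ : MDiffAt (T% Z) x) :
    d% (g.pair Y Z) x (X x)
      = g.val x (g.leviCivita Y x (X x)) (Z x) + g.val x (Y x) (g.leviCivita Z x (X x)) := by
  have h1 := g.val_leviCivita hX hY hZ
  have h2 := g.val_leviCivita hX hZ hY
  rw [koszul] at h1 h2
  rw [mlieBracket_swap_apply (V := Z) (W := Y), g.pair_comm Z Y] at h2
  rw [g.symm x (Y x)]
  simp at h1 h2 ⊢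
  linarith

/-- A smooth field `A` of endomorphisms of the tangent bundle is parallel, `∇ A = 0`, if
`(∇_U A) V = ∇_U (A V) - A (∇_U V)` vanishes for all (differentiable) vector fields `U`, `V`. -/
def IsParallel (A : Π x : M, TangentSpace I x →L[ℝ] TangentSpace I x) : Prop :=
  ∀ (V : Π x : M, TangentSpace I x) (x : M), MDiffAt (T% V) x → ∀ u : TangentSpace I x,
    g.leviCivita (fun y ↦ A y (V y)) x u = A x (g.leviCivita V x u)

end PseudoRiemannianMetric

end Metric

section ParaKahler

/-- A para-Kähler structure on a manifold: a pseudo-Riemannian metric `g` and a smooth almost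
product structure `𝒫 ≠ ± id` with `𝒫² = id` and `g(𝒫 X, 𝒫 Y) = - g(X, Y)`, which is parallel for
the Levi-Civita connection of `g`. -/
structure ParaKahlerStructure {E : Type*} [NormedAddCommGroup E] [NormedSpace ℝ E]
    [FiniteDimensional ℝ E] {H : Type*} [TopologicalSpace H] (I : ModelWithCorners ℝ E H)
    (M : Type*) [TopologicalSpace M] [ChartedSpace H M] [IsManifold I ∞ M] where
  /-- The pseudo-Riemannian metric. -/
  metric : PseudoRiemannianMetric I M
  /-- The almost product structure. -/
  para (x : M) : TangentSpace I x →L[ℝ] TangentSpace I x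
  contMDiff_para : ContMDiff I (I.prod 𝓘(ℝ, E →L[ℝ] E)) ∞
    (fun x ↦ TotalSpace.mk' (E →L[ℝ] E)
      (E := fun x : M ↦ TangentSpace I x →L[ℝ] TangentSpace I x) x (para x))
  para_para (x : M) (v : TangentSpace I x) : para x (para x v) = v
  para_ne_id : ∃ (x : M) (v : TangentSpace I x), para x v ≠ v
  para_ne_neg_id : ∃ (x : M) (v : TangentSpace I x), para x v ≠ -v
  metric_para (x : M) (v w : TangentSpace I x) :
    metric.val x (para x v) (para x w) = -metric.val x v w
  isParallel_para : metric.IsParallel para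

end ParaKahler

section Submanifolds

variable {E : Type*} [NormedAddCommGroup E] [NormedSpace ℝ E]
  {H : Type*} [TopologicalSpace H] {I : ModelWithCorners ℝ E H}
  {M : Type*} [TopologicalSpace M] [ChartedSpace H M] [IsManifold I ∞ M]
  {E' : Type*} [NormedAddCommGroup E'] [NormedSpace ℝ E']
  {H' : Type*} [TopologicalSpace H'] {J : ModelWithCorners ℝ E' H'}
  {N : Type*} [TopologicalSpace N] [ChartedSpace H' N] [IsManifold J ∞ N]

/-- A smooth isometric immersion `f : (M, g) → (N, h)` of pseudo-Riemannian manifolds, that is, a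
pseudo-Riemannian (immersed) submanifold with induced metric `g`. -/
structure IsIsometricImmersion (g : PseudoRiemannianMetric I M) (h : PseudoRiemannianMetric J N)
    (f : M → N) : Prop where
  contMDiff : ContMDiff I J ∞ f
  injective (x : M) : Function.Injective (mfderiv I J f x)
  isometric (x : M) (u v : TangentSpace I x) :
    h.val (f x) (mfderiv I J f x u) (mfderiv I J f x v) = g.val x u v

variable (I) in
/-- The tangent space of an immersed submanifold `f : M → N` at `x`, inside the ambient one. -/
def imageTangentSpace (J : ModelWithCorners ℝ E' H') (f : M → N) (x : M) :
    Submodule ℝ (TangentSpace J (f x)) :=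
  (mfderiv I J f x).toLinearMap.range

variable (I) in
/-- The normal space of an immersed submanifold `f : M → N` at `x`. -/
def normalSpace (h : PseudoRiemannianMetric J N) (f : M → N) (x : M) :
    Submodule ℝ (TangentSpace J (f x)) where
  carrier := {ξ | ∀ v ∈ imageTangentSpace I J f x, h.val (f x) ξ v = 0}
  add_mem' ha hb v hv := by simp [ha v hv, hb v hv]
  zero_mem' v _ := by simp
  smul_mem' c ξ hξ v hv := by simp [hξ v hv]

section

variable [FiniteDimensional ℝ E]

/-- The tangential projection `tan : T_{f x} N → T_x M`: the vector `tan ξ` is determined by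
`g(tan ξ, v) = h(ξ, df v)` for all `v`. -/
def tangentialPart (g : PseudoRiemannianMetric I M) (h : PseudoRiemannianMetric J N)
    (f : M → N) (x : M) : TangentSpace J (f x) →L[ℝ] TangentSpace I x :=
  g.sharp x ∘L ContinuousLinearMap.precomp ℝ (mfderiv I J f x) ∘L h.val (f x)

/-- For an isometric immersion, `tan ξ` is the tangential component of `ξ` in the decomposition
of the ambient tangent space into tangential and normal parts. -/
theorem tangentialPart_eq_iff {g : PseudoRiemannianMetric I M} {h : PseudoRiemannianMetric J N}
    {f : M → N} (hf : IsIsometricImmersion g h f) (x : M) (ξ : TangentSpace J (f x))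
    (w : TangentSpace I x) :
    tangentialPart g h f x ξ = w ↔ ξ - mfderiv I J f x w ∈ normalSpace I h f x := by
  have key (v : TangentSpace I x) :
      g.val x (tangentialPart g h f x ξ) v = h.val (f x) ξ (mfderiv I J f x v) := by
    simp [tangentialPart, PseudoRiemannianMetric.val_sharp]
  constructor
  · rintro rfl _ ⟨v, rfl⟩
    have := hf.isometric x (tangentialPart g h f x ξ) v
    rw [key] at this
    simpa [sub_eq_zero] using this.symm
  · intro hw
    refine g.ext_val fun v ↦ ?_
    have h1 := hw (mfderiv I J f x v) ⟨v, rfl⟩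
    rw [key, ← hf.isometric x w v]
    simpa [sub_eq_zero] using h1

end

variable [FiniteDimensional ℝ E']

variable (I) in
/-- The submanifold `f : M → N` is invariant: `𝒫` maps each of its tangent spaces into itself. -/
def IsInvariantSubmanifold (K : ParaKahlerStructure J N) (f : M → N) : Prop :=
  ∀ x : M, (imageTangentSpace I J f x).map (K.para (f x)).toLinearMap ≤ imageTangentSpace I J f x

variable (I) in
/-- The submanifold `f : M → N` is anti-invariant: `𝒫` maps each of its tangent spaces into the
corresponding normal space. -/
def IsAntiInvariantSubmanifold (K : ParaKahlerStructure J N) (f : M → N) : Prop :=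
  ∀ x : M, (imageTangentSpace I J f x).map (K.para (f x)).toLinearMap ≤ normalSpace I K.metric f x

/-- A smooth distribution: a family of subspaces of the tangent spaces which near each point is
spanned by pointwise linearly independent smooth vector fields. -/
def IsSmoothDistribution (D : Π x : M, Submodule ℝ (TangentSpace I x)) : Prop :=
  ∀ x : M, ∃ U ∈ 𝓝 x, ∃ (k : ℕ) (s : Fin k → Π y : M, TangentSpace I y),
    (∀ i, ContMDiffOn I I.tangent ∞ (fun y ↦ (⟨y, s i y⟩ : TangentBundle I M)) U) ∧
    ∀ y ∈ U, LinearIndependent ℝ (fun i ↦ s i y) ∧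
      Submodule.span ℝ (Set.range fun i ↦ s i y) = D y

variable (I) in
/-- The submanifold `f : M → N` of a para-Kähler manifold is a `𝒫R`-submanifold:
`TM = D ⊕ D⊥` with an invariant distribution `D` (`𝒫 D = D`) and an anti-invariant
distribution `D⊥` (`𝒫 D⊥` is normal to `M`). -/
def IsPRSubmanifold (K : ParaKahlerStructure J N) (f : M → N) : Prop :=
  ∃ D Dperp : Π x : M, Submodule ℝ (TangentSpace I x),
    IsSmoothDistribution D ∧ IsSmoothDistribution Dperp ∧
    ∀ x : M, IsCompl (D x) (Dperp x) ∧
      ((D x).map (mfderiv I J f x).toLinearMap).map (K.para (f x)).toLinearMap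
        = (D x).map (mfderiv I J f x).toLinearMap ∧
      ((Dperp x).map (mfderiv I J f x).toLinearMap).map (K.para (f x)).toLinearMap
        ≤ normalSpace I K.metric f x

variable [FiniteDimensional ℝ E]

/-- The tangential endomorphism `P`, `P X = tan (𝒫 X)`, of a submanifold of a para-Kähler
manifold. -/
def tangentialEndomorphism (g : PseudoRiemannianMetric I M) (K : ParaKahlerStructure J N)
    (f : M → N) (x : M) : TangentSpace I x →L[ℝ] TangentSpace I x :=
  tangentialPart g K.metric f x ∘L K.para (f x) ∘L mfderiv I J f x

/-- The submanifold `f : (M, g) → N` is a `𝒫R`-product: each point of `M` has an open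
neighbourhood (the range of `Φ`) which is isometric to a direct product `(N₁, g₁) × (N₂, g₂)` of
pseudo-Riemannian manifolds, in such a way that the leaves `N₁ × {b}` are invariant and the
leaves `{a} × N₂` are anti-invariant submanifolds of `N`.

The leaves are isometrically immersed because `Φ` and `f` are isometric. As small product
neighbourhoods can be modelled on open subsets of Euclidean spaces, taking the factors in `Type`
is no restriction. -/
def IsPRProduct (g : PseudoRiemannianMetric I M) (K : ParaKahlerStructure J N)
    (f : M → N) : Prop :=
  ∀ x : M, ∃ (p q : ℕ)
    (N₁ : Type) (_ : TopologicalSpace N₁) (_ : T2Space N₁) (_ : SecondCountableTopology N₁)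
    (_ : ChartedSpace (EuclideanSpace ℝ (Fin p)) N₁) (_ : IsManifold (𝓡 p) ∞ N₁)
    (N₂ : Type) (_ : TopologicalSpace N₂) (_ : T2Space N₂) (_ : SecondCountableTopology N₂)
    (_ : ChartedSpace (EuclideanSpace ℝ (Fin q)) N₂) (_ : IsManifold (𝓡 q) ∞ N₂)
    (g₁ : PseudoRiemannianMetric (𝓡 p) N₁) (g₂ : PseudoRiemannianMetric (𝓡 q) N₂)
    (Φ : N₁ × N₂ → M),
    x ∈ Set.range Φ ∧ Function.Injective Φ ∧
    IsLocalDiffeomorph ((𝓡 p).prod (𝓡 q)) I ∞ Φ ∧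
    (∀ (z : N₁ × N₂) (v w : TangentSpace ((𝓡 p).prod (𝓡 q)) z),
      g.val (Φ z) (mfderiv ((𝓡 p).prod (𝓡 q)) I Φ z v) (mfderiv ((𝓡 p).prod (𝓡 q)) I Φ z w)
        = g₁.val z.1 (mfderiv ((𝓡 p).prod (𝓡 q)) (𝓡 p) Prod.fst z v)
            (mfderiv ((𝓡 p).prod (𝓡 q)) (𝓡 p) Prod.fst z w)
          + g₂.val z.2 (mfderiv ((𝓡 p).prod (𝓡 q)) (𝓡 q) Prod.snd z v)
            (mfderiv ((𝓡 p).prod (𝓡 q)) (𝓡 q) Prod.snd z w)) ∧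
    (∀ b : N₂, IsInvariantSubmanifold (𝓡 p) K (fun a : N₁ ↦ f (Φ (a, b)))) ∧
    (∀ a : N₁, IsAntiInvariantSubmanifold (𝓡 q) K (fun b : N₂ ↦ f (Φ (a, b))))

end Submanifolds

end

noncomputable section

section Superposition

set_option synthInstance.maxHeartbeats 200000

universe u

variable {K : Type u} [TopologicalSpace K] [CompactSpace K]
  {E F : Type u} [NormedAddCommGroup E] [NormedSpace ℝ E]
  [NormedAddCommGroup F] [NormedSpace ℝ F]

variable (K E F) in
/-- Pointwise application of a continuous family of operators to a continuous family of vectors. -/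
def pointwiseApply : C(K, E →L[ℝ] F) →L[ℝ] C(K, E) →L[ℝ] C(K, F) :=
  LinearMap.mkContinuous₂
    (LinearMap.mk₂ ℝ (fun (A : C(K, E →L[ℝ] F)) (h : C(K, E)) ↦ (⟨fun x ↦ A x (h x), by fun_prop⟩ : C(K, F)))
      (fun A B h ↦ by ext; simp) (fun c A h ↦ by ext; simp)
      (fun A h h' ↦ by ext; simp) (fun c A h ↦ by ext; simp))
    1 (fun A h ↦ by
      rw [one_mul, ContinuousMap.norm_le _ (by positivity)]
      intro x
      exact (A x).le_of_opNorm_le_of_le (A.norm_coe_le_norm x) (h.norm_coe_le_norm x))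

/-- The superposition operator `γ ↦ f ∘ γ` has derivative `h ↦ (f' ∘ γ) · h`. -/
lemma hasFDerivAt_superposition {f : C(E, F)} {f' : C(E, E →L[ℝ] F)}
    (hf : ∀ x, HasFDerivAt f (f' x) x) (γ : C(K, E)) :
    HasFDerivAt (fun γ : C(K, E) ↦ f.comp γ) (pointwiseApply K E F (f'.comp γ)) γ := by
  rw [hasFDerivAt_iff_isLittleO_nhds_zero, Asymptotics.isLittleO_iff]
  intro ε hε
  have hcont : Continuous fun γ : C(K, E) ↦ f'.comp γ := ContinuousMap.continuous_postcomp f'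
  obtain ⟨δ, hδ, hball⟩ := Metric.continuousAt_iff (α := C(K, E)) (β := C(K, E →L[ℝ] F)).1 (hcont.continuousAt (x := γ)) ε hε
  filter_upwards [Metric.ball_mem_nhds 0 hδ] with h hh
  rw [ContinuousMap.norm_le _ (by positivity)]
  intro x
  have key : ∀ y ∈ Metric.ball (γ x) δ, ‖f' y - f' (γ x)‖ ≤ ε := by
    intro y hy
    have h1 : dist (γ + ContinuousMap.const K (y - γ x)) γ < δ := by
      rw [dist_eq_norm, add_sub_cancel_left]
      refine lt_of_le_of_lt ((ContinuousMap.norm_le _ (norm_nonneg (y - γ x))).2 fun z ↦ ?_)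
        (mem_ball_iff_norm.1 hy)
      simp
    have h2 := (ContinuousMap.norm_coe_le_norm (f'.comp (γ + ContinuousMap.const K (y - γ x))
      - f'.comp γ) x).trans
      ((dist_eq_norm _ _).symm.trans_le (hball h1).le)
    simpa using h2
  have hx : ‖h x‖ < δ := (h.norm_coe_le_norm x).trans_lt (by simpa using hh)
  have := (convex_ball (γ x) δ).norm_image_sub_le_of_norm_hasFDerivWithin_le'
    (fun y _ ↦ (hf y).hasFDerivWithinAt) key (Metric.mem_ball_self hδ)
    (y := γ x + h x) (by simpa [mem_ball_iff_norm] using hx)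
  simp only [add_sub_cancel_left] at this
  exact this.trans (mul_le_mul_of_nonneg_left (h.norm_coe_le_norm x) hε.le)

lemma contDiff_nat_superposition (n : ℕ) {F : Type u} [NormedAddCommGroup F] [NormedSpace ℝ F]
    (f : C(E, F)) (hf : ContDiff ℝ n f) :
    ContDiff ℝ n fun γ : C(K, E) ↦ f.comp γ := by
  induction n generalizing F with
  | zero =>
    exact contDiff_zero.2 (ContinuousMap.continuous_postcomp f)
  | succ n ih =>
    have h1 : ContDiff ℝ n (fderiv ℝ f) := (contDiff_succ_iff_fderiv.1 hf).2.2
    let f' : C(E, E →L[ℝ] F) := ⟨fderiv ℝ f, h1.continuous⟩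
    have hd : ∀ γ : C(K, E), HasFDerivAt (fun γ : C(K, E) ↦ f.comp γ)
        (pointwiseApply K E F (f'.comp γ)) γ :=
      hasFDerivAt_superposition fun x ↦ (hf.differentiable (by simp) x).hasFDerivAt
    rw [Nat.cast_succ]
    refine contDiff_succ_iff_fderiv.2 ⟨fun γ ↦ (hd γ).differentiableAt, fun h ↦ absurd h (by simp), ?_⟩
    rw [show fderiv ℝ (fun γ : C(K, E) ↦ f.comp γ) = fun γ ↦ pointwiseApply K E F (f'.comp γ) from
      funext fun γ ↦ (hd γ).fderiv]
    exact (pointwiseApply K E F).contDiff.comp (ih f' h1)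

/-- Superposition with a smooth map is a smooth operator on spaces of continuous functions. -/
theorem contDiff_superposition (f : C(E, F)) (hf : ContDiff ℝ ∞ f) :
    ContDiff ℝ ∞ fun γ : C(K, E) ↦ f.comp γ :=
  contDiff_infty.2 fun n ↦ contDiff_nat_superposition n f (contDiff_infty.1 hf n)

end Superposition

section Primitive

open unitInterval MeasureTheory

variable {E : Type*} [NormedAddCommGroup E] [NormedSpace ℝ E]

omit [NormedSpace ℝ E] in
lemma continuous_comp_projIcc (γ : C(I, E)) :
    Continuous fun s : ℝ ↦ γ (Set.projIcc 0 1 zero_le_one s) :=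
  γ.continuous.comp continuous_projIcc

variable (E) in
/-- The operator sending a curve on the unit interval to its primitive vanishing at `0`. -/
def primitiveCLM [CompleteSpace E] : C(I, E) →L[ℝ] C(I, E) :=
  LinearMap.mkContinuous
    { toFun := fun γ ↦ ⟨fun t ↦ ∫ s in (0 : ℝ)..t, γ (Set.projIcc 0 1 zero_le_one s), by
        have := intervalIntegral.continuous_primitive
          (fun a b ↦ (continuous_comp_projIcc γ).intervalIntegrable (μ := volume) a b) 0
        exact this.comp continuous_subtype_val⟩
      map_add' := fun γ γ' ↦ by
        ext t
        exact intervalIntegral.integral_add ((continuous_comp_projIcc γ).intervalIntegrable _ _)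
          ((continuous_comp_projIcc γ').intervalIntegrable _ _)
      map_smul' := fun c γ ↦ by
        ext t
        exact intervalIntegral.integral_smul c _ }
    1 (fun γ ↦ by
      rw [one_mul, ContinuousMap.norm_le _ (norm_nonneg _)]
      intro t
      refine (intervalIntegral.norm_integral_le_of_norm_le_const
        (fun s _ ↦ γ.norm_coe_le_norm _)).trans ?_
      rw [sub_zero, abs_of_nonneg t.2.1]
      exact mul_le_of_le_one_right (norm_nonneg _) t.2.2)

end Primitive

section FixedPoint

open Filter

variable {A X Y : Type*} [NormedAddCommGroup A] [NormedSpace ℝ A]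
  [NormedAddCommGroup X] [NormedSpace ℝ X]
  [NormedAddCommGroup Y] [NormedSpace ℝ Y]

lemma ContDiffAt.eventually_contDiffAt_implicitFunction [CompleteSpace A] [CompleteSpace X]
    {G : A × X → X} {u : A × X} (hGu : ContDiffAt ℝ ∞ G u) (hG : ContDiff ℝ ∞ G)
    (hinv : (fderiv ℝ G u ∘L .inr ℝ A X).IsInvertible) :
    ∀ᶠ a in 𝓝 u.1, ContDiffAt ℝ ∞ (hGu.implicitFunction (by simp) hinv) a := by
  set η := hGu.implicitFunction (by simp) hinv
  have hη : ContinuousAt η u.1 := (hGu.contDiffAt_implicitFunction (by simp) hinv).continuousAt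
  have hηu : η u.1 = u.2 := hGu.implicitFunction_apply_self (by simp) hinv
  have htend : Tendsto (fun a ↦ (a, η a)) (𝓝 u.1) (𝓝 u) := by
    have := (continuousAt_id (x := u.1)).prodMk hη
    rwa [ContinuousAt, id, hηu] at this
  have hinv' : ∀ᶠ x in 𝓝 u, (fderiv ℝ G x ∘L .inr ℝ A X).IsInvertible := by
    obtain ⟨e, he⟩ := hinv
    have hc : Continuous fun x ↦ fderiv ℝ G x ∘L .inr ℝ A X :=
      (hG.continuous_fderiv (by simp)).clm_comp continuous_const
    have hn := ContinuousLinearEquiv.nhds e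
    rw [he] at hn
    exact hc.continuousAt.eventually hn
  have hiff := hGu.eventually_apply_eq_iff_implicitFunction (by simp) hinv
  have hz := hGu.eventually_apply_implicitFunction (by simp) hinv
  filter_upwards [htend.eventually hinv', htend.eventually hiff.eventually_nhds,
    hz] with a ha1 ha2 ha3
  have hGa : ContDiffAt ℝ ∞ G (a, η a) := hG.contDiffAt
  have h1 := hGa.contDiffAt_implicitFunction (by simp) ha1
  have h2 : hGa.implicitFunction (by simp) ha1 a = η a :=
    hGa.implicitFunction_apply_self (by simp) ha1
  refine h1.congr_of_eventuallyEq ?_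
  have htend' : Tendsto (fun b ↦ (b, hGa.implicitFunction (by simp) ha1 b)) (𝓝 a)
      (𝓝 (a, η a)) := by
    have := (continuousAt_id (x := a)).prodMk h1.continuousAt
    rw [ContinuousAt] at this
    simpa only [id, h2] using this
  filter_upwards [htend'.eventually ha2, hGa.eventually_apply_implicitFunction (by simp) ha1]
    with b hb1 hb2
  exact hb1.1 (hb2.trans ha3)

/-- Smooth dependence on the parameter `a` of the solution `η` of the equation
`η = x₀ + P a + B (N η) (Q a)`, together with the linearized equation and its unique solvability. -/
lemma exists_contDiffAt_fixedPoint [CompleteSpace A] [CompleteSpace X] {N : X → Y} (hN : ContDiff ℝ ∞ N) (B : Y →L[ℝ] X →L[ℝ] X)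
    (P Q : A →L[ℝ] X) (x₀ : X) :
    ∃ η : A → X, (∀ᶠ a in 𝓝 0, ContDiffAt ℝ ∞ η a) ∧ η 0 = x₀ ∧
      (∀ᶠ a in 𝓝 0, η a = x₀ + P a + B (N (η a)) (Q a)) ∧
      (∀ᶠ a in 𝓝 0, ∀ u, fderiv ℝ η a u
        = P u + B (fderiv ℝ N (η a) (fderiv ℝ η a u)) (Q a) + B (N (η a)) (Q u)) ∧
      (∀ᶠ a in 𝓝 0, ∀ W, W = B (fderiv ℝ N (η a) W) (Q a) → W = 0) := by
  let G : A × X → X := fun x ↦ x.2 - (x₀ + P x.1 + B (N x.2) (Q x.1))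
  have hG : ContDiff ℝ ∞ G := by
    refine contDiff_snd.sub ((contDiff_const.add (P.contDiff.comp contDiff_fst)).add ?_)
    exact (B.contDiff.comp (hN.comp contDiff_snd)).clm_apply (Q.contDiff.comp contDiff_fst)
  have hG' (x : A × X) (u : A) (J : X) : fderiv ℝ G x (u, J)
      = J - (P u + (B (N x.2) (Q u) + B (fderiv ℝ N x.2 J) (Q x.1))) := by
    have h1 : HasFDerivAt (fun x : A × X ↦ N x.2) _ x :=
      ((hN.differentiable (by simp) x.2).hasFDerivAt).comp x hasFDerivAt_snd
    have h2 : HasFDerivAt (fun x : A × X ↦ Q x.1) _ x := Q.hasFDerivAt.comp x hasFDerivAt_fst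
    have h3 : HasFDerivAt (fun x : A × X ↦ x₀ + P x.1) _ x :=
      (P.hasFDerivAt.comp x hasFDerivAt_fst).const_add x₀
    have h4 : HasFDerivAt (fun x : A × X ↦ B (N x.2)) _ x := B.hasFDerivAt.comp x h1
    have h5 : HasFDerivAt G _ x := hasFDerivAt_snd.sub (h3.add (h4.clm_apply h2))
    rw [h5.fderiv]
    simp
  have hinv : (fderiv ℝ G (0, x₀) ∘L .inr ℝ A X).IsInvertible := by
    refine ⟨ContinuousLinearEquiv.refl ℝ X, ?_⟩
    ext J
    simp [hG']
  have hG0 : ContDiffAt ℝ ∞ G (0, x₀) := hG.contDiffAt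
  obtain ⟨η, hη, hη0, hηG⟩ : ∃ η : A → X, (∀ᶠ a in 𝓝 0, ContDiffAt ℝ ∞ η a) ∧ η 0 = x₀ ∧
      ∀ᶠ a in 𝓝 0, G (a, η a) = 0 := by
    have hz : ∀ᶠ a in 𝓝 0, G (a, hG0.implicitFunction (by simp) hinv a) = 0 := by
      filter_upwards [hG0.eventually_apply_implicitFunction (by simp) hinv] with a ha
      rw [ha]
      simp [G]
    refine ⟨hG0.implicitFunction (by simp) hinv,
      hG0.eventually_contDiffAt_implicitFunction hG hinv, 
      hG0.implicitFunction_apply_self (by simp) hinv, hz⟩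
  refine ⟨η, hη, hη0, ?_, ?_, ?_⟩
  · filter_upwards [hηG] with a ha
    exact sub_eq_zero.1 ha
  · have hdiff : ∀ᶠ a in 𝓝 0, DifferentiableAt ℝ η a :=
      hη.mono fun a ha ↦ ha.differentiableAt (by simp)
    filter_upwards [hηG.eventually_nhds, hdiff] with a ha hd u
    have h1 : HasFDerivAt (fun a ↦ G (a, η a))
        (fderiv ℝ G (a, η a) ∘L (ContinuousLinearMap.id ℝ A).prod (fderiv ℝ η a)) a :=
      HasFDerivAt.comp (f := fun a ↦ (a, η a)) a
        (hG.differentiable (by simp) (a, η a)).hasFDerivAt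
        ((hasFDerivAt_id a).prodMk hd.hasFDerivAt)
    have h2 : HasFDerivAt (fun a ↦ G (a, η a)) (0 : A →L[ℝ] X) a :=
      (hasFDerivAt_const (0 : X) a).congr_of_eventuallyEq ha
    have h3 := congrArg (fun L : A →L[ℝ] X ↦ L u) (h1.unique h2)
    simp [hG', sub_eq_zero] at h3
    rw [add_assoc, add_comm (B _ (Q a))]
    exact h3
  · have hc : ContinuousAt (fun a ↦ ‖B‖ * ‖fderiv ℝ N (η a)‖ * ‖Q a‖) 0 := by
      have := (hN.continuous_fderiv (by simp)).continuousAt.comp hη.self_of_nhds.continuousAt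
      exact (this.norm.const_mul _).mul Q.continuous.norm.continuousAt
    have hlt : ∀ᶠ a in 𝓝 0, ‖B‖ * ‖fderiv ℝ N (η a)‖ * ‖Q a‖ < 1 :=
      hc.eventually_lt_const (by simp)
    filter_upwards [hlt] with a ha W hW
    by_contra hne
    have hpos : 0 < ‖W‖ := norm_pos_iff.2 hne
    have h1 : ‖W‖ ≤ ‖B‖ * (‖fderiv ℝ N (η a)‖ * ‖W‖) * ‖Q a‖ := by
      conv_lhs => rw [hW]
      refine (B.le_opNorm₂ _ _).trans ?_
      gcongr
      exact (fderiv ℝ N (η a)).le_opNorm W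
    nlinarith

end FixedPoint

section RadialFlow

open unitInterval MeasureTheory Filter

variable {E : Type} [NormedAddCommGroup E] [NormedSpace ℝ E] [CompleteSpace E]

variable (E) in
/-- The inclusion of constant curves. -/
def constCurve : E →L[ℝ] C(I, E) :=
  LinearMap.mkContinuous
    { toFun := ContinuousMap.const I, map_add' := fun _ _ ↦ rfl, map_smul' := fun _ _ ↦ rfl } 1
    (fun v ↦ by
      rw [one_mul, ContinuousMap.norm_le _ (norm_nonneg _)]
      exact fun _ ↦ le_rfl)

omit [CompleteSpace E] in
@[simp] lemma constCurve_apply (v : E) (t : I) : constCurve E v t = v := rfl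

set_option synthInstance.maxHeartbeats 200000

/-- Smooth dependence on the parameter `a` of the solution `η` of
`η' = ℓ(η) (q a)`, `η(0) = z₀ + p a`. -/
lemma exists_contDiffAt_integralCurve (ℓ : C(E, E →L[ℝ] E)) (hℓ : ContDiff ℝ ∞ ℓ)
    (p q : E →L[ℝ] E) (z₀ : E) :
    ∃ η : E → C(I, E), (∀ᶠ a in 𝓝 0, ContDiffAt ℝ ∞ η a) ∧ η 0 = constCurve E z₀ ∧
      (∀ᶠ a in 𝓝 0, ∀ t : I, η a t = z₀ + p a
        + ∫ s in (0 : ℝ)..t, ℓ (η a (Set.projIcc 0 1 zero_le_one s)) (q a)) ∧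
      (∀ᶠ a in 𝓝 0, ∀ (u : E) (t : I), fderiv ℝ η a u t
        = p u + (∫ s in (0 : ℝ)..t, fderiv ℝ ℓ (η a (Set.projIcc 0 1 zero_le_one s))
            (fderiv ℝ η a u (Set.projIcc 0 1 zero_le_one s)) (q a))
          + ∫ s in (0 : ℝ)..t, ℓ (η a (Set.projIcc 0 1 zero_le_one s)) (q u)) ∧
      (∀ᶠ a in 𝓝 0, ∀ W : C(I, E), (∀ t : I, W t = ∫ s in (0 : ℝ)..t,
        fderiv ℝ ℓ (η a (Set.projIcc 0 1 zero_le_one s)) (W (Set.projIcc 0 1 zero_le_one s)) (q a))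
        → W = 0) := by
  let ℓ' : C(E, E →L[ℝ] E →L[ℝ] E) := ⟨fderiv ℝ ℓ, hℓ.continuous_fderiv (by simp)⟩
  have hN' (γ : C(I, E)) : fderiv ℝ (fun γ : C(I, E) ↦ ℓ.comp γ) γ
      = pointwiseApply I E (E →L[ℝ] E) (ℓ'.comp γ) :=
    (hasFDerivAt_superposition (f' := ℓ')
      (fun x ↦ (hℓ.differentiable (by simp) x).hasFDerivAt) γ).fderiv
  let B : C(I, E →L[ℝ] E) →L[ℝ] C(I, E) →L[ℝ] C(I, E) :=
    (ContinuousLinearMap.compL ℝ C(I, E) C(I, E) C(I, E) (primitiveCLM E)) ∘L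
      pointwiseApply I E E
  obtain ⟨η, h1, h2, h3, h4, h5⟩ := exists_contDiffAt_fixedPoint
    (contDiff_superposition (K := I) ℓ hℓ) B (constCurve E ∘L p) (constCurve E ∘L q)
    (constCurve E z₀)
  refine ⟨η, h1, h2, ?_, ?_, ?_⟩
  · filter_upwards [h3] with a ha t
    exact congrArg (fun γ : C(I, E) ↦ γ t) ha
  · filter_upwards [h4] with a ha u t
    have := ha u
    rw [hN'] at this
    exact congrArg (fun γ : C(I, E) ↦ γ t) this
  · filter_upwards [h5] with a ha W hW
    refine ha W ?_
    rw [hN']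
    ext t
    exact hW t

end RadialFlow

section LeafChart

open unitInterval MeasureTheory Filter

variable {E : Type} [NormedAddCommGroup E] [NormedSpace ℝ E] [CompleteSpace E]

/-- A family `ℓ z` of projections with common kernel, satisfying the integrability condition,
admits a chart whose slices in the directions of `range q`, where `q = ℓ z₀`, are tangent to the
ranges of the `ℓ z`. -/
lemma exists_leafChart {ℓ : E → E →L[ℝ] E} (hℓ : ContDiff ℝ ∞ ℓ)
    {p q : E →L[ℝ] E} {z₀ : E} (hpq : p + q = 1) (hq : ℓ z₀ = q)
    (hℓq : ∀ z v, ℓ z (q v) = ℓ z v)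
    (hint : ∀ᶠ z in 𝓝 z₀, ∀ u v, fderiv ℝ ℓ z (ℓ z u) v = fderiv ℝ ℓ z (ℓ z v) u) :
    ∃ Θ : E → E, (∀ᶠ a in 𝓝 0, ContDiffAt ℝ ∞ Θ a) ∧ Θ 0 = z₀ ∧ fderiv ℝ Θ 0 = 1 ∧
      ∀ᶠ a in 𝓝 0, ∀ u, fderiv ℝ Θ a (q u) = ℓ (Θ a) u := by
  have hqq (v : E) : q (q v) = q v := by simpa [hq] using hℓq z₀ v
  have hpq' (v : E) : p v + q v = v := by simpa using congrArg (fun L : E →L[ℝ] E ↦ L v) hpq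
  have hp (v : E) : p (q v) = 0 := by simpa [hqq] using hpq' (q v)
  obtain ⟨η, hη, hη0, heq, hlin, huniq⟩ :=
    exists_contDiffAt_integralCurve ⟨ℓ, hℓ.continuous⟩ hℓ p q z₀
  simp only [ContinuousMap.coe_mk] at heq hlin huniq
  have hdη : ∀ᶠ a in 𝓝 0, DifferentiableAt ℝ η a :=
    hη.mono fun a ha ↦ ha.differentiableAt (by simp)
  let ev : C(I, E) →L[ℝ] E := ContinuousMap.evalCLM ℝ (1 : I)
  have hΘ' {a : E} (ha : DifferentiableAt ℝ η a) (u : E) :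
      fderiv ℝ (fun a ↦ η a 1) a u = fderiv ℝ η a u 1 := by
    have : HasFDerivAt (fun a ↦ η a 1) (ev ∘L fderiv ℝ η a) a :=
      ev.hasFDerivAt.comp a ha.hasFDerivAt
    rw [this.fderiv]
    rfl
  refine ⟨fun a ↦ η a 1, hη.mono fun a ha ↦ ev.contDiff.contDiffAt.comp a ha, by simp [hη0], ?_, ?_⟩
  · ext u
    rw [hΘ' hdη.self_of_nhds, hlin.self_of_nhds u 1]
    simp [hη0, hq, hqq, hpq']
  · obtain ⟨δ, hδ, hball⟩ := Metric.eventually_nhds_iff.1 hint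
    have hnear : ∀ᶠ a in 𝓝 0, dist (η a) (constCurve E z₀) < δ := by
      have := hη.self_of_nhds.continuousAt
      rw [ContinuousAt, hη0] at this
      exact this.eventually (Metric.ball_mem_nhds _ hδ)
    filter_upwards [heq, hlin, huniq, hdη, hnear] with a ha hJ hW hd hn u
    have hint' (t : I) (u v : E) :
        fderiv ℝ ℓ (η a t) (ℓ (η a t) u) v = fderiv ℝ ℓ (η a t) (ℓ (η a t) v) u :=
      hball ((ContinuousMap.dist_apply_le_dist t).trans_lt hn) u v
    let e : ℝ → E := fun s ↦ η a (Set.projIcc 0 1 zero_le_one s)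
    have he : Continuous e := continuous_comp_projIcc (η a)
    have hℓe : Continuous fun s ↦ ℓ (e s) := hℓ.continuous.comp he
    have hℓe' : Continuous fun s ↦ fderiv ℝ ℓ (e s) := (hℓ.continuous_fderiv (by simp)).comp he
    let c : ℝ → E := fun t ↦ z₀ + p a + ∫ s in (0 : ℝ)..t, ℓ (e s) (q a)
    have hc (t : ℝ) : HasDerivAt c (ℓ (e t) (q a)) t :=
      ((hℓe.clm_apply continuous_const).integral_hasStrictDerivAt 0 t).hasDerivAt.const_add _
    have hce {t : ℝ} (ht : t ∈ Set.Icc (0 : ℝ) 1) : c t = e t := by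
      simp only [e, Set.projIcc_of_mem zero_le_one ht]
      exact (ha ⟨t, ht⟩).symm
    let T : C(I, E) := ⟨fun t ↦ (t : ℝ) • ℓ (η a t) u, by
      have := hℓ.continuous
      fun_prop⟩
    have hTe {t : ℝ} (ht : t ∈ Set.Icc (0 : ℝ) 1) :
        T (Set.projIcc 0 1 zero_le_one t) = t • ℓ (e t) u := by
      simp [T, e, Set.projIcc_of_mem zero_le_one ht]
    have hTc : Continuous fun s : ℝ ↦ T (Set.projIcc 0 1 zero_le_one s) := continuous_comp_projIcc T
    have hderiv {t : ℝ} (ht : t ∈ Set.Icc (0 : ℝ) 1) : HasDerivAt (fun t ↦ t • ℓ (c t) u)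
        (ℓ (e t) u + fderiv ℝ ℓ (e t) (T (Set.projIcc 0 1 zero_le_one t)) (q a)) t := by
      have h1 := (((hℓ.differentiable (by simp) (c t)).hasFDerivAt.comp_hasDerivAt t
        (hc t)).clm_apply (hasDerivAt_const t u))
      have h2 := (hasDerivAt_id t).smul h1
      refine h2.congr_deriv ?_
      rw [hTe ht, hce ht, map_smul]
      simp only [id, smul_apply, map_zero, add_zero, one_smul, Function.comp_apply]
      rw [add_comm, hce ht, hint' _ u]
    have hT (t : I) : T t = ∫ s in (0 : ℝ)..t, (ℓ (e s) u
        + fderiv ℝ ℓ (e s) (T (Set.projIcc 0 1 zero_le_one s)) (q a)) := by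
      have hsub : Set.uIcc (0 : ℝ) t ⊆ Set.Icc 0 1 := by
        rw [Set.uIcc_of_le t.2.1]
        exact Set.Icc_subset_Icc_right t.2.2
      rw [intervalIntegral.integral_eq_sub_of_hasDerivAt (fun s hs ↦ hderiv (hsub hs))
        (Continuous.intervalIntegrable (by fun_prop) _ _)]
      simp [T, hce t.2, e]
    have hW0 := hW (fderiv ℝ η a (q u) - T) fun t ↦ by
      have hJc : Continuous fun s : ℝ ↦ fderiv ℝ η a (q u) (Set.projIcc 0 1 zero_le_one s) :=
        continuous_comp_projIcc _
      have i1 : IntervalIntegrable (fun s ↦ fderiv ℝ ℓ (e s)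
          (fderiv ℝ η a (q u) (Set.projIcc 0 1 zero_le_one s)) (q a)) volume 0 t :=
        Continuous.intervalIntegrable (by fun_prop) _ _
      have i2 : IntervalIntegrable (fun s ↦ fderiv ℝ ℓ (e s)
          (T (Set.projIcc 0 1 zero_le_one s)) (q a)) volume 0 t :=
        Continuous.intervalIntegrable (by fun_prop) _ _
      have i3 : IntervalIntegrable (fun s ↦ ℓ (e s) u) volume 0 t :=
        Continuous.intervalIntegrable (by fun_prop) _ _
      have h1 := hJ (q u) t
      have h2 := hT t
      simp only [hp, hqq, hℓq, zero_add] at h1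
      simp only [ContinuousMap.sub_apply, map_sub, sub_apply]
      rw [h1, h2, intervalIntegral.integral_add i3 i2, intervalIntegral.integral_sub i1 i2]
      abel
    rw [hΘ' hd, sub_eq_zero.1 hW0]
    simp [T]

end LeafChart

section LocalInverse

open Filter

variable {E F : Type*} [NormedAddCommGroup E] [NormedSpace ℝ E] [CompleteSpace E]
  [NormedAddCommGroup F] [NormedSpace ℝ F]

lemma eventually_isInvertible_of_continuousAt {X : Type*} [TopologicalSpace X]
    {L : X → E →L[ℝ] F} {x : X} (hL : ContinuousAt L x) (h : (L x).IsInvertible) :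
    ∀ᶠ y in 𝓝 x, (L y).IsInvertible := by
  obtain ⟨e, he⟩ := h
  have hn := ContinuousLinearEquiv.nhds e
  rw [he] at hn
  exact hL.eventually hn

/-- The inverse function theorem for smooth maps. -/
lemma exists_openPartialHomeomorph_of_isInvertible_fderiv {f : E → F} {a : E}
    (hf : ∀ᶠ x in 𝓝 a, ContDiffAt ℝ ∞ f x) (hinv : (fderiv ℝ f a).IsInvertible)
    {Q : E → Prop} (hQ : ∀ᶠ x in 𝓝 a, Q x) :
    ∃ e : OpenPartialHomeomorph E F, a ∈ e.source ∧ (e : E → F) = f ∧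
      (∀ x ∈ e.source, ContDiffAt ℝ ∞ f x ∧ (fderiv ℝ f x).IsInvertible ∧ Q x) ∧
      ∀ y ∈ e.target, ContDiffAt ℝ ∞ e.symm y ∧
        fderiv ℝ e.symm y = (fderiv ℝ f (e.symm y)).inverse := by
  have hfa := hf.self_of_nhds
  obtain ⟨L, hL⟩ := hinv
  have hd : HasFDerivAt f (L : E →L[ℝ] F) a := by
    rw [hL]
    exact (hfa.differentiableAt (by simp)).hasFDerivAt
  have hcont : ContinuousAt (fderiv ℝ f) a :=
    (hfa.fderiv_right (m := 0) (by simp)).continuousAt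
  have hev := hf.and ((eventually_isInvertible_of_continuousAt hcont ⟨L, hL⟩).and hQ)
  obtain ⟨s, hs, hso, has⟩ := eventually_nhds_iff.1 hev
  let e₀ := hfa.toOpenPartialHomeomorph f hd (by simp)
  have he₀ : (e₀ : E → F) = f := rfl
  refine ⟨e₀.restrOpen s hso, ?_, he₀, ?_, ?_⟩
  · exact ⟨hfa.mem_toOpenPartialHomeomorph_source hd (by simp), has⟩
  · exact fun x hx ↦ hs x hx.2
  · intro y hy
    obtain ⟨h1, ⟨M, hM⟩, -⟩ := hs _ ((e₀.restrOpen s hso).map_target hy).2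
    have hd' : HasFDerivAt (e₀.restrOpen s hso) (M : E →L[ℝ] F) ((e₀.restrOpen s hso).symm y) := by
      rw [hM]
      exact (h1.differentiableAt (by simp)).hasFDerivAt
    have h2 := (e₀.restrOpen s hso).contDiffAt_symm hy hd' h1
    refine ⟨h2, ?_⟩
    rw [((e₀.restrOpen s hso).hasFDerivAt_symm hy hd').fderiv, ← hM]
    simp

end LocalInverse

section Frobenius

open Filter

variable {E : Type} [NormedAddCommGroup E] [NormedSpace ℝ E] [FiniteDimensional ℝ E]

/-- A map which is smooth near a point agrees near this point with a globally smooth multiple of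
itself. -/
lemma exists_contDiff_smul_eventuallyEq {F : Type*} [NormedAddCommGroup F] [NormedSpace ℝ F]
    {f : E → F} {a : E} (hf : ∀ᶠ x in 𝓝 a, ContDiffAt ℝ ∞ f x) :
    ∃ χ : E → ℝ, ContDiff ℝ ∞ (fun x ↦ χ x • f x) ∧ ∀ᶠ x in 𝓝 a, χ x = 1 := by
  obtain ⟨r, hr, hball⟩ := Metric.eventually_nhds_iff.1 hf
  let χ : ContDiffBump a := ⟨r / 4, r / 2, by positivity, by linarith⟩
  refine ⟨χ, ?_, χ.eventuallyEq_one⟩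
  rw [contDiff_iff_contDiffAt]
  intro x
  by_cases hx : dist x a < r
  · exact χ.contDiff.contDiffAt.smul (hball hx)
  · have h0 : ∀ᶠ y in 𝓝 x, χ y = 0 := by
      apply notMem_tsupport_iff_eventuallyEq.1
      rw [χ.tsupport_eq, Metric.mem_closedBall]
      change ¬ dist x a ≤ r / 2
      linarith
    refine (contDiffAt_const (c := (0 : F))).congr_of_eventuallyEq ?_
    filter_upwards [h0] with y hy
    simp [hy]

/-- The Frobenius theorem: the kernels of a smooth family `ρ` of projections which satisfies the
integrability condition are the kernels of the derivative of a smooth map. -/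
theorem exists_firstIntegral {ρ : E → E →L[ℝ] E} {z₀ : E}
    (hρ : ∀ᶠ z in 𝓝 z₀, ContDiffAt ℝ ∞ ρ z)
    (hidem : ∀ᶠ z in 𝓝 z₀, ∀ v, ρ z (ρ z v) = ρ z v)
    (hint : ∀ᶠ z in 𝓝 z₀, ∀ u v, ρ z u = 0 → ρ z v = 0 →
      fderiv ℝ ρ z u v = fderiv ℝ ρ z v u) :
    ∃ ψ : E → E, (∀ᶠ z in 𝓝 z₀, ContDiffAt ℝ ∞ ψ z) ∧
      (∀ᶠ z in 𝓝 z₀, ∀ v, fderiv ℝ ψ z v = 0 ↔ ρ z v = 0) ∧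
      (∀ᶠ z in 𝓝 z₀, ∀ v, ρ z₀ (fderiv ℝ ψ z v) = fderiv ℝ ψ z v) := by
  have := FiniteDimensional.complete ℝ E
  set p : E →L[ℝ] E := ρ z₀ with hp
  let q : E →L[ℝ] E := 1 - p
  have hpp (v : E) : p (p v) = p v := hidem.self_of_nhds v
  have hq_apply (v : E) : q v = v - p v := rfl
  have hpq (v : E) : p (q v) = 0 := by simp [hq_apply, hpp]
  have hqq (v : E) : q (q v) = q v := by simp [hq_apply, hpp]
  let T : E → E →L[ℝ] E := fun z ↦ p ∘L ρ z + q ∘L (1 - ρ z)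
  have hTz (z v : E) : T z v = p (ρ z v) + q (v - ρ z v) := rfl
  have hT : ∀ᶠ z in 𝓝 z₀, ContDiffAt ℝ ∞ T z := hρ.mono fun z hz ↦
    (contDiffAt_const.clm_comp hz).add (contDiffAt_const.clm_comp (contDiffAt_const.sub hz))
  have hT0 : T z₀ = 1 := by
    ext v
    rw [hTz, ← hp, hpp, ← hq_apply, hqq]
    simp [hq_apply]
  have hTinv : ∀ᶠ z in 𝓝 z₀, (T z).IsInvertible :=
    eventually_isInvertible_of_continuousAt hT.self_of_nhds.continuousAt
      (by rw [hT0]; exact ⟨ContinuousLinearEquiv.refl ℝ E, rfl⟩)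
  let ℓ₀ : E → E →L[ℝ] E := fun z ↦ (T z).inverse ∘L q
  have hℓ₀ : ∀ᶠ z in 𝓝 z₀, ContDiffAt ℝ ∞ ℓ₀ z := by
    filter_upwards [hT, hTinv] with z h1 h2
    exact (h2.contDiffAt_map_inverse.comp z h1).clm_comp contDiffAt_const
  obtain ⟨χ, hχ, hχ1⟩ := exists_contDiff_smul_eventuallyEq hℓ₀
  let ℓ : E → E →L[ℝ] E := fun z ↦ χ z • ℓ₀ z
  have hℓ : ContDiff ℝ ∞ ℓ := hχ
  have hℓq (z v : E) : ℓ z (q v) = ℓ z v := by simp [ℓ, ℓ₀, hqq]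
  have hℓz₀ : ℓ z₀ = q := by
    ext v
    simp only [ℓ, ℓ₀, hχ1.self_of_nhds, hT0, one_smul]
    rw [show (1 : E →L[ℝ] E) = ContinuousLinearMap.id ℝ E from rfl]
    simp
  have hprop : ∀ᶠ z in 𝓝 z₀, ∀ v, ρ z (ℓ z v) = 0 ∧ q (ℓ z v) = q v ∧
      (ρ z v = 0 → ℓ z v = v) := by
    filter_upwards [hidem, hTinv, hχ1] with z hi hinv h1 v
    have hTℓ : T z (ℓ z v) = q v := by simp [ℓ, ℓ₀, h1, hinv]
    have hpT (w : E) : p (T z w) = p (ρ z w) := by simp [hTz, hpp, hpq]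
    have hρℓ : ρ z (ℓ z v) = 0 := by
      apply hinv.injective
      rw [map_zero, hTz, hi, sub_self, map_zero, add_zero, ← hpT, hTℓ, hpq]
    refine ⟨hρℓ, ?_, fun hv ↦ ?_⟩
    · rw [hTz, hρℓ] at hTℓ
      simpa using hTℓ
    · apply hinv.injective
      rw [hTℓ, hTz, hv]
      simp
  have hintℓ : ∀ᶠ z in 𝓝 z₀, ∀ u v, fderiv ℝ ℓ z (ℓ z u) v = fderiv ℝ ℓ z (ℓ z v) u := by
    filter_upwards [hprop.eventually_nhds, hint, hρ] with z hz hi hs u v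
    have hdℓ (w x : E) : HasFDerivAt (fun y ↦ ℓ y x) ((fderiv ℝ ℓ z).flip x) z := by
      have h := (hℓ.differentiable (by simp) z).hasFDerivAt.clm_apply (hasFDerivAt_const x z)
      simpa using h
    have hρd (w x : E) : ρ z (fderiv ℝ ℓ z w x) = - fderiv ℝ ρ z w (ℓ z x) := by
      have h1 := (hs.differentiableAt (by simp)).hasFDerivAt.clm_apply (hdℓ w x)
      have h2 := h1.unique ((hasFDerivAt_const (0 : E) z).congr_of_eventuallyEq
        (hz.mono fun y hy ↦ (hy x).1))
      have h3 := congrArg (fun L : E →L[ℝ] E ↦ L w) h2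
      simp only [_root_.add_apply, ContinuousLinearMap.comp_apply,
        ContinuousLinearMap.flip_apply, _root_.zero_apply] at h3
      exact eq_neg_of_add_eq_zero_left h3
    have hqd (w x : E) : q (fderiv ℝ ℓ z w x) = 0 := by
      have h1 : HasFDerivAt (fun y ↦ q (ℓ y x)) _ z := q.hasFDerivAt.comp z (hdℓ w x)
      have h2 := h1.unique ((hasFDerivAt_const (q x) z).congr_of_eventuallyEq
        (hz.mono fun y hy ↦ (hy x).2.1))
      exact congrArg (fun L : E →L[ℝ] E ↦ L w) h2
    have hz0 := hz.self_of_nhds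
    have hd : ρ z (fderiv ℝ ℓ z (ℓ z u) v - fderiv ℝ ℓ z (ℓ z v) u) = 0 := by
      rw [map_sub, hρd, hρd, hi _ _ (hz0 u).1 (hz0 v).1, sub_self]
    have := (hz0 _).2.2 hd
    rw [← hℓq, map_sub q, hqd, hqd, sub_self, map_zero] at this
    exact sub_eq_zero.1 this.symm
  obtain ⟨Θ, hΘ, hΘ0, hΘ1, hΘℓ⟩ := exists_leafChart hℓ (p := p) (q := q) (by simp [q]) hℓz₀ hℓq
    hintℓ
  obtain ⟨e, he0, heΘ, hes, het⟩ := exists_openPartialHomeomorph_of_isInvertible_fderiv hΘ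
    (by rw [hΘ1]; exact ⟨ContinuousLinearEquiv.refl ℝ E, rfl⟩) (Eventually.of_forall fun _ ↦ trivial)
  have hmem : z₀ ∈ e.target := by
    rw [← hΘ0, ← heΘ]
    exact e.map_source he0
  have het' : ∀ᶠ z in 𝓝 z₀, z ∈ e.target := e.open_target.mem_nhds hmem
  have hψ' {z : E} (hz : z ∈ e.target) (v : E) : fderiv ℝ (fun z ↦ p (e.symm z)) z v
      = p ((fderiv ℝ Θ (e.symm z)).inverse v) := by
    have h : HasFDerivAt (fun z ↦ p (e.symm z)) (p ∘L fderiv ℝ e.symm z) z :=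
      p.hasFDerivAt.comp z ((het z hz).1.differentiableAt (by simp)).hasFDerivAt
    rw [h.fderiv, (het z hz).2]
    rfl
  refine ⟨fun z ↦ p (e.symm z), ?_, ?_, ?_⟩
  · filter_upwards [het'] with z hz
    exact p.contDiff.contDiffAt.comp z (het z hz).1
  · have htend : Tendsto e.symm (𝓝 z₀) (𝓝 0) := by
      have h := e.tendsto_symm he0
      rwa [heΘ, hΘ0] at h
    filter_upwards [het', htend.eventually hΘℓ, hprop] with z hz hΘz hpz v
    have hΘe : Θ (e.symm z) = z := by
      rw [← heΘ]
      exact e.right_inv hz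
    rw [hΘe] at hΘz
    obtain ⟨L, hL⟩ := (hes _ (e.map_target hz)).2.1
    rw [← hL] at hΘz
    rw [hψ' hz, ← hL, ContinuousLinearMap.inverse_equiv]
    change p (L.symm v) = 0 ↔ _
    constructor
    · intro h
      have h1 : L.symm v = q (L.symm v) := by rw [hq_apply, h, sub_zero]
      have h2 := hΘz (L.symm v)
      rw [← h1] at h2
      have h3 : v = ℓ z (L.symm v) := by simpa using h2
      rw [h3]
      exact (hpz _).1
    · intro h
      have h1 : L (q v) = v := (hΘz v).trans ((hpz v).2.2 h)
      rw [← h1, L.symm_apply_apply, hpq]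
  · filter_upwards [het'] with z hz v
    rw [hψ' hz, hpp]

end Frobenius

section Straightening

open Filter

variable {E : Type} [NormedAddCommGroup E] [NormedSpace ℝ E] [FiniteDimensional ℝ E]

/-- Linear coordinates in which a projection is the projection to the first factor. -/
lemma exists_equiv_prod_of_idempotent (p : E →L[ℝ] E) (hp : ∀ v, p (p v) = p v) :
    ∃ (a b : ℕ) (L : E ≃L[ℝ] EuclideanSpace ℝ (Fin a) × EuclideanSpace ℝ (Fin b)),
      ∀ v, L (p v) = ((L v).1, 0) := by
  have hker (v : E) : v - p v ∈ p.ker := by simp [hp]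
  have hrange (v : p.range) : p v = v := by
    obtain ⟨_, w, rfl⟩ := v
    exact hp w
  have hzero (v : p.ker) : p v = 0 := v.2
  let e₁ := toEuclidean (E := p.range)
  let e₂ := toEuclidean (E := p.ker)
  let L : E ≃ₗ[ℝ] EuclideanSpace ℝ (Fin (Module.finrank ℝ p.range)) ×
      EuclideanSpace ℝ (Fin (Module.finrank ℝ p.ker)) :=
    { toFun := fun v ↦ (e₁ ⟨p v, v, rfl⟩, e₂ ⟨v - p v, hker v⟩)
      map_add' := fun v w ↦ by
        rw [Prod.mk_add_mk, ← map_add, ← map_add]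
        congr 3 <;> simp
        abel
      map_smul' := fun c v ↦ by
        rw [RingHom.id_apply, Prod.smul_mk, ← map_smul, ← map_smul]
        congr 3 <;> simp [smul_sub]
      invFun := fun x ↦ (e₁.symm x.1 : E) + (e₂.symm x.2 : E)
      left_inv := fun v ↦ by simp
      right_inv := fun x ↦ by
        ext1
        · refine e₁.symm.injective ?_
          rw [e₁.symm_apply_apply]
          ext
          simp [hrange, hzero]
        · refine e₂.symm.injective ?_
          rw [e₂.symm_apply_apply]
          ext
          simp [hrange, hzero] }
  refine ⟨_, _, L.toContinuousLinearEquiv, fun v ↦ ?_⟩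
  have h1 : (⟨p (p v), p v, rfl⟩ : p.range) = ⟨p v, v, rfl⟩ := Subtype.ext (hp v)
  have h2 : (⟨p v - p (p v), hker (p v)⟩ : p.ker) = 0 := Subtype.ext (by simp [hp])
  change (e₁ ⟨p (p v), p v, rfl⟩, e₂ ⟨p v - p (p v), hker (p v)⟩) = (e₁ ⟨p v, v, rfl⟩, 0)
  rw [h1, h2, map_zero]

/-- If the kernels and the ranges of a smooth family of projections are integrable, then the family
is constant in suitable coordinates. -/
theorem exists_straightening {ρ : E → E →L[ℝ] E} {z₀ : E}
    (hρ : ∀ᶠ z in 𝓝 z₀, ContDiffAt ℝ ∞ ρ z)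
    (hidem : ∀ᶠ z in 𝓝 z₀, ∀ v, ρ z (ρ z v) = ρ z v)
    (hker : ∀ᶠ z in 𝓝 z₀, ∀ u v, ρ z u = 0 → ρ z v = 0 →
      fderiv ℝ ρ z u v = fderiv ℝ ρ z v u)
    (hrange : ∀ᶠ z in 𝓝 z₀, ∀ u v, ρ z u = u → ρ z v = v →
      fderiv ℝ ρ z u v = fderiv ℝ ρ z v u)
    {Q : E → Prop} (hQ : ∀ᶠ z in 𝓝 z₀, Q z) :
    ∃ (a b : ℕ)
      (Θ : OpenPartialHomeomorph (EuclideanSpace ℝ (Fin a) × EuclideanSpace ℝ (Fin b)) E),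
      Θ.source = Set.univ ∧ z₀ ∈ Θ.target ∧ ContDiff ℝ ∞ Θ ∧ ContDiffOn ℝ ∞ Θ.symm Θ.target ∧
      (∀ x u v, ρ (Θ x) (fderiv ℝ Θ x (u, v)) = fderiv ℝ Θ x (u, 0)) ∧ ∀ z ∈ Θ.target, Q z := by
  have := FiniteDimensional.complete ℝ E
  obtain ⟨ψ₁, hψ₁, hk₁, hr₁⟩ := exists_firstIntegral hρ hidem hker
  obtain ⟨ψ₂, hψ₂, hk₂, hr₂⟩ := exists_firstIntegral (ρ := fun z ↦ 1 - ρ z)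
    (hρ.mono fun z hz ↦ contDiffAt_const.sub hz)
    (hidem.mono fun z hz v ↦ by simp [hz])
    (by
      filter_upwards [hrange, hρ] with z hz hs u v hu hv
      have hd : HasFDerivAt (fun z ↦ 1 - ρ z) (-fderiv ℝ ρ z) z :=
        (hs.differentiableAt (by simp)).hasFDerivAt.const_sub 1
      rw [hd.fderiv]
      simp only [sub_apply, one_apply_eq_self, sub_eq_zero] at hu hv
      simp [hz u v hu.symm hv.symm])
  simp only [sub_apply, one_apply_eq_self, sub_eq_zero] at hk₂
  replace hr₂ : ∀ᶠ z in 𝓝 z₀, ∀ v, ρ z₀ (fderiv ℝ ψ₂ z v) = 0 :=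
    hr₂.mono fun z hz v ↦ by simpa using hz v
  obtain ⟨a, b, L, hL⟩ := exists_equiv_prod_of_idempotent (ρ z₀) hidem.self_of_nhds
  let f : E → EuclideanSpace ℝ (Fin a) × EuclideanSpace ℝ (Fin b) := fun z ↦ L (ψ₁ z + ψ₂ z)
  have hf : ∀ᶠ z in 𝓝 z₀, ContDiffAt ℝ ∞ f z := by
    filter_upwards [hψ₁, hψ₂] with z h1 h2
    exact L.contDiff.contDiffAt.comp z (h1.add h2)
  have hf' : ∀ᶠ z in 𝓝 z₀, ∀ w, fderiv ℝ f z w = L (fderiv ℝ ψ₁ z w + fderiv ℝ ψ₂ z w) := by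
    filter_upwards [hψ₁, hψ₂] with z h1 h2 w
    have : HasFDerivAt f ((L : E →L[ℝ] _) ∘L (fderiv ℝ ψ₁ z + fderiv ℝ ψ₂ z)) z :=
      L.hasFDerivAt.comp z ((h1.differentiableAt (by simp)).hasFDerivAt.add
        (h2.differentiableAt (by simp)).hasFDerivAt)
    rw [this.fderiv]
    rfl
  have hfinj : ∀ᶠ z in 𝓝 z₀, Function.Injective (fderiv ℝ f z) := by
    filter_upwards [hf', hk₁, hk₂, hr₁, hr₂] with z h0 h1 h2 h3 h4
    rw [injective_iff_map_eq_zero]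
    intro w hw
    rw [h0, map_eq_zero_iff _ L.injective] at hw
    have h5 := congrArg (ρ z₀) hw
    rw [map_add, h3, h4, add_zero, map_zero] at h5
    rw [h5, zero_add] at hw
    rw [(h2 w).1 hw, (h1 w).1 h5]
  have hfρ : ∀ᶠ z in 𝓝 z₀, ∀ w, fderiv ℝ f z (ρ z w) = ((fderiv ℝ f z w).1, 0) := by
    filter_upwards [hf', hk₁, hk₂, hr₁, hr₂, hidem] with z h0 h1 h2 h3 h4 h5 w
    have e1 : fderiv ℝ ψ₂ z (ρ z w) = 0 := (h2 _).2 (h5 w).symm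
    have e2 : fderiv ℝ ψ₁ z (ρ z w) = fderiv ℝ ψ₁ z w := by
      rw [← sub_eq_zero, ← map_sub, h1]
      simp [h5]
    have e3 : ρ z₀ (fderiv ℝ ψ₁ z w + fderiv ℝ ψ₂ z w) = fderiv ℝ ψ₁ z w := by
      rw [map_add, h3, h4, add_zero]
    rw [h0, h0, e1, e2, add_zero, ← hL, e3]
  have hfinv : (fderiv ℝ f z₀).IsInvertible := by
    have hfin : Module.finrank ℝ E
        = Module.finrank ℝ (EuclideanSpace ℝ (Fin a) × EuclideanSpace ℝ (Fin b)) :=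
      L.toLinearEquiv.finrank_eq
    let M := LinearEquiv.ofInjectiveOfFinrankEq (fderiv ℝ f z₀).toLinearMap
      hfinj.self_of_nhds hfin
    exact ⟨M.toContinuousLinearEquiv, by ext1 v; rfl⟩
  obtain ⟨e, he0, hef, hes, het⟩ := exists_openPartialHomeomorph_of_isInvertible_fderiv hf hfinv
    (hfinj.and (hfρ.and hQ))
  have hmem : f z₀ ∈ e.target := by
    rw [← hef]
    exact e.map_source he0
  obtain ⟨r, hr, hball⟩ := Metric.isOpen_iff.1 e.open_target _ hmem
  let U₁ := OpenPartialHomeomorph.univBall (f z₀).1 r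
  let U₂ := OpenPartialHomeomorph.univBall (f z₀).2 r
  have hU₁ : U₁.target = Metric.ball (f z₀).1 r := OpenPartialHomeomorph.univBall_target _ hr
  have hU₂ : U₂.target = Metric.ball (f z₀).2 r := OpenPartialHomeomorph.univBall_target _ hr
  have hUs₁ : U₁.source = Set.univ := OpenPartialHomeomorph.univBall_source _ _
  have hUs₂ : U₂.source = Set.univ := OpenPartialHomeomorph.univBall_source _ _
  have hUd₁ : ContDiff ℝ ∞ U₁ := OpenPartialHomeomorph.contDiff_univBall
  have hUd₂ : ContDiff ℝ ∞ U₂ := OpenPartialHomeomorph.contDiff_univBall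
  have hUt (x : EuclideanSpace ℝ (Fin a) × EuclideanSpace ℝ (Fin b)) : (U₁ x.1, U₂ x.2) ∈ e.target := by
    apply hball
    rw [← ball_prod_same]
    exact ⟨hU₁ ▸ U₁.map_source (hUs₁ ▸ trivial), hU₂ ▸ U₂.map_source (hUs₂ ▸ trivial)⟩
  let Θ := (U₁.prod U₂).trans e.symm
  have hΘ_apply (x) : Θ x = e.symm (U₁ x.1, U₂ x.2) := rfl
  have hΘs (x) : Θ x ∈ e.source := e.map_target (hUt x)
  have hfΘ (x) : f (Θ x) = (U₁ x.1, U₂ x.2) := by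
    rw [← hef, hΘ_apply, e.right_inv (hUt x)]
  have hΘd : ContDiff ℝ ∞ Θ := contDiff_iff_contDiffAt.2 fun x ↦
    ContDiffAt.comp (f := fun x : EuclideanSpace ℝ (Fin a) × EuclideanSpace ℝ (Fin b) ↦
      (U₁ x.1, U₂ x.2)) x (het _ (hUt x)).1 ((hUd₁.comp contDiff_fst).prodMk (hUd₂.comp contDiff_snd)).contDiffAt
  have hΘt : Θ.target ⊆ e.source := by
    intro z hz
    have := hΘs (Θ.symm z)
    rwa [Θ.right_inv hz] at this
  have hΘsource : Θ.source = Set.univ := by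
    ext x
    simp only [Set.mem_univ, iff_true]
    refine ⟨⟨hUs₁ ▸ trivial, hUs₂ ▸ trivial⟩, hUt x⟩
  refine ⟨a, b, Θ, hΘsource, ?_, hΘd, ?_, ?_, fun z hz ↦ (hes z (hΘt hz)).2.2.2.2⟩
  · have h0 : Θ 0 = z₀ := by
      rw [hΘ_apply]
      simp only [U₁, U₂, Prod.fst_zero, Prod.snd_zero, OpenPartialHomeomorph.univBall_apply_zero]
      rw [← hef]
      exact e.left_inv he0
    rw [← h0]
    exact Θ.map_source (hΘsource ▸ trivial)
  · intro z hz
    have hz' := hΘt hz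
    have hfz : f z = (U₁ (Θ.symm z).1, U₂ (Θ.symm z).2) := by
      rw [← hfΘ, Θ.right_inv hz]
    have hb : f z ∈ Metric.ball (f z₀).1 r ×ˢ Metric.ball (f z₀).2 r := by
      rw [hfz]
      exact ⟨hU₁ ▸ U₁.map_source (hUs₁ ▸ trivial), hU₂ ▸ U₂.map_source (hUs₂ ▸ trivial)⟩
    have h1 : ContDiffAt ℝ ∞ U₁.symm (f z).1 :=
      OpenPartialHomeomorph.contDiffOn_univBall_symm.contDiffAt
        (Metric.isOpen_ball.mem_nhds hb.1)
    have h2 : ContDiffAt ℝ ∞ U₂.symm (f z).2 :=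
      OpenPartialHomeomorph.contDiffOn_univBall_symm.contDiffAt
        (Metric.isOpen_ball.mem_nhds hb.2)
    have hfz' := (hes z hz').1
    have h3 : ContDiffAt ℝ ∞ (fun z ↦ (U₁.symm (f z).1, U₂.symm (f z).2)) z :=
      (h1.comp z hfz'.fst).prodMk (h2.comp z hfz'.snd)
    have h4 : (Θ.symm : E → _) = fun z ↦ (U₁.symm (f z).1, U₂.symm (f z).2) := by
      funext z
      rw [← hef]
      rfl
    rw [h4]
    exact h3.contDiffWithinAt
  · intro x u v
    obtain ⟨hs1, -, hs2, hs3, -⟩ := hes _ (hΘs x)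
    have hcomp : fderiv ℝ f (Θ x) ∘L fderiv ℝ Θ x
        = (fderiv ℝ U₁ x.1).prodMap (fderiv ℝ U₂ x.2) := by
      have h1 : HasFDerivAt (fun x ↦ f (Θ x)) (fderiv ℝ f (Θ x) ∘L fderiv ℝ Θ x) x :=
        (hs1.differentiableAt (by simp)).hasFDerivAt.comp x
          (hΘd.differentiable (by simp) x).hasFDerivAt
      have h2 : HasFDerivAt (Prod.map U₁ U₂) ((fderiv ℝ U₁ x.1).prodMap (fderiv ℝ U₂ x.2)) x :=
        (hUd₁.differentiable (by simp) x.1).hasFDerivAt.prodMap x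
          (hUd₂.differentiable (by simp) x.2).hasFDerivAt
      exact h1.unique (h2.congr_of_eventuallyEq (Eventually.of_forall hfΘ))
    have hcomp' (w) : fderiv ℝ f (Θ x) (fderiv ℝ Θ x w)
        = (fderiv ℝ U₁ x.1 w.1, fderiv ℝ U₂ x.2 w.2) :=
      congrArg (fun L ↦ L w) hcomp
    apply hs2
    rw [hs3, hcomp', hcomp', map_zero]

end Straightening

section AlongMaps

variable {F : Type*} [NormedAddCommGroup F] [NormedSpace ℝ F]
  {E : Type*} [NormedAddCommGroup E] [NormedSpace ℝ E]
  {H : Type*} [TopologicalSpace H] {I : ModelWithCorners ℝ E H}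
  {M : Type*} [TopologicalSpace M] [ChartedSpace H M] [IsManifold I ∞ M]

/-- A vector field on a vector space is differentiable in the sense of manifolds if and only if it
is differentiable. -/
lemma mdifferentiableAt_vectorSpace_iff_differentiableAt
    {V : Π x : F, TangentSpace 𝓘(ℝ, F) x} {x : F} :
    MDiffAt (T% V) x ↔ DifferentiableAt ℝ (fun y ↦ (V y : F)) x := by
  rw [mdifferentiableAt_totalSpace]
  have hV : (fun y ↦ (trivializationAt F (TangentSpace 𝓘(ℝ, F)) x
      (⟨y, V y⟩ : TangentBundle 𝓘(ℝ, F) F)).2) = fun y ↦ (V y : F) := by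
    funext y
    simp
    rfl
  exact ⟨fun h ↦ mdifferentiableAt_iff_differentiableAt.1 (hV ▸ h.2), fun h ↦
    ⟨mdifferentiableAt_id, (mdifferentiableAt_iff_differentiableAt.2 (hV ▸ h) :)⟩⟩

/-- The velocity field `y ↦ dΨ_y u` along a smooth map `Ψ` is smooth. -/
lemma ContMDiffAt.mfderiv_apply_const {Ψ : F → M} {z : F} (hΨ : ContMDiffAt 𝓘(ℝ, F) I ∞ Ψ z)
    (u : F) : ContMDiffAt 𝓘(ℝ, F) I.tangent ∞
      (fun y ↦ (⟨Ψ y, mfderiv 𝓘(ℝ, F) I Ψ y u⟩ : TangentBundle I M)) z := by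
  have h1 := hΨ.mfderiv_const (m := ∞) le_rfl
  have h2 : ContMDiffAt 𝓘(ℝ, F) 𝓘(ℝ, F).tangent ∞
      (fun y ↦ (⟨y, u⟩ : TangentBundle 𝓘(ℝ, F) F)) z :=
    contMDiffAt_vectorSpace_iff_contDiffAt.2 contDiffAt_const
  exact ContMDiffAt.clm_apply_of_inCoordinates h1 h2 hΨ

/-- Pairing smooth vector fields along a map with a metric gives a smooth function. -/
lemma PseudoRiemannianMetric.contDiffAt_val_along (g : PseudoRiemannianMetric I M)
    {Ψ : F → M} {z : F} {V W : Π y : F, TangentSpace I (Ψ y)}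
    (hV : ContMDiffAt 𝓘(ℝ, F) I.tangent ∞ (fun y ↦ (⟨Ψ y, V y⟩ : TangentBundle I M)) z)
    (hW : ContMDiffAt 𝓘(ℝ, F) I.tangent ∞ (fun y ↦ (⟨Ψ y, W y⟩ : TangentBundle I M)) z) :
    ContDiffAt ℝ ∞ (fun y ↦ g.val (Ψ y) (V y) (W y)) z := by
  have hΨ : ContMDiffAt 𝓘(ℝ, F) I ∞ Ψ z := ((contMDiffAt_totalSpace).1 hV).1
  have : ContMDiffAt 𝓘(ℝ, F) (I.prod 𝓘(ℝ)) ∞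
      (fun y ↦ TotalSpace.mk' ℝ (E := Bundle.Trivial M ℝ) (Ψ y) (g.val (Ψ y) (V y) (W y))) z := by
    apply ContMDiffAt.clm_bundle_apply₂ (F₁ := E) (F₂ := E)
    · exact g.contMDiff.contMDiffAt.comp z hΨ
    · exact hV
    · exact hW
  simp only [contMDiffAt_totalSpace] at this
  exact this.2.contDiffAt

/-- The pullback of a metric by a map from a vector space, as a family of bilinear forms. -/
def PseudoRiemannianMetric.pullbackForm (g : PseudoRiemannianMetric I M) (Ψ : F → M) (y : F) :
    F →L[ℝ] F →L[ℝ] ℝ :=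
  ContinuousLinearMap.bilinearComp (E' := F) (F' := F) (E := E) (F := E) (g.val (Ψ y))
    (mfderiv 𝓘(ℝ, F) I Ψ y) (mfderiv 𝓘(ℝ, F) I Ψ y)

lemma PseudoRiemannianMetric.pullbackForm_apply (g : PseudoRiemannianMetric I M) (Ψ : F → M)
    (y u v : F) : g.pullbackForm Ψ y u v
      = g.val (Ψ y) (mfderiv 𝓘(ℝ, F) I Ψ y u) (mfderiv 𝓘(ℝ, F) I Ψ y v) := rfl

lemma contDiffAt_of_apply {F' : Type*} [NormedAddCommGroup F'] [NormedSpace ℝ F']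
    [FiniteDimensional ℝ F] {D : Type*} [NormedAddCommGroup D] [NormedSpace ℝ D]
    {B : D → F →L[ℝ] F'} {z : D} (h : ∀ u, ContDiffAt ℝ ∞ (fun y ↦ B y u) z) :
    ContDiffAt ℝ ∞ B z := by
  let e₁ := ContinuousLinearEquiv.ofFinrankEq
    (Module.finrank_fin_fun ℝ (n := Module.finrank ℝ F)).symm
  let e₂ := (e₁.arrowCongr (1 : F' ≃L[ℝ] F')).trans
    (ContinuousLinearEquiv.piRing (Fin (Module.finrank ℝ F)))
  rw [← Function.id_comp B, ← e₂.symm_comp_self]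
  exact e₂.symm.contDiff.contDiffAt.comp z (contDiffAt_pi.2 fun i ↦ h _)

lemma PseudoRiemannianMetric.contDiffAt_pullbackForm [FiniteDimensional ℝ F]
    (g : PseudoRiemannianMetric I M) {Ψ : F → M} {z : F} (hΨ : ContMDiffAt 𝓘(ℝ, F) I ∞ Ψ z) :
    ContDiffAt ℝ ∞ (g.pullbackForm Ψ) z :=
  contDiffAt_of_apply fun u ↦ contDiffAt_of_apply fun w ↦
    g.contDiffAt_val_along (hΨ.mfderiv_apply_const u) (hΨ.mfderiv_apply_const w)

end AlongMaps

section Coordinates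

open Filter

/-- The Christoffel symbols of the first kind of a family `G` of symmetric bilinear forms. -/
def christoffel {F : Type*} [NormedAddCommGroup F] [NormedSpace ℝ F]
    (G : F → F →L[ℝ] F →L[ℝ] ℝ) (z u v w : F) : ℝ :=
  (fderiv ℝ G z u v w + fderiv ℝ G z v u w - fderiv ℝ G z w u v) / 2

variable {F : Type*} [NormedAddCommGroup F] [NormedSpace ℝ F] [FiniteDimensional ℝ F]
  {E : Type*} [NormedAddCommGroup E] [NormedSpace ℝ E] [FiniteDimensional ℝ E]
  {H : Type*} [TopologicalSpace H] {I : ModelWithCorners ℝ E H}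
  {M : Type*} [TopologicalSpace M] [ChartedSpace H M] [IsManifold I ∞ M]
  (g : PseudoRiemannianMetric I M)

variable (I) in
/-- The coordinate expression of a vector field in a local parametrization `Φ`. -/
def coordField (Φ : F → M) (Y : Π x : M, TangentSpace I x) : F → F :=
  fun y ↦ mpullback 𝓘(ℝ, F) I Φ Y y

lemma IsLocalDiffeomorphAt.eventually {H₁ H₂ E₁ E₂ M₁ M₂ : Type*}
    [NormedAddCommGroup E₁] [NormedSpace ℝ E₁]
    [NormedAddCommGroup E₂] [NormedSpace ℝ E₂] [TopologicalSpace H₁] [TopologicalSpace H₂]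
    {I₁ : ModelWithCorners ℝ E₁ H₁} {I₂ : ModelWithCorners ℝ E₂ H₂}
    [TopologicalSpace M₁] [TopologicalSpace M₂] [ChartedSpace H₁ M₁] [ChartedSpace H₂ M₂]
    {f : M₁ → M₂} {x : M₁} {n : WithTop ℕ∞} (hf : IsLocalDiffeomorphAt I₁ I₂ n f x) :
    ∀ᶠ y in 𝓝 x, IsLocalDiffeomorphAt I₁ I₂ n f y := by
  obtain ⟨Φ, hx, he⟩ := hf
  filter_upwards [Φ.open_source.mem_nhds hx] with y hy
  exact ⟨Φ, hy, he⟩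

variable {Φ : F → M} {z : F}

omit [FiniteDimensional ℝ F] [FiniteDimensional ℝ E] [IsManifold I ∞ M] in
lemma IsLocalDiffeomorphAt.isInvertible_mfderiv (hΦ : IsLocalDiffeomorphAt 𝓘(ℝ, F) I ∞ Φ z) :
    (mfderiv 𝓘(ℝ, F) I Φ z).IsInvertible :=
  ⟨hΦ.mfderivToContinuousLinearEquiv (by simp), rfl⟩

omit [FiniteDimensional ℝ F] [FiniteDimensional ℝ E] [IsManifold I ∞ M] in
lemma mfderiv_coordField (hΦ : IsLocalDiffeomorphAt 𝓘(ℝ, F) I ∞ Φ z)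
    (Y : Π x : M, TangentSpace I x) :
    mfderiv 𝓘(ℝ, F) I Φ z (coordField (F := F) I Φ Y z) = Y (Φ z) := by
  obtain ⟨e, he⟩ := hΦ.isInvertible_mfderiv
  rw [coordField, mpullback_apply, ← he, ContinuousLinearMap.inverse_equiv]
  exact e.apply_symm_apply _

omit [FiniteDimensional ℝ E] in
lemma differentiableAt_coordField (hΦ : IsLocalDiffeomorphAt 𝓘(ℝ, F) I ∞ Φ z)
    {Y : Π x : M, TangentSpace I x} (hY : MDiffAt (T% Y) (Φ z)) :
    DifferentiableAt ℝ (coordField I Φ Y) z :=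
  mdifferentiableAt_vectorSpace_iff_differentiableAt.1
    (hY.mpullback_vectorField hΦ.contMDiffAt hΦ.isInvertible_mfderiv
      (WithTop.coe_le_coe.2 le_top))

omit [FiniteDimensional ℝ E] in
lemma mfderiv_coordField_lieBracket (hΦ : IsLocalDiffeomorphAt 𝓘(ℝ, F) I ∞ Φ z)
    {X Y : Π x : M, TangentSpace I x} (hX : MDiffAt (T% X) (Φ z)) (hY : MDiffAt (T% Y) (Φ z)) :
    mlieBracket I X Y (Φ z) = mfderiv 𝓘(ℝ, F) I Φ z
      (fderiv ℝ (coordField (F := F) I Φ Y) z (coordField I Φ X z)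
        - fderiv ℝ (coordField I Φ X) z (coordField I Φ Y z)) := by
  rw [← mfderiv_coordField hΦ (mlieBracket I X Y)]
  congr 1
  have hn : minSmoothness ℝ 2 ≤ ∞ := by
    rw [minSmoothness_of_isRCLikeNormedField]
    exact WithTop.coe_le_coe.2 le_top
  have : IsManifold I (minSmoothness ℝ 2) M := IsManifold.of_le hn
  have := mpullback_mlieBracket (n := ∞) hX hY hΦ.contMDiffAt hn
  rw [coordField, this, ← mlieBracketWithin_univ, mlieBracketWithin_eq_lieBracketWithin]
  change lieBracketWithin ℝ (coordField I Φ X) (coordField I Φ Y) Set.univ z = _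
  rw [lieBracketWithin_univ]
  rfl

omit [FiniteDimensional ℝ E] in
lemma mvfderiv_pair_apply (hΦ : IsLocalDiffeomorphAt 𝓘(ℝ, F) I ∞ Φ z)
    {X Y Z : Π x : M, TangentSpace I x} (hY : MDiffAt (T% Y) (Φ z)) (hZ : MDiffAt (T% Z) (Φ z)) :
    d% (g.pair Y Z) (Φ z) (X (Φ z))
      = fderiv ℝ (g.pullbackForm Φ) z (coordField I Φ X z) (coordField I Φ Y z) (coordField I Φ Z z)
        + g.pullbackForm Φ z (fderiv ℝ (coordField I Φ Y) z (coordField I Φ X z))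
          (coordField I Φ Z z)
        + g.pullbackForm Φ z (coordField I Φ Y z)
          (fderiv ℝ (coordField I Φ Z) z (coordField I Φ X z)) := by
  have h1 : (fun y ↦ g.pullbackForm Φ y (coordField I Φ Y y) (coordField I Φ Z y))
      =ᶠ[𝓝 z] g.pair Y Z ∘ Φ := by
    filter_upwards [hΦ.eventually] with y hy
    rw [PseudoRiemannianMetric.pullbackForm_apply, mfderiv_coordField hy, mfderiv_coordField hy]
    rfl
  have h2 : HasFDerivAt (fun y ↦ g.pullbackForm Φ y (coordField I Φ Y y) (coordField I Φ Z y))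
      _ z :=
    (((g.contDiffAt_pullbackForm hΦ.contMDiffAt).differentiableAt (by simp)).hasFDerivAt.clm_apply
      (differentiableAt_coordField hΦ hY).hasFDerivAt).clm_apply
      (differentiableAt_coordField hΦ hZ).hasFDerivAt
  have h3 := mvfderiv_comp_apply (I := I) (I' := 𝓘(ℝ, F)) (f := Φ) (g := g.pair Y Z) z
    (g.mdifferentiableAt_pair hY hZ) (hΦ.mdifferentiableAt (by simp)) (coordField (F := F) I Φ X z)
  rw [mfderiv_coordField hΦ] at h3
  rw [← h3]
  have h4 := congrArg (fun L : F →L[ℝ] ℝ ↦ L (coordField I Φ X z)) (h1.fderiv_eq.symm.trans h2.fderiv)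
  refine Eq.trans ?_ (h4.trans ?_)
  · simp [mvfderiv, mfderiv_eq_fderiv]
    rfl
  · simp
    ring

/-- The Levi-Civita connection in a local parametrization. -/
theorem PseudoRiemannianMetric.val_leviCivita_coord (hΦ : IsLocalDiffeomorphAt 𝓘(ℝ, F) I ∞ Φ z)
    {Y : Π x : M, TangentSpace I x} (hY : MDiffAt (T% Y) (Φ z)) (u w : F) :
    g.val (Φ z) (g.leviCivita Y (Φ z) (mfderiv 𝓘(ℝ, F) I Φ z u)) (mfderiv 𝓘(ℝ, F) I Φ z w)
      = g.pullbackForm Φ z (fderiv ℝ (coordField I Φ Y) z u) w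
        + christoffel (g.pullbackForm Φ) z u (coordField I Φ Y z) w := by
  obtain ⟨X, hX, hXu⟩ : ∃ X : Π x : M, TangentSpace I x, MDiffAt (T% X) (Φ z) ∧
      coordField I Φ X z = u := by
    refine ⟨FiberBundle.extend E (mfderiv 𝓘(ℝ, F) I Φ z u),
      FiberBundle.mdifferentiableAt_extend I E _, ?_⟩
    apply hΦ.isInvertible_mfderiv.injective
    rw [mfderiv_coordField hΦ, FiberBundle.extend_apply_self]
  obtain ⟨Z, hZ, hZw⟩ : ∃ Z : Π x : M, TangentSpace I x, MDiffAt (T% Z) (Φ z) ∧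
      coordField I Φ Z z = w := by
    refine ⟨FiberBundle.extend E (mfderiv 𝓘(ℝ, F) I Φ z w),
      FiberBundle.mdifferentiableAt_extend I E _, ?_⟩
    apply hΦ.isInvertible_mfderiv.injective
    rw [mfderiv_coordField hΦ, FiberBundle.extend_apply_self]
  have hsymm (a b : F) : g.pullbackForm Φ z a b = g.pullbackForm Φ z b a := g.symm _ _ _
  have key := g.val_leviCivita hX hY hZ
  have hval (a : F) (A : Π x : M, TangentSpace I x) :
      g.val (Φ z) (mfderiv 𝓘(ℝ, F) I Φ z a) (A (Φ z))
        = g.pullbackForm Φ z a (coordField I Φ A z) := by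
    rw [← mfderiv_coordField hΦ A]
    rfl
  rw [PseudoRiemannianMetric.koszul, mvfderiv_pair_apply g hΦ hY hZ, mvfderiv_pair_apply g hΦ hX hZ,
    mvfderiv_pair_apply g hΦ hX hY, mfderiv_coordField_lieBracket hΦ hX hY,
    mfderiv_coordField_lieBracket hΦ hX hZ, mfderiv_coordField_lieBracket hΦ hY hZ, hval, hval,
    hval, ← mfderiv_coordField hΦ X, ← mfderiv_coordField hΦ Z, hXu, hZw] at key
  simp only [map_sub, sub_apply] at key
  rw [christoffel]
  have e1 := hsymm u (fderiv ℝ (coordField I Φ Y) z w)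
  have e2 := hsymm u (fderiv ℝ (coordField I Φ Z) z (coordField I Φ Y z))
  have e3 := hsymm (coordField I Φ Y z) (fderiv ℝ (coordField I Φ Z) z u)
  linarith

end Coordinates

section CoordinateEndomorphisms

open Filter

variable {F : Type*} [NormedAddCommGroup F] [NormedSpace ℝ F] [FiniteDimensional ℝ F]
  {E : Type*} [NormedAddCommGroup E] [NormedSpace ℝ E] [FiniteDimensional ℝ E]
  {H : Type*} [TopologicalSpace H] {I : ModelWithCorners ℝ E H}
  {M : Type*} [TopologicalSpace M] [ChartedSpace H M] [IsManifold I ∞ M]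
  (g : PseudoRiemannianMetric I M)
  {Φ : F → M} {z : F}

omit [FiniteDimensional ℝ F] in
/-- A vector field whose coordinate expression is differentiable is differentiable. -/
lemma mdifferentiableAt_of_coordField (hΦ : IsLocalDiffeomorphAt 𝓘(ℝ, F) I ∞ Φ z)
    {Y : Π x : M, TangentSpace I x} (hY : DifferentiableAt ℝ (coordField (F := F) I Φ Y) z) :
    MDiffAt (T% Y) (Φ z) := by
  have hz : hΦ.localInverse (Φ z) = z := hΦ.localInverse_left_inv hΦ.localInverse_mem_target
  have hinv (p : F) (hp : p ∈ hΦ.localInverse.target) (hp' : IsLocalDiffeomorphAt 𝓘(ℝ, F) I ∞ Φ p) :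
      (mfderiv I 𝓘(ℝ, F) hΦ.localInverse (Φ p)).IsInvertible ∧
      ∀ v : F, mfderiv I 𝓘(ℝ, F) hΦ.localInverse (Φ p) (mfderiv 𝓘(ℝ, F) I Φ p v) = v := by
    have hs : Φ p ∈ hΦ.localInverse.source := by
      have h1 := hΦ.localInverse.toPartialEquiv.map_target hp
      have h2 := hΦ.localInverse_left_inv hp
      have h3 := hΦ.localInverse_right_inv h1
      have h4 : hΦ.localInverse.toPartialEquiv (hΦ.localInverse.toPartialEquiv.symm p) = p :=
        hΦ.localInverse.toPartialEquiv.right_inv hp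
      rw [h4] at h3
      rwa [h3]
    have hd : IsLocalDiffeomorphAt I 𝓘(ℝ, F) ∞ hΦ.localInverse (Φ p) :=
      hΦ.localInverse.isLocalDiffeomorphAt _ _ _ hs
    refine ⟨⟨hd.mfderivToContinuousLinearEquiv (by simp), rfl⟩, fun v ↦ ?_⟩
    have h5 := mfderiv_comp p (hd.mdifferentiableAt (by simp)) (hp'.mdifferentiableAt (by simp))
    have h6 : hΦ.localInverse ∘ Φ =ᶠ[𝓝 p] id :=
      eventuallyEq_of_mem (hΦ.localInverse.open_target.mem_nhds hp) hΦ.localInverse_eqOn_left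
    rw [h6.mfderiv_eq, mfderiv_id] at h5
    exact (congrArg (fun L : F →L[ℝ] F ↦ L v) h5).symm
  have h1 : MDiffAt (T% (mpullback I 𝓘(ℝ, F) hΦ.localInverse
      (fun p ↦ (coordField (F := F) I Φ Y p : TangentSpace 𝓘(ℝ, F) p)))) (Φ z) := by
    refine MDifferentiableAt.mpullback_vectorField (n := ∞) ?_ hΦ.localInverse_contMDiffAt
      (hinv z hΦ.localInverse_mem_target hΦ).1 (WithTop.coe_le_coe.2 le_top)
    rw [hz]
    exact mdifferentiableAt_vectorSpace_iff_differentiableAt.2 hY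
  refine h1.congr_of_eventuallyEq ?_
  have h2 : ∀ᶠ y in 𝓝 (Φ z), hΦ.localInverse y ∈ hΦ.localInverse.target ∧
      IsLocalDiffeomorphAt 𝓘(ℝ, F) I ∞ Φ (hΦ.localInverse y) := by
    apply hΦ.localInverse_contMDiffAt.continuousAt.eventually
      (p := fun p ↦ p ∈ hΦ.localInverse.target ∧ IsLocalDiffeomorphAt 𝓘(ℝ, F) I ∞ Φ p)
    rw [hz]
    exact Filter.Eventually.and (hΦ.localInverse.open_target.mem_nhds
      hΦ.localInverse_mem_target) hΦ.eventually
  filter_upwards [h2, hΦ.localInverse_eventuallyEq_right] with y hy hy'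
  have hy'' : Φ (hΦ.localInverse y) = y := hy'
  generalize hΦ.localInverse y = p at hy hy''
  subst hy''
  congr 1
  obtain ⟨h3, h4⟩ := hinv p hy.1 hy.2
  have h5 := h4 (coordField (F := F) I Φ Y p)
  rw [mfderiv_coordField hy.2] at h5
  have h6 := h3.inverse_apply_self (Y (Φ p))
  rw [h5] at h6
  refine h6.symm.trans ?_
  change _ = (mfderiv I 𝓘(ℝ, F) hΦ.localInverse (Φ p)).inverse
    (coordField (F := F) I Φ Y (hΦ.localInverse (Φ p)))
  rw [hΦ.localInverse_left_inv hy.1]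

variable (I) in
/-- The coordinate expression of a field of endomorphisms in a local parametrization `Φ`. -/
def coordEndo (Φ : F → M) (A : Π x : M, TangentSpace I x →L[ℝ] TangentSpace I x) (y : F) :
    F →L[ℝ] F :=
  let L : F →L[ℝ] E := mfderiv 𝓘(ℝ, F) I Φ y
  let B : E →L[ℝ] E := A (Φ y)
  L.inverse ∘L B ∘L L

omit [FiniteDimensional ℝ F] [FiniteDimensional ℝ E] [IsManifold I ∞ M] in
lemma IsLocalDiffeomorphAt.mfderiv_surjective (hΦ : IsLocalDiffeomorphAt 𝓘(ℝ, F) I ∞ Φ z)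
    (w : TangentSpace I (Φ z)) : ∃ v : F, mfderiv 𝓘(ℝ, F) I Φ z v = w := by
  obtain ⟨e, he⟩ := hΦ.isInvertible_mfderiv
  exact ⟨e.symm w, by rw [← he]; exact e.apply_symm_apply w⟩

omit [FiniteDimensional ℝ F] [FiniteDimensional ℝ E] [IsManifold I ∞ M] in
lemma IsLocalDiffeomorphAt.mfderiv_injective (hΦ : IsLocalDiffeomorphAt 𝓘(ℝ, F) I ∞ Φ z)
    {v w : F} (h : mfderiv 𝓘(ℝ, F) I Φ z v = mfderiv 𝓘(ℝ, F) I Φ z w) : v = w :=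
  hΦ.isInvertible_mfderiv.injective h

omit [FiniteDimensional ℝ F] [FiniteDimensional ℝ E] [IsManifold I ∞ M] in
lemma mfderiv_coordEndo (hΦ : IsLocalDiffeomorphAt 𝓘(ℝ, F) I ∞ Φ z)
    (A : Π x : M, TangentSpace I x →L[ℝ] TangentSpace I x) (v : F) :
    mfderiv 𝓘(ℝ, F) I Φ z (coordEndo (F := F) I Φ A z v)
      = A (Φ z) (mfderiv 𝓘(ℝ, F) I Φ z v) := by
  exact hΦ.isInvertible_mfderiv.self_apply_inverse _

omit [FiniteDimensional ℝ E] in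
lemma PseudoRiemannianMetric.isInvertible_pullbackForm (hΦ : IsLocalDiffeomorphAt 𝓘(ℝ, F) I ∞ Φ z) :
    (g.pullbackForm Φ z).IsInvertible := by
  have hinj : Function.Injective (g.pullbackForm Φ z) := by
    rw [injective_iff_map_eq_zero]
    intro v hv
    apply hΦ.mfderiv_injective
    refine (g.nondegenerate _ _ fun w ↦ ?_).trans (map_zero (mfderiv 𝓘(ℝ, F) I Φ z)).symm
    obtain ⟨w, rfl⟩ := hΦ.mfderiv_surjective w
    exact congrArg (fun L : F →L[ℝ] ℝ ↦ L w) hv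
  have hrank : Module.finrank ℝ F = Module.finrank ℝ (F →L[ℝ] ℝ) := by
    rw [← LinearEquiv.finrank_eq
        (LinearMap.toContinuousLinearMap (𝕜 := ℝ) (E := F) (F' := ℝ))]
    exact Subspace.dual_finrank_eq.symm
  exact ⟨(LinearEquiv.ofInjectiveOfFinrankEq (g.pullbackForm Φ z).toLinearMap hinj
    hrank).toContinuousLinearEquiv, by ext; rfl⟩

omit [FiniteDimensional ℝ F] [FiniteDimensional ℝ E] in
lemma PseudoRiemannianMetric.pullbackForm_coordEndo (hΦ : IsLocalDiffeomorphAt 𝓘(ℝ, F) I ∞ Φ z)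
    (A : Π x : M, TangentSpace I x →L[ℝ] TangentSpace I x) (v w : F) :
    g.pullbackForm Φ z (coordEndo I Φ A z v) w
      = g.val (Φ z) (A (Φ z) (mfderiv 𝓘(ℝ, F) I Φ z v)) (mfderiv 𝓘(ℝ, F) I Φ z w) := by
  rw [pullbackForm_apply, mfderiv_coordEndo hΦ]

omit [FiniteDimensional ℝ E] in
/-- The coordinate expression of a field of endomorphisms is smooth as soon as the associated
bilinear form is smooth. -/
lemma PseudoRiemannianMetric.contDiffAt_coordEndo (hΦ : IsLocalDiffeomorphAt 𝓘(ℝ, F) I ∞ Φ z)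
    {A : Π x : M, TangentSpace I x →L[ℝ] TangentSpace I x}
    (hA : ∀ v w : F, ContDiffAt ℝ ∞ (fun y ↦ g.val (Φ y) (A (Φ y) (mfderiv 𝓘(ℝ, F) I Φ y v))
      (mfderiv 𝓘(ℝ, F) I Φ y w)) z) :
    ContDiffAt ℝ ∞ (coordEndo (F := F) I Φ A) z := by
  have h1 : ContDiffAt ℝ ∞ (fun y ↦ (g.pullbackForm Φ y) ∘L (coordEndo (F := F) I Φ A y)) z :=
    contDiffAt_of_apply fun v ↦ contDiffAt_of_apply fun w ↦
      (hA v w).congr_of_eventuallyEq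
        (hΦ.eventually.mono fun y hy ↦ g.pullbackForm_coordEndo hy A v w)
  have h2 : ContDiffAt ℝ ∞ (fun y ↦ (g.pullbackForm Φ y).inverse) z :=
    (g.isInvertible_pullbackForm hΦ).contDiffAt_map_inverse.comp z
      (g.contDiffAt_pullbackForm hΦ.contMDiffAt)
  refine (h2.clm_comp h1).congr_of_eventuallyEq (hΦ.eventually.mono fun y hy ↦ ?_)
  obtain ⟨e, he⟩ := g.isInvertible_pullbackForm hy
  ext v
  simp [← he]

/-- The (lowered) coordinate expression of the covariant derivative of a field of skew
endomorphisms `Π` for the metric `G`. -/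
def covDefect (G : F → F →L[ℝ] F →L[ℝ] ℝ) (A : F → F →L[ℝ] F) (z u v w : F) : ℝ :=
  G z (fderiv ℝ A z u v) w + christoffel G z u (A z v) w + christoffel G z u v (A z w)

/-- A field of skew endomorphisms is parallel if and only if its coordinate expressions satisfy a
first order equation. -/
theorem PseudoRiemannianMetric.parallel_iff_covDefect (hΦ : IsLocalDiffeomorphAt 𝓘(ℝ, F) I ∞ Φ z)
    {A : Π x : M, TangentSpace I x →L[ℝ] TangentSpace I x}
    (hskew : ∀ v w : TangentSpace I (Φ z),
      g.val (Φ z) (A (Φ z) v) w = -g.val (Φ z) v (A (Φ z) w))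
    (hA : DifferentiableAt ℝ (coordEndo (F := F) I Φ A) z) :
    (∀ V : Π x : M, TangentSpace I x, MDiffAt (T% V) (Φ z) → ∀ u : TangentSpace I (Φ z),
      g.leviCivita (fun y ↦ A y (V y)) (Φ z) u = A (Φ z) (g.leviCivita V (Φ z) u)) ↔
    ∀ u v w : F, covDefect (g.pullbackForm Φ) (coordEndo I Φ A) z u v w = 0 := by
  have key (V : Π x : M, TangentSpace I x) (hV : MDiffAt (T% V) (Φ z)) (u w : F) :
      g.val (Φ z) (g.leviCivita (fun y ↦ A y (V y)) (Φ z) (mfderiv 𝓘(ℝ, F) I Φ z u)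
        - A (Φ z) (g.leviCivita V (Φ z) (mfderiv 𝓘(ℝ, F) I Φ z u))) (mfderiv 𝓘(ℝ, F) I Φ z w)
      = covDefect (g.pullbackForm Φ) (coordEndo I Φ A) z u (coordField I Φ V z) w := by
    have h1 : coordField (F := F) I Φ (fun y ↦ A y (V y))
        =ᶠ[𝓝 z] fun y ↦ coordEndo (F := F) I Φ A y (coordField (F := F) I Φ V y) := by
      filter_upwards [hΦ.eventually] with y hy
      apply hy.isInvertible_mfderiv.injective
      rw [mfderiv_coordField hy, mfderiv_coordEndo hy, mfderiv_coordField hy]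
    have h2 := hA.hasFDerivAt.clm_apply (differentiableAt_coordField hΦ hV).hasFDerivAt
    have h3 : MDiffAt (T% (fun y ↦ A y (V y))) (Φ z) :=
      mdifferentiableAt_of_coordField hΦ (h2.differentiableAt.congr_of_eventuallyEq h1)
    rw [map_sub, sub_apply, g.val_leviCivita_coord hΦ h3, hskew, ← mfderiv_coordEndo (F := F) hΦ A w,
      g.val_leviCivita_coord hΦ hV, h1.fderiv_eq, h2.fderiv, h1.eq_of_nhds, covDefect]
    have h4 : g.pullbackForm Φ z (coordEndo I Φ A z (fderiv ℝ (coordField I Φ V) z u)) w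
        = -g.pullbackForm Φ z (fderiv ℝ (coordField I Φ V) z u) (coordEndo I Φ A z w) := by
      rw [pullbackForm_apply, pullbackForm_apply, mfderiv_coordEndo hΦ, mfderiv_coordEndo hΦ, hskew]
    simp only [add_apply, ContinuousLinearMap.coe_comp, Function.comp_apply, map_add, h4,
      ContinuousLinearMap.flip_apply]
    ring
  constructor
  · intro h u v w
    have hV := FiberBundle.mdifferentiableAt_extend I E (mfderiv 𝓘(ℝ, F) I Φ z v)
    have h1 := key _ hV u w
    rw [h _ hV, sub_self, map_zero, zero_apply] at h1
    have h2 : coordField (F := F) I Φ (FiberBundle.extend E (mfderiv 𝓘(ℝ, F) I Φ z v)) z = v := by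
      apply hΦ.isInvertible_mfderiv.injective
      rw [mfderiv_coordField hΦ, FiberBundle.extend_apply_self]
    rw [h2] at h1
    exact h1.symm
  · intro h V hV u
    obtain ⟨u, rfl⟩ := hΦ.mfderiv_surjective u
    rw [← sub_eq_zero]
    refine g.nondegenerate _ _ fun w ↦ ?_
    obtain ⟨w, rfl⟩ := hΦ.mfderiv_surjective w
    rw [key V hV, h]

end CoordinateEndomorphisms

section Calculus

open Filter

variable {F : Type*} [NormedAddCommGroup F] [NormedSpace ℝ F]
  {F' : Type*} [NormedAddCommGroup F'] [NormedSpace ℝ F']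

lemma christoffel_add_mid (G : F → F →L[ℝ] F →L[ℝ] ℝ) (z u v v' w : F) :
    christoffel G z u (v + v') w = christoffel G z u v w + christoffel G z u v' w := by
  rw [christoffel, (fderiv ℝ G z).map_add, (fderiv ℝ G z u).map_add, (fderiv ℝ G z w u).map_add,
    christoffel, christoffel]
  simp only [add_apply]
  ring

lemma christoffel_add_right (G : F → F →L[ℝ] F →L[ℝ] ℝ) (z u v w w' : F) :
    christoffel G z u v (w + w') = christoffel G z u v w + christoffel G z u v w' := by
  rw [christoffel, (fderiv ℝ G z).map_add, (fderiv ℝ G z u v).map_add,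
    (fderiv ℝ G z v u).map_add, christoffel, christoffel]
  simp only [add_apply]
  ring

lemma christoffel_zero_mid (G : F → F →L[ℝ] F →L[ℝ] ℝ) (z u w : F) :
    christoffel G z u 0 w = 0 := by
  simpa using christoffel_add_mid G z u 0 0 w

lemma christoffel_zero_right (G : F → F →L[ℝ] F →L[ℝ] ℝ) (z u v : F) :
    christoffel G z u v 0 = 0 := by
  simpa using christoffel_add_right G z u v 0 0

lemma covDefect_add_mid (G : F → F →L[ℝ] F →L[ℝ] ℝ) (A : F → F →L[ℝ] F) (z u v v' w : F) :
    covDefect G A z u (v + v') w = covDefect G A z u v w + covDefect G A z u v' w := by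
  rw [covDefect, (fderiv ℝ A z u).map_add, (A z).map_add, (G z).map_add, christoffel_add_mid,
    christoffel_add_mid, covDefect, covDefect]
  simp only [add_apply]
  ring

lemma covDefect_add_right (G : F → F →L[ℝ] F →L[ℝ] ℝ) (A : F → F →L[ℝ] F) (z u v w w' : F) :
    covDefect G A z u v (w + w') = covDefect G A z u v w + covDefect G A z u v w' := by
  rw [covDefect, (A z).map_add, (G z _).map_add, christoffel_add_right,
    christoffel_add_right, covDefect, covDefect]
  ring

lemma hasFDerivAt_comp_of_differentiableAt {B : Type*} [NormedAddCommGroup B] [NormedSpace ℝ B]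
    {G : F' → B} {j : F → F'} {z : F} (hj : DifferentiableAt ℝ j z)
    (hG : DifferentiableAt ℝ G (j z)) :
    HasFDerivAt (fun y ↦ G (j y)) (fderiv ℝ G (j z) ∘L fderiv ℝ j z) z :=
  hG.hasFDerivAt.comp (g := G) z hj.hasFDerivAt

lemma fderiv_bilin_apply {G : F → F →L[ℝ] F →L[ℝ] ℝ} {z : F} (hG : DifferentiableAt ℝ G z)
    (u v w : F) : fderiv ℝ G z u v w = fderiv ℝ (fun y ↦ G y v w) z u := by
  have h := (hG.hasFDerivAt.clm_apply (hasFDerivAt_const v z)).clm_apply (hasFDerivAt_const w z)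
  rw [h.fderiv]
  simp

/-- If a bilinear form vanishes on two vectors along a neighbourhood, so does its derivative. -/
lemma fderiv_bilin_apply_eq_zero {G : F → F →L[ℝ] F →L[ℝ] ℝ} {z : F}
    (hG : DifferentiableAt ℝ G z) (u : F) {v w : F} (h : ∀ᶠ y in 𝓝 z, G y v w = 0) :
    fderiv ℝ G z u v w = 0 := by
  rw [fderiv_bilin_apply hG]
  have : (fun y ↦ G y v w) =ᶠ[𝓝 z] fun _ ↦ (0 : ℝ) := h
  rw [this.fderiv_eq]
  simp

lemma fderiv_bilin_symm {G : F → F →L[ℝ] F →L[ℝ] ℝ} {z : F}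
    (hG : DifferentiableAt ℝ G z) (u v w : F) (h : ∀ᶠ y in 𝓝 z, ∀ v w, G y v w = G y w v) :
    fderiv ℝ G z u v w = fderiv ℝ G z u w v := by
  rw [fderiv_bilin_apply hG, fderiv_bilin_apply hG]
  have : (fun y ↦ G y v w) =ᶠ[𝓝 z] fun y ↦ G y w v := h.mono fun y hy ↦ hy v w
  rw [this.fderiv_eq]

/-- The derivative of a bilinear form along `v` is zero on a pair of vectors if the form on that
pair does not depend on the position along the direction `v`. -/
lemma fderiv_bilin_apply_eq_zero_of_line {G : F → F →L[ℝ] F →L[ℝ] ℝ} {z : F}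
    (hG : DifferentiableAt ℝ G z) {u v w : F}
    (h : ∀ᶠ t : ℝ in 𝓝 0, G (z + t • v) u w = G z u w) :
    fderiv ℝ G z v u w = 0 := by
  rw [fderiv_bilin_apply hG]
  have h1 : DifferentiableAt ℝ (fun y ↦ G y u w) z :=
    (hG.clm_apply (differentiableAt_const u)).clm_apply (differentiableAt_const w)
  have h2 : lineDeriv ℝ (fun y ↦ G y u w) z v = 0 := by
    rw [lineDeriv]
    have : (fun t : ℝ ↦ G (z + t • v) u w) =ᶠ[𝓝 0] fun _ ↦ G z u w := h
    rw [this.deriv_eq]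
    simp
  rw [← h1.lineDeriv_eq_fderiv, h2]

set_option synthInstance.maxHeartbeats 200000 in
/-- The Gauss formula: Christoffel symbols of an induced metric. -/
lemma christoffel_pullback {G : F → F →L[ℝ] F →L[ℝ] ℝ} {G' : F' → F' →L[ℝ] F' →L[ℝ] ℝ}
    {j : F → F'} {z : F} (hj : ContDiffAt ℝ ∞ j z) (hG : DifferentiableAt ℝ G z)
    (hG' : DifferentiableAt ℝ G' (j z)) (hsymm : ∀ a b, G' (j z) a b = G' (j z) b a)
    (h : ∀ᶠ y in 𝓝 z, ∀ u v, G y u v = G' (j y) (fderiv ℝ j y u) (fderiv ℝ j y v)) (u v w : F) :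
    christoffel G z u v w
      = christoffel G' (j z) (fderiv ℝ j z u) (fderiv ℝ j z v) (fderiv ℝ j z w)
        + G' (j z) (fderiv ℝ (fderiv ℝ j) z u v) (fderiv ℝ j z w) := by
  have h2 : (2 : WithTop ℕ∞) ≤ ∞ := WithTop.coe_le_coe.2 le_top
  have hd : DifferentiableAt ℝ (fderiv ℝ j) z :=
    (hj.fderiv_right (m := ∞) le_rfl).differentiableAt (by simp)
  have hs : ∀ a b, fderiv ℝ (fderiv ℝ j) z a b = fderiv ℝ (fderiv ℝ j) z b a :=
    hj.isSymmSndFDerivAt (by rw [minSmoothness_of_isRCLikeNormedField]; exact h2)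
  have key (a b c : F) : fderiv ℝ G z a b c
      = fderiv ℝ G' (j z) (fderiv ℝ j z a) (fderiv ℝ j z b) (fderiv ℝ j z c)
        + G' (j z) (fderiv ℝ (fderiv ℝ j) z a b) (fderiv ℝ j z c)
        + G' (j z) (fderiv ℝ j z b) (fderiv ℝ (fderiv ℝ j) z a c) := by
    have h1 : (fun y ↦ G y b c) =ᶠ[𝓝 z] fun y ↦ G' (j y) (fderiv ℝ j y b) (fderiv ℝ j y c) :=
      h.mono fun y hy ↦ hy b c
    have h0 : HasFDerivAt (fun y ↦ G' (j y)) (fderiv ℝ G' (j z) ∘L fderiv ℝ j z) z :=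
      hasFDerivAt_comp_of_differentiableAt (B := F' →L[ℝ] F' →L[ℝ] ℝ) (G := G')
        (hj.differentiableAt (by simp)) hG'
    have h3 := (h0.clm_apply
      (hd.hasFDerivAt.clm_apply (hasFDerivAt_const b z))).clm_apply
      (hd.hasFDerivAt.clm_apply (hasFDerivAt_const c z))
    rw [fderiv_bilin_apply hG, h1.fderiv_eq]
    rw [h3.fderiv]
    simp
    ring
  simp only [christoffel, key]
  rw [hs w u, hs w v, hs v u, hsymm (fderiv ℝ j z v), hsymm (fderiv ℝ j z u)]
  ring

variable {E₁ : Type*} [NormedAddCommGroup E₁] [NormedSpace ℝ E₁]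
  {E₂ : Type*} [NormedAddCommGroup E₂] [NormedSpace ℝ E₂]

lemma christoffel_inr_inl_eq_zero {G : E₁ × E₂ → (E₁ × E₂) →L[ℝ] (E₁ × E₂) →L[ℝ] ℝ} {z : E₁ × E₂}
    (hG : DifferentiableAt ℝ G z) (hsymm : ∀ᶠ y in 𝓝 z, ∀ v w, G y v w = G y w v)
    (h₀ : ∀ᶠ y in 𝓝 z, ∀ v w, G y (v, 0) (0, w) = 0)
    (h₁ : ∀ v w, ∀ u : E₁, fderiv ℝ G z (0, w) (u, 0) (v, 0) = 0)
    (h₂ : ∀ v w, ∀ u : E₂, fderiv ℝ G z (v, 0) (0, u) (0, w) = 0)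
    (u : E₁ × E₂) (v : E₁) (w : E₂) :
    christoffel G z u (v, 0) (0, w) = 0 ∧ christoffel G z u (0, w) (v, 0) = 0 := by
  have h3 (a : E₁ × E₂) : fderiv ℝ G z a (v, 0) (0, w) = 0 :=
    fderiv_bilin_apply_eq_zero hG a (h₀.mono fun y hy ↦ hy v w)
  have h3' (a : E₁ × E₂) : fderiv ℝ G z a (0, w) (v, 0) = 0 := by
    rw [fderiv_bilin_symm hG _ _ _ hsymm, h3]
  have hu : u = (u.1, 0) + (0, u.2) := by simp
  have h4 : fderiv ℝ G z (v, 0) u (0, w) = 0 := by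
    rw [hu, (fderiv ℝ G z (v, 0)).map_add, add_apply, h₂, add_zero]
    exact fderiv_bilin_apply_eq_zero hG _ (h₀.mono fun y hy ↦ hy _ w)
  have h5 : fderiv ℝ G z (0, w) u (v, 0) = 0 := by
    rw [hu, (fderiv ℝ G z (0, w)).map_add, add_apply, h₁, zero_add, fderiv_bilin_symm hG _ _ _ hsymm]
    exact fderiv_bilin_apply_eq_zero hG _ (h₀.mono fun y hy ↦ hy v _)
  rw [christoffel, christoffel, h3, h3', h4, h5]
  simp

/-- The covariant derivative of a skew endomorphism field which is induced from a parallel one on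
the first factor of a product metric, and which vanishes on the second factor. -/
lemma covDefect_eq_zero_of_product {G : E₁ × E₂ → (E₁ × E₂) →L[ℝ] (E₁ × E₂) →L[ℝ] ℝ}
    {A : E₁ × E₂ → (E₁ × E₂) →L[ℝ] (E₁ × E₂)} {z : E₁ × E₂}
    {G' : F' → F' →L[ℝ] F' →L[ℝ] ℝ} {A' : F' → F' →L[ℝ] F'} {j : E₁ × E₂ → F'}
    [FiniteDimensional ℝ F'] [FiniteDimensional ℝ E₁] [FiniteDimensional ℝ E₂]
    (hG : DifferentiableAt ℝ G z) (hA : DifferentiableAt ℝ A z)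
    (hsymm : ∀ᶠ y in 𝓝 z, ∀ v w, G y v w = G y w v)
    (h₀ : ∀ᶠ y in 𝓝 z, ∀ v w, G y (v, 0) (0, w) = 0)
    (h₁ : ∀ v w, ∀ u : E₁, fderiv ℝ G z (0, w) (u, 0) (v, 0) = 0)
    (h₂ : ∀ v w, ∀ u : E₂, fderiv ℝ G z (v, 0) (0, u) (0, w) = 0)
    (hA₁ : ∀ᶠ y in 𝓝 z, ∀ v, (A y (v, 0)).2 = 0) (hA₂ : ∀ᶠ y in 𝓝 z, ∀ w, A y (0, w) = 0)
    (hj : ContDiffAt ℝ ∞ j z) (hG' : DifferentiableAt ℝ G' (j z))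
    (hA' : DifferentiableAt ℝ A' (j z))
    (hsymm' : ∀ a b, G' (j z) a b = G' (j z) b a)
    (hskew' : ∀ a b, G' (j z) (A' (j z) a) b = - G' (j z) a (A' (j z) b))
    (hGG' : ∀ᶠ y in 𝓝 z, ∀ u v, G y u v = G' (j y) (fderiv ℝ j y u) (fderiv ℝ j y v))
    (hAA' : ∀ᶠ y in 𝓝 z, ∀ v, fderiv ℝ j y (A y (v, 0)) = A' (j y) (fderiv ℝ j y (v, 0)))
    (hpar : ∀ u v w, covDefect G' A' (j z) u v w = 0) (u v w : E₁ × E₂) :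
    covDefect G A z u v w = 0 := by
  have hΓ := christoffel_inr_inl_eq_zero hG hsymm h₀ h₁ h₂
  have hdA (a : E₁ × E₂) : HasFDerivAt (fun y ↦ A y a) ((fderiv ℝ A z).flip a) z := by
    simpa using hA.hasFDerivAt.clm_apply (hasFDerivAt_const a z)
  have hd₂ (w : E₂) : fderiv ℝ A z u (0, w) = 0 := by
    have h3 : (fun y ↦ A y (0, w)) =ᶠ[𝓝 z] fun _ ↦ 0 := hA₂.mono fun y hy ↦ hy w
    have h4 := (hdA (0, w)).fderiv
    rw [h3.fderiv_eq] at h4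
    simpa using (congrArg (fun L ↦ L u) h4).symm
  have hd₁ (v : E₁) : (fderiv ℝ A z u (v, 0)).2 = 0 := by
    have h3 : (fun y ↦ (A y (v, 0)).2) =ᶠ[𝓝 z] fun _ ↦ 0 := hA₁.mono fun y hy ↦ hy v
    have h4 := (hdA (v, 0)).snd.fderiv
    rw [h3.fderiv_eq] at h4
    simpa using (congrArg (fun L ↦ L u) h4).symm
  have hsplit (a : E₁ × E₂) : a = (a.1, 0) + (0, a.2) := by simp
  have hr (a : E₁ × E₂) : A z a = ((A z a).1, 0) := by
    have h5 : (A z a).2 = 0 := by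
      rw [hsplit a, map_add, hA₂.self_of_nhds, add_zero, hA₁.self_of_nhds]
    exact Prod.ext rfl h5
  suffices h : ∀ a b : E₁, covDefect G A z u (a, 0) (b, 0) = 0 by
    have h6 (w : E₁ × E₂) (b : E₂) : covDefect G A z u (0, b) w = 0 := by
      rw [covDefect, hd₂, hA₂.self_of_nhds, christoffel_zero_mid, hr w, (hΓ u _ _).2]
      simp
    have h7 (a : E₁) (b : E₂) : covDefect G A z u (a, 0) (0, b) = 0 := by
      have h8 : fderiv ℝ A z u (a, 0) = ((fderiv ℝ A z u (a, 0)).1, 0) := Prod.ext rfl (hd₁ a)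
      rw [covDefect, h8, h₀.self_of_nhds, hr, (hΓ u _ _).1, hA₂.self_of_nhds,
        christoffel_zero_right]
      simp
    rw [hsplit v, covDefect_add_mid, h6, add_zero, hsplit w, covDefect_add_right, h, h7, add_zero]
  intro a b
  have hd : DifferentiableAt ℝ (fderiv ℝ j) z :=
    (hj.fderiv_right (m := ∞) le_rfl).differentiableAt (by simp)
  have hgauss := christoffel_pullback hj hG hG' hsymm' hGG'
  have hdiff : fderiv ℝ (fderiv ℝ j) z u (A z (a, 0)) + fderiv ℝ j z (fderiv ℝ A z u (a, 0))
      = fderiv ℝ A' (j z) (fderiv ℝ j z u) (fderiv ℝ j z (a, 0))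
        + A' (j z) (fderiv ℝ (fderiv ℝ j) z u (a, 0)) := by
    have h3 : (fun y ↦ fderiv ℝ j y (A y (a, 0)))
        =ᶠ[𝓝 z] fun y ↦ A' (j y) (fderiv ℝ j y (a, 0)) := hAA'.mono fun y hy ↦ hy a
    have h4 := hd.hasFDerivAt.clm_apply (hdA (a, 0))
    have h5 := (hA'.hasFDerivAt.comp z (hj.differentiableAt (by simp)).hasFDerivAt).clm_apply
      (hd.hasFDerivAt.clm_apply (hasFDerivAt_const ((a, 0) : E₁ × E₂) z))
    have h6 := h4.fderiv.symm.trans (h3.fderiv_eq.trans h5.fderiv)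
    have h7 := congrArg (fun L ↦ L u) h6
    simp at h7
    rw [add_comm, h7, add_comm]
  have hp := hpar (fderiv ℝ j z u) (fderiv ℝ j z (a, 0)) (fderiv ℝ j z (b, 0))
  rw [covDefect] at hp
  rw [covDefect, hgauss, hgauss, hGG'.self_of_nhds, hAA'.self_of_nhds, hAA'.self_of_nhds]
  have e1 := congrArg (fun x ↦ G' (j z) x (fderiv ℝ j z (b, 0))) hdiff
  simp only [map_add, add_apply] at e1
  have e2 := hskew' (fderiv ℝ (fderiv ℝ j) z u (a, 0)) (fderiv ℝ j z (b, 0))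
  linarith

end Calculus

section ParallelEndomorphisms

open Filter

variable {F : Type*} [NormedAddCommGroup F] [NormedSpace ℝ F] [FiniteDimensional ℝ F]

omit [FiniteDimensional ℝ F] in
lemma christoffel_smul_right (G : F → F →L[ℝ] F →L[ℝ] ℝ) (z u v w : F) (c : ℝ) :
    christoffel G z u v (c • w) = c * christoffel G z u v w := by
  rw [christoffel, (fderiv ℝ G z).map_smul, (fderiv ℝ G z u v).map_smul,
    (fderiv ℝ G z v u).map_smul, christoffel]
  simp only [smul_apply, smul_eq_mul]
  ring

/-- The derivative of the square of a parallel skew endomorphism field is controlled by the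
Christoffel symbols. -/
lemma exists_fderiv_comp_self_eq {G : F → F →L[ℝ] F →L[ℝ] ℝ} {A : F → F →L[ℝ] F} {z : F}
    (hG : DifferentiableAt ℝ G z) (hA : DifferentiableAt ℝ A z)
    (hsymm : ∀ᶠ y in 𝓝 z, ∀ v w, G y v w = G y w v) (hinv : (G z).IsInvertible)
    (hskew : ∀ v w, G z (A z v) w = -G z v (A z w)) (hpar : ∀ u v w, covDefect G A z u v w = 0) :
    ∃ C : F → F → F, (∀ u v, C u v = C v u) ∧ (∀ u, C u 0 = 0) ∧
      ∀ u v, fderiv ℝ (fun y ↦ A y ∘L A y) z u v = A z (A z (C u v)) - C u (A z (A z v)) := by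
  have hext {a b : F} (h : ∀ w, G z a w = G z b w) : a = b :=
    hinv.injective (ContinuousLinearMap.ext h)
  have hex (u v : F) : ∃ c, ∀ w, G z c w = christoffel G z u v w := by
    let φ : F →ₗ[ℝ] ℝ :=
      { toFun := christoffel G z u v
        map_add' := christoffel_add_right G z u v
        map_smul' := fun c w ↦ christoffel_smul_right G z u v w c }
    refine ⟨(G z).inverse (LinearMap.toContinuousLinearMap φ), fun w ↦ ?_⟩
    rw [hinv.self_apply_inverse]
    rfl
  choose C hC using hex
  have hdA (u v : F) : fderiv ℝ A z u v = A z (C u v) - C u (A z v) := by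
    refine hext fun w ↦ ?_
    have h := hpar u v w
    rw [covDefect, ← hC, ← hC] at h
    rw [(G z).map_sub, sub_apply, hskew]
    linarith
  refine ⟨C, fun u v ↦ hext fun w ↦ ?_, fun u ↦ hext fun w ↦ ?_, fun u v ↦ ?_⟩
  · rw [hC, hC, christoffel, christoffel, fderiv_bilin_symm hG w u v hsymm]
    ring
  · rw [hC, christoffel_zero_mid, map_zero, zero_apply]
  · have h := hA.hasFDerivAt.clm_comp hA.hasFDerivAt
    rw [h.fderiv]
    simp [hdA]

variable {E₁ : Type*} [NormedAddCommGroup E₁] [NormedSpace ℝ E₁] [FiniteDimensional ℝ E₁]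
  {E₂ : Type*} [NormedAddCommGroup E₂] [NormedSpace ℝ E₂] [FiniteDimensional ℝ E₂]

omit [FiniteDimensional ℝ E₁] [FiniteDimensional ℝ E₂] in
/-- A metric which carries a parallel skew endomorphism field with kernel the second factor and
image the first factor splits. -/
lemma fderiv_eq_zero_of_covDefect {G : E₁ × E₂ → (E₁ × E₂) →L[ℝ] (E₁ × E₂) →L[ℝ] ℝ}
    {A : E₁ × E₂ → (E₁ × E₂) →L[ℝ] (E₁ × E₂)} {z : E₁ × E₂}
    (hG : DifferentiableAt ℝ G z) (hA : DifferentiableAt ℝ A z)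
    (hsymm : ∀ᶠ y in 𝓝 z, ∀ v w, G y v w = G y w v)
    (h₀ : ∀ᶠ y in 𝓝 z, ∀ v w, G y (v, 0) (0, w) = 0)
    (hA₁ : ∀ᶠ y in 𝓝 z, ∀ v, (A y (v, 0)).2 = 0) (hA₂ : ∀ w, A z (0, w) = 0)
    (hAA : ∀ v, A z (A z (v, 0)) = (v, 0))
    (hpar : ∀ u v w, covDefect G A z u v w = 0) :
    (∀ v w, ∀ u : E₁, fderiv ℝ G z (0, w) (u, 0) (v, 0) = 0) ∧
    (∀ v w, ∀ u : E₂, fderiv ℝ G z (v, 0) (0, u) (0, w) = 0) := by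
  have hd₁ (u : E₁ × E₂) (v : E₁) : (fderiv ℝ A z u (v, 0)).2 = 0 := by
    have h3 : (fun y ↦ (A y (v, 0)).2) =ᶠ[𝓝 z] fun _ ↦ 0 := hA₁.mono fun y hy ↦ hy v
    have h4 := (hA.hasFDerivAt.clm_apply (hasFDerivAt_const ((v, 0) : E₁ × E₂) z)).snd.fderiv
    rw [h3.fderiv_eq] at h4
    simpa using (congrArg (fun L ↦ L u) h4).symm
  have hΓ (u : E₁ × E₂) (v : E₁) (w : E₂) : christoffel G z u (v, 0) (0, w) = 0 := by
    have h5 : A z (v, 0) = ((A z (v, 0)).1, 0) := Prod.ext rfl (hA₁.self_of_nhds v)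
    have h6 := hpar u (A z (v, 0)) (0, w)
    rw [covDefect, hAA, hA₂, christoffel_zero_right, h5] at h6
    have h8 : fderiv ℝ A z u ((A z (v, 0)).1, 0)
        = ((fderiv ℝ A z u ((A z (v, 0)).1, 0)).1, 0) := Prod.ext rfl (hd₁ _ _)
    rw [h8, h₀.self_of_nhds] at h6
    linarith
  have h3 (a : E₁ × E₂) (v : E₁) (w : E₂) : fderiv ℝ G z a (v, 0) (0, w) = 0 :=
    fderiv_bilin_apply_eq_zero hG a (h₀.mono fun y hy ↦ hy v w)
  refine ⟨fun v w u ↦ ?_, fun v w u ↦ ?_⟩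
  · have h := hΓ (u, 0) v w
    rw [christoffel, h3, h3] at h
    linarith
  · have h := hΓ (0, u) v w
    rw [christoffel, h3, fderiv_bilin_symm hG (0, w) (0, u) (v, 0) hsymm, h3] at h
    linarith

omit [FiniteDimensional ℝ E₁] [FiniteDimensional ℝ E₂] in
/-- A family of bilinear forms without mixed derivatives is a product. -/
lemma eq_product_of_fderiv_eq_zero {G : E₁ × E₂ → (E₁ × E₂) →L[ℝ] (E₁ × E₂) →L[ℝ] ℝ}
    (hG : Differentiable ℝ G) (hsymm : ∀ y v w, G y v w = G y w v)
    (h₀ : ∀ y v w, G y (v, 0) (0, w) = 0)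
    (h₁ : ∀ y v w, ∀ u : E₁, fderiv ℝ G y (0, w) (u, 0) (v, 0) = 0)
    (h₂ : ∀ y v w, ∀ u : E₂, fderiv ℝ G y (v, 0) (0, u) (0, w) = 0)
    (y u v : E₁ × E₂) :
    G y u v = G (y.1, 0) (u.1, 0) (v.1, 0) + G (0, y.2) (0, u.2) (0, v.2) := by
  have hd (a b c : E₁ × E₂) (y : E₁ × E₂) :
      HasFDerivAt (fun y ↦ G y b c) (fderiv ℝ (fun y ↦ G y b c) y) y :=
    (((hG y).clm_apply (differentiableAt_const b)).clm_apply (differentiableAt_const c)).hasFDerivAt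
  have h3 (b c : E₁) : G y (b, 0) (c, 0) = G (y.1, 0) (b, 0) (c, 0) := by
    have h4 (s : E₂) := (hd 0 (b, 0) (c, 0) (y.1, s)).comp s (hasFDerivAt_prodMk_right y.1 s)
    refine is_const_of_fderiv_eq_zero (𝕜 := ℝ) (f := fun s : E₂ ↦ G (y.1, s) (b, 0) (c, 0))
      (fun s ↦ (h4 s).differentiableAt) (fun s ↦ ?_) y.2 0
    refine (h4 s).fderiv.trans ?_
    ext w
    simp only [ContinuousLinearMap.coe_comp, Function.comp_apply, ContinuousLinearMap.inr_apply,
      zero_apply]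
    rw [← fderiv_bilin_apply (hG _), h₁]
  have h5 (b c : E₂) : G y (0, b) (0, c) = G (0, y.2) (0, b) (0, c) := by
    have h4 (s : E₁) := HasFDerivAt.comp (g := fun y ↦ G y (0, b) (0, c))
      (f := fun s ↦ (s, y.2)) s (hd 0 (0, b) (0, c) (s, y.2)) (hasFDerivAt_prodMk_left s y.2)
    refine is_const_of_fderiv_eq_zero (𝕜 := ℝ) (f := fun s : E₁ ↦ G (s, y.2) (0, b) (0, c))
      (fun s ↦ (h4 s).differentiableAt) (fun s ↦ ?_) y.1 0
    refine (h4 s).fderiv.trans ?_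
    ext w
    simp only [ContinuousLinearMap.coe_comp, Function.comp_apply, ContinuousLinearMap.inl_apply,
      zero_apply]
    rw [← fderiv_bilin_apply (hG _), h₂]
  have hsplit (a : E₁ × E₂) : a = (a.1, 0) + (0, a.2) := by simp
  rw [← h3, ← h5]
  conv_lhs => rw [hsplit u, hsplit v]
  rw [(G y).map_add, add_apply, (G y _).map_add, (G y _).map_add, h₀, hsymm y (0, u.2) (v.1, 0), h₀]
  ring

end ParallelEndomorphisms

section Parametrizations

open Filter

lemma isLocalDiffeomorphAt_extChartAt_symm
    {E : Type*} [NormedAddCommGroup E] [NormedSpace ℝ E]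
    {H : Type*} [TopologicalSpace H] (I : ModelWithCorners ℝ E H) [I.Boundaryless]
    {M : Type*} [TopologicalSpace M] [ChartedSpace H M] [IsManifold I ∞ M] (x : M) {z : E}
    (hz : z ∈ (extChartAt I x).target) :
    IsLocalDiffeomorphAt 𝓘(ℝ, E) I ∞ (extChartAt I x).symm z :=
  ⟨{ toPartialEquiv := (extChartAt I x).symm
     open_source := isOpen_extChartAt_target x
     open_target := isOpen_extChartAt_source x
     contMDiffOn_toFun := contMDiffOn_extChartAt_symm x
     contMDiffOn_invFun := by
      have := contMDiffOn_extChartAt (I := I) (x := x) (n := ∞)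
      rwa [← extChartAt_source I] at this }, hz, fun _ _ ↦ rfl⟩

variable {F : Type*} [NormedAddCommGroup F] [NormedSpace ℝ F]
  {E : Type*} [NormedAddCommGroup E] [NormedSpace ℝ E] [FiniteDimensional ℝ E]
  {H : Type*} [TopologicalSpace H] {I : ModelWithCorners ℝ E H}
  {M : Type*} [TopologicalSpace M] [ChartedSpace H M] [IsManifold I ∞ M]
  {E' : Type*} [NormedAddCommGroup E'] [NormedSpace ℝ E'] [FiniteDimensional ℝ E']
  {H' : Type*} [TopologicalSpace H'] {J : ModelWithCorners ℝ E' H'}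
  {N : Type*} [TopologicalSpace N] [ChartedSpace H' N] [IsManifold J ∞ N]
  {g : PseudoRiemannianMetric I M} {K : ParaKahlerStructure J N} {f : M → N}

lemma ParaKahlerStructure.metric_para_left (K : ParaKahlerStructure J N) (x : N)
    (v w : TangentSpace J x) :
    K.metric.val x (K.para x v) w = -K.metric.val x v (K.para x w) := by
  rw [← K.metric_para, K.para_para]

lemma val_tangentialEndomorphism (x : M) (v w : TangentSpace I x) :
    g.val x (tangentialEndomorphism g K f x v) w
      = K.metric.val (f x) (K.para (f x) (mfderiv I J f x v)) (mfderiv I J f x w) := by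
  simp [tangentialEndomorphism, tangentialPart, PseudoRiemannianMetric.val_sharp]

lemma val_tangentialEndomorphism_left (x : M) (v w : TangentSpace I x) :
    g.val x (tangentialEndomorphism g K f x v) w
      = -g.val x v (tangentialEndomorphism g K f x w) := by
  rw [g.symm x v, val_tangentialEndomorphism, val_tangentialEndomorphism, K.metric_para_left,
    K.metric.symm]

/-- Applying the para-complex structure preserves smoothness of vector fields along maps. -/
lemma ParaKahlerStructure.contMDiffAt_para_along (K : ParaKahlerStructure J N)
    {Ψ : F → N} {z : F} {V : Π y : F, TangentSpace J (Ψ y)}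
    (hV : ContMDiffAt 𝓘(ℝ, F) J.tangent ∞ (fun y ↦ (⟨Ψ y, V y⟩ : TangentBundle J N)) z) :
    ContMDiffAt 𝓘(ℝ, F) J.tangent ∞
      (fun y ↦ (⟨Ψ y, K.para (Ψ y) (V y)⟩ : TangentBundle J N)) z := by
  have hΨ : ContMDiffAt 𝓘(ℝ, F) J ∞ Ψ z := ((contMDiffAt_totalSpace).1 hV).1
  exact ContMDiffAt.clm_bundle_apply (F₁ := E') (F₂ := E')
    (K.contMDiff_para.contMDiffAt.comp z hΨ) hV

variable [FiniteDimensional ℝ F] {Φ : F → M} {z : F}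

lemma ParaKahlerStructure.contDiffAt_coordEndo_para (K : ParaKahlerStructure J N) {Ψ : F → N}
    (hΨ : IsLocalDiffeomorphAt 𝓘(ℝ, F) J ∞ Ψ z) :
    ContDiffAt ℝ ∞ (coordEndo (F := F) J Ψ K.para) z :=
  K.metric.contDiffAt_coordEndo hΨ fun v w ↦ K.metric.contDiffAt_val_along
    (K.contMDiffAt_para_along (hΨ.contMDiffAt.mfderiv_apply_const v))
    (hΨ.contMDiffAt.mfderiv_apply_const w)

lemma contDiffAt_coordEndo_tangentialEndomorphism (hf : ContMDiff I J ∞ f)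
    (hΦ : IsLocalDiffeomorphAt 𝓘(ℝ, F) I ∞ Φ z) :
    ContDiffAt ℝ ∞ (coordEndo (F := F) I Φ (tangentialEndomorphism g K f)) z := by
  refine g.contDiffAt_coordEndo hΦ fun v w ↦ ?_
  have h1 : ContMDiffAt 𝓘(ℝ, F) J ∞ (f ∘ Φ) z := hf.contMDiffAt.comp z hΦ.contMDiffAt
  refine (K.metric.contDiffAt_val_along (K.contMDiffAt_para_along (h1.mfderiv_apply_const v))
    (h1.mfderiv_apply_const w)).congr_of_eventuallyEq ?_
  filter_upwards [hΦ.eventually] with y hy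
  rw [val_tangentialEndomorphism, mfderiv_comp y (hf.mdifferentiableAt (by simp))
    (hy.mdifferentiableAt (by simp))]
  rfl

omit [FiniteDimensional ℝ F] in
lemma coordEndo_para_skew {Ψ : F → N} (hΨ : IsLocalDiffeomorphAt 𝓘(ℝ, F) J ∞ Ψ z) (v w : F) :
    K.metric.pullbackForm Ψ z (coordEndo J Ψ K.para z v) w
      = -K.metric.pullbackForm Ψ z v (coordEndo J Ψ K.para z w) := by
  rw [K.metric.pullbackForm_coordEndo hΨ, K.metric_para_left,
    PseudoRiemannianMetric.pullbackForm_apply, mfderiv_coordEndo hΨ]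

omit [FiniteDimensional ℝ F] in
lemma coordEndo_tangentialEndomorphism_skew (hΦ : IsLocalDiffeomorphAt 𝓘(ℝ, F) I ∞ Φ z) (v w : F) :
    g.pullbackForm Φ z (coordEndo I Φ (tangentialEndomorphism g K f) z v) w
      = -g.pullbackForm Φ z v (coordEndo I Φ (tangentialEndomorphism g K f) z w) := by
  rw [g.pullbackForm_coordEndo hΦ, val_tangentialEndomorphism_left,
    PseudoRiemannianMetric.pullbackForm_apply, mfderiv_coordEndo hΦ]

omit [FiniteDimensional ℝ F] [FiniteDimensional ℝ E] in
lemma PseudoRiemannianMetric.pullbackForm_symm (g : PseudoRiemannianMetric I M) (Φ : F → M)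
    (z v w : F) : g.pullbackForm Φ z v w = g.pullbackForm Φ z w v := g.symm _ _ _

end Parametrizations

section ProductImpliesParallel

open Filter

variable {F : Type*} [NormedAddCommGroup F] [NormedSpace ℝ F]
  {E' : Type*} [NormedAddCommGroup E'] [NormedSpace ℝ E']
  {H' : Type*} [TopologicalSpace H'] {J : ModelWithCorners ℝ E' H'}
  {N : Type*} [TopologicalSpace N] [ChartedSpace H' N]

lemma PseudoRiemannianMetric.val_congr [IsManifold J ∞ N] (h : PseudoRiemannianMetric J N)
    {x x' : N} (e : x = x')
    {v w : TangentSpace J x} {v' w' : TangentSpace J x'} (hv : (v : E') = (v' : E'))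
    (hw : (w : E') = (w' : E')) : h.val x v w = h.val x' v' w' := by
  subst e
  exact congrArg₂ (fun a b ↦ h.val x a b) hv hw

lemma ParaKahlerStructure.para_congr [IsManifold J ∞ N] [FiniteDimensional ℝ E']
    (K : ParaKahlerStructure J N) {x x' : N} (e : x = x')
    {v : TangentSpace J x} {v' : TangentSpace J x'} (hv : (v : E') = (v' : E')) :
    (K.para x v : E') = K.para x' v' := by
  subst e
  exact congrArg (fun a ↦ K.para x a) hv

lemma mfderiv_eq_of_eventuallyEq_comp {φ : F → N} {Ψ : E' → N} {j : F → E'} {y : F}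
    (h : φ =ᶠ[𝓝 y] Ψ ∘ j) (hΨ : MDifferentiableAt 𝓘(ℝ, E') J Ψ (j y))
    (hj : DifferentiableAt ℝ j y) (v : F) :
    (mfderiv 𝓘(ℝ, F) J φ y v : E') = mfderiv 𝓘(ℝ, E') J Ψ (j y) (fderiv ℝ j y v) := by
  have h1 : (mfderiv 𝓘(ℝ, F) J φ y : F →L[ℝ] E') = mfderiv 𝓘(ℝ, F) J (Ψ ∘ j) y := h.mfderiv_eq
  have h2 := mfderiv_comp y hΨ (mdifferentiableAt_iff_differentiableAt.2 hj)
  rw [mfderiv_eq_fderiv] at h2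
  exact (congrArg (fun L : F →L[ℝ] E' ↦ L v) h1).trans (congrArg (fun L : F →L[ℝ] E' ↦ L v) h2)

variable [IsManifold J ∞ N] [FiniteDimensional ℝ E']
  {E : Type*} [NormedAddCommGroup E] [NormedSpace ℝ E] [FiniteDimensional ℝ E]
  {H : Type*} [TopologicalSpace H] {I : ModelWithCorners ℝ E H}
  {M : Type*} [TopologicalSpace M] [ChartedSpace H M] [IsManifold I ∞ M]
  {g : PseudoRiemannianMetric I M} {K : ParaKahlerStructure J N} {f : M → N}
  {E₁ : Type*} [NormedAddCommGroup E₁] [NormedSpace ℝ E₁] [FiniteDimensional ℝ E₁]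
  {E₂ : Type*} [NormedAddCommGroup E₂] [NormedSpace ℝ E₂] [FiniteDimensional ℝ E₂]

/-- In a local product decomposition with invariant and anti-invariant leaves, the tangential
endomorphism is parallel. -/
theorem parallel_tangentialEndomorphism_of_product [J.Boundaryless]
    (hf : IsIsometricImmersion g K.metric f) {Φ : E₁ × E₂ → M} {z : E₁ × E₂}
    (hΦ : IsLocalDiffeomorphAt 𝓘(ℝ, E₁ × E₂) I ∞ Φ z)
    {G₁ : E₁ → E₁ →L[ℝ] E₁ →L[ℝ] ℝ} {G₂ : E₂ → E₂ →L[ℝ] E₂ →L[ℝ] ℝ}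
    (hG : ∀ᶠ y in 𝓝 z, ∀ u v,
      g.pullbackForm Φ y u v = G₁ y.1 u.1 v.1 + G₂ y.2 u.2 v.2)
    (hinv : ∀ᶠ y in 𝓝 z, ∀ v : E₁, ∃ v' : E₁,
      K.para (f (Φ y)) (mfderiv I J f (Φ y) (mfderiv 𝓘(ℝ, E₁ × E₂) I Φ y ((v, 0) : E₁ × E₂)))
        = mfderiv I J f (Φ y) (mfderiv 𝓘(ℝ, E₁ × E₂) I Φ y ((v', 0) : E₁ × E₂)))
    (hanti : ∀ᶠ y in 𝓝 z, ∀ v w : E₂, K.metric.val (f (Φ y))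
      (K.para (f (Φ y)) (mfderiv I J f (Φ y) (mfderiv 𝓘(ℝ, E₁ × E₂) I Φ y ((0, v) : E₁ × E₂))))
      (mfderiv I J f (Φ y) (mfderiv 𝓘(ℝ, E₁ × E₂) I Φ y ((0, w) : E₁ × E₂))) = 0)
    (V : Π x : M, TangentSpace I x) (hV : MDiffAt (T% V) (Φ z)) (u : TangentSpace I (Φ z)) :
    g.leviCivita (fun y ↦ tangentialEndomorphism g K f y (V y)) (Φ z) u
      = tangentialEndomorphism g K f (Φ z) (g.leviCivita V (Φ z) u) := by
  have hAd := contDiffAt_coordEndo_tangentialEndomorphism (g := g) (K := K) hf.contMDiff hΦ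
  have hGd := g.contDiffAt_pullbackForm hΦ.contMDiffAt
  refine (g.parallel_iff_covDefect hΦ (fun v w ↦ val_tangentialEndomorphism_left (Φ z) v w)
    (hAd.differentiableAt (by simp))).2 ?_ V hV u
  have hpull (y : E₁ × E₂) (u v : E₁ × E₂) : g.pullbackForm Φ y u v = K.metric.val (f (Φ y))
      (mfderiv I J f (Φ y) (mfderiv 𝓘(ℝ, E₁ × E₂) I Φ y u))
      (mfderiv I J f (Φ y) (mfderiv 𝓘(ℝ, E₁ × E₂) I Φ y v)) := (hf.isometric _ _ _).symm
  have hext {y : E₁ × E₂} (hy : IsLocalDiffeomorphAt 𝓘(ℝ, E₁ × E₂) I ∞ Φ y) {a b : E₁ × E₂}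
      (h : ∀ w, g.pullbackForm Φ y a w = g.pullbackForm Φ y b w) : a = b :=
    (g.isInvertible_pullbackForm hy).injective (ContinuousLinearMap.ext h)
  have hcoord {y : E₁ × E₂} (hy : IsLocalDiffeomorphAt 𝓘(ℝ, E₁ × E₂) I ∞ Φ y) (v w : E₁ × E₂) :
      g.pullbackForm Φ y (coordEndo I Φ (tangentialEndomorphism g K f) y v) w
        = K.metric.val (f (Φ y)) (K.para (f (Φ y)) (mfderiv I J f (Φ y)
          (mfderiv 𝓘(ℝ, E₁ × E₂) I Φ y v)))
          (mfderiv I J f (Φ y) (mfderiv 𝓘(ℝ, E₁ × E₂) I Φ y w)) := by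
    rw [g.pullbackForm_coordEndo hy, val_tangentialEndomorphism]
  have hA₁' {y : E₁ × E₂} (hy : IsLocalDiffeomorphAt 𝓘(ℝ, E₁ × E₂) I ∞ Φ y) (v v' : E₁)
      (hv : K.para (f (Φ y)) (mfderiv I J f (Φ y) (mfderiv 𝓘(ℝ, E₁ × E₂) I Φ y ((v, 0) : E₁ × E₂)))
        = mfderiv I J f (Φ y) (mfderiv 𝓘(ℝ, E₁ × E₂) I Φ y ((v', 0) : E₁ × E₂))) :
      coordEndo (F := E₁ × E₂) I Φ (tangentialEndomorphism g K f) y (v, 0) = (v', 0) := by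
    refine hext hy fun w ↦ ?_
    rw [hcoord hy, hv, hpull]
  set x₀ := f (Φ z) with hx₀
  set Ψ := (extChartAt J x₀).symm with hΨdef
  set j : E₁ × E₂ → E' := fun y ↦ extChartAt J x₀ (f (Φ y)) with hj
  have hfΦ : ContMDiffAt 𝓘(ℝ, E₁ × E₂) J ∞ (fun y ↦ f (Φ y)) z :=
    hf.contMDiff.contMDiffAt.comp z hΦ.contMDiffAt
  have hjs : ContDiffAt ℝ ∞ j z :=
    (ContMDiffAt.comp z (I' := J) (contMDiffAt_extChartAt (I := J) (x := x₀)) hfΦ).contDiffAt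
  have hjt : j z ∈ (extChartAt J x₀).target := mem_extChartAt_target x₀
  have hΨ : IsLocalDiffeomorphAt 𝓘(ℝ, E') J ∞ Ψ (j z) := isLocalDiffeomorphAt_extChartAt_symm J x₀ hjt
  have hfΨ : ∀ᶠ y in 𝓝 z, f (Φ y) = Ψ (j y) := by
    filter_upwards [hfΦ.continuousAt.preimage_mem_nhds (extChartAt_source_mem_nhds (I := J) x₀)]
      with y hy
    exact ((extChartAt J x₀).left_inv hy).symm
  have hΨe : ∀ᶠ y in 𝓝 z, IsLocalDiffeomorphAt 𝓘(ℝ, E') J ∞ Ψ (j y) :=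
    hjs.continuousAt.eventually hΨ.eventually
  have hje : ∀ᶠ y in 𝓝 z, ContDiffAt ℝ 1 j y :=
    (hjs.of_le (m := 1) (by exact_mod_cast le_top)).eventually (by simp)
  have htrans : ∀ᶠ y in 𝓝 z, ∀ v : E₁ × E₂,
      (mfderiv I J f (Φ y) (mfderiv 𝓘(ℝ, E₁ × E₂) I Φ y v) : E')
        = mfderiv 𝓘(ℝ, E') J Ψ (j y) (fderiv ℝ j y v) := by
    filter_upwards [hΦ.eventually, hfΨ.eventually_nhds, hΨe, hje] with y hy1 hy2 hy3 hy4 v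
    have h1 := mfderiv_eq_of_eventuallyEq_comp (J := J) (φ := f ∘ Φ) (y := y) hy2
      (hy3.mdifferentiableAt (by simp)) (hy4.differentiableAt (by simp)) v
    rw [← h1, mfderiv_comp y (hf.contMDiff.mdifferentiableAt (by simp))
      (hy1.mdifferentiableAt (by simp))]
    rfl
  have hskew' := fun a b ↦ coordEndo_para_skew (K := K) hΨ a b
  have hpar' := (K.metric.parallel_iff_covDefect hΨ (fun v w ↦ K.metric_para_left (Ψ (j z)) v w)
    ((K.contDiffAt_coordEndo_para hΨ).differentiableAt (by simp))).1
    (fun V hV u ↦ K.isParallel_para V _ hV u)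
  have h₀ : ∀ᶠ y in 𝓝 z, ∀ (v : E₁) (w : E₂), g.pullbackForm Φ y (v, 0) (0, w) = 0 :=
    hG.mono fun y hy v w ↦ by rw [hy]; simp
  have hline (v : E₁ × E₂) : Tendsto (fun t : ℝ ↦ z + t • v) (𝓝 0) (𝓝 z) := by
    have : Continuous fun t : ℝ ↦ z + t • v := by fun_prop
    simpa using this.tendsto 0
  refine covDefect_eq_zero_of_product (hGd.differentiableAt (by simp))
    (hAd.differentiableAt (by simp))
    (Eventually.of_forall fun y v w ↦ g.pullbackForm_symm Φ y v w) h₀ ?_ ?_ ?_ ?_ hjs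
    ((K.metric.contDiffAt_pullbackForm hΨ.contMDiffAt).differentiableAt (by simp))
    ((K.contDiffAt_coordEndo_para hΨ).differentiableAt (by simp))
    (K.metric.pullbackForm_symm Ψ (j z)) hskew' ?_ ?_ hpar'
  · intro v w u
    refine fderiv_bilin_apply_eq_zero_of_line (hGd.differentiableAt (by simp)) ?_
    filter_upwards [(hline (0, w)).eventually hG] with t ht
    rw [ht, hG.self_of_nhds]
    simp
  · intro v w u
    refine fderiv_bilin_apply_eq_zero_of_line (hGd.differentiableAt (by simp)) ?_
    filter_upwards [(hline (v, 0)).eventually hG] with t ht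
    rw [ht, hG.self_of_nhds]
    simp
  · filter_upwards [hΦ.eventually, hinv] with y hy1 hy2 v
    obtain ⟨v', hv'⟩ := hy2 v
    rw [hA₁' hy1 v v' hv']
  · filter_upwards [hΦ.eventually, hinv, hanti, h₀] with y hy1 hy2 hy3 hy4 w
    refine hext hy1 fun b ↦ ?_
    obtain ⟨b', hb'⟩ := hy2 b.1
    have hb : b = (b.1, 0) + (0, b.2) := by simp
    rw [hb, (g.pullbackForm Φ y _).map_add, coordEndo_tangentialEndomorphism_skew hy1,
      hA₁' hy1 _ _ hb', g.pullbackForm_symm, hy4, hcoord hy1, hy3, map_zero]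
    simp
  · filter_upwards [htrans, hfΨ] with y hy1 hy2 u v
    rw [hpull]
    exact K.metric.val_congr hy2 (hy1 u) (hy1 v)
  · filter_upwards [hΦ.eventually, hinv, htrans, hfΨ, hΨe] with y hy1 hy2 hy3 hy4 hy5 v
    obtain ⟨v', hv'⟩ := hy2 v
    apply hy5.mfderiv_injective
    rw [mfderiv_coordEndo hy5, hA₁' hy1 v v' hv']
    exact (hy3 _).symm.trans ((show (_ : E') = _ from hv').symm.trans (K.para_congr hy4 (hy3 _)))

end ProductImpliesParallel

section Slices

variable {E₁ : Type*} [NormedAddCommGroup E₁] [NormedSpace ℝ E₁]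
  {E₂ : Type*} [NormedAddCommGroup E₂] [NormedSpace ℝ E₂]
  {E : Type*} [NormedAddCommGroup E] [NormedSpace ℝ E]
  {H : Type*} [TopologicalSpace H] {I : ModelWithCorners ℝ E H}
  {M : Type*} [TopologicalSpace M] [ChartedSpace H M]

lemma mfderiv_slice_left {φ : E₁ × E₂ → M} {y : E₁ × E₂}
    (hφ : MDifferentiableAt 𝓘(ℝ, E₁ × E₂) I φ y) (v : E₁) :
    mfderiv 𝓘(ℝ, E₁) I (fun s ↦ φ (s, y.2)) y.1 v = mfderiv 𝓘(ℝ, E₁ × E₂) I φ y (v, (0 : E₂)) := by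
  have h1 : HasFDerivAt (fun s : E₁ ↦ (s, y.2)) (ContinuousLinearMap.inl ℝ E₁ E₂) y.1 :=
    hasFDerivAt_prodMk_left y.1 y.2
  have h2 := mfderiv_comp (I := 𝓘(ℝ, E₁)) (I' := 𝓘(ℝ, E₁ × E₂)) (I'' := I) (g := φ)
    (f := fun s : E₁ ↦ (s, y.2)) y.1 hφ (mdifferentiableAt_iff_differentiableAt.2 h1.differentiableAt)
  rw [mfderiv_eq_fderiv, h1.fderiv] at h2
  exact congrArg (fun L : E₁ →L[ℝ] E ↦ L v) h2

lemma mfderiv_slice_right {φ : E₁ × E₂ → M} {y : E₁ × E₂}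
    (hφ : MDifferentiableAt 𝓘(ℝ, E₁ × E₂) I φ y) (v : E₂) :
    mfderiv 𝓘(ℝ, E₂) I (fun s ↦ φ (y.1, s)) y.2 v = mfderiv 𝓘(ℝ, E₁ × E₂) I φ y ((0 : E₁), v) := by
  have h1 : HasFDerivAt (fun s : E₂ ↦ (y.1, s)) (ContinuousLinearMap.inr ℝ E₁ E₂) y.2 :=
    hasFDerivAt_prodMk_right y.1 y.2
  have h2 := mfderiv_comp (I := 𝓘(ℝ, E₂)) (I' := 𝓘(ℝ, E₁ × E₂)) (I'' := I) (g := φ)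
    (f := fun s : E₂ ↦ (y.1, s)) y.2 hφ (mdifferentiableAt_iff_differentiableAt.2 h1.differentiableAt)
  rw [mfderiv_eq_fderiv, h1.fderiv] at h2
  exact congrArg (fun L : E₂ →L[ℝ] E ↦ L v) h2

end Slices

section ProductImpliesParallel

open Filter

variable {E : Type*} [NormedAddCommGroup E] [NormedSpace ℝ E] [FiniteDimensional ℝ E]
  {H : Type*} [TopologicalSpace H] {I : ModelWithCorners ℝ E H}
  {M : Type*} [TopologicalSpace M] [ChartedSpace H M] [IsManifold I ∞ M]
  {E' : Type*} [NormedAddCommGroup E'] [NormedSpace ℝ E'] [FiniteDimensional ℝ E']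
  {H' : Type*} [TopologicalSpace H'] {J : ModelWithCorners ℝ E' H'} [J.Boundaryless]
  {N : Type*} [TopologicalSpace N] [ChartedSpace H' N] [IsManifold J ∞ N]
  {g : PseudoRiemannianMetric I M} {K : ParaKahlerStructure J N} {f : M → N}

omit [FiniteDimensional ℝ E] [J.Boundaryless] [IsManifold I ∞ M] in
lemma isInvariantSubmanifold_iff : IsInvariantSubmanifold I K f ↔ ∀ (x : M) (v : TangentSpace I x),
    ∃ v', K.para (f x) (mfderiv I J f x v) = mfderiv I J f x v' := by
  refine ⟨fun h x v ↦ ?_, fun h x ↦ ?_⟩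
  · obtain ⟨v', hv'⟩ := h x ⟨_, ⟨v, rfl⟩, rfl⟩
    exact ⟨v', hv'.symm⟩
  · rintro _ ⟨_, ⟨v, rfl⟩, rfl⟩
    obtain ⟨v', hv'⟩ := h x v
    exact ⟨v', hv'.symm⟩

omit [FiniteDimensional ℝ E] [J.Boundaryless] [IsManifold I ∞ M] in
lemma isAntiInvariantSubmanifold_iff :
    IsAntiInvariantSubmanifold I K f ↔ ∀ (x : M) (v w : TangentSpace I x),
      K.metric.val (f x) (K.para (f x) (mfderiv I J f x v)) (mfderiv I J f x w) = 0 := by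
  refine ⟨fun h x v w ↦ h x ⟨_, ⟨v, rfl⟩, rfl⟩ _ ⟨w, rfl⟩, fun h x ↦ ?_⟩
  rintro _ ⟨_, ⟨v, rfl⟩, rfl⟩ _ ⟨w, rfl⟩
  exact h x v w

set_option maxHeartbeats 800000 in
/-- If a submanifold is a `𝒫R`-product, its tangential endomorphism is parallel. -/
theorem IsPRProduct.isParallel (hf : IsIsometricImmersion g K.metric f)
    (hP : IsPRProduct g K f) : g.IsParallel (tangentialEndomorphism g K f) := by
  intro V x hV u
  obtain ⟨p, q, N₁, _, _, _, _, _, N₂, _, _, _, _, _, g₁, g₂, Φ₀, ⟨n, rfl⟩, -, hΦ₀, hmet, hinv,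
    hanti⟩ := hP x
  set c := (extChartAt ((𝓡 p).prod (𝓡 q)) n).symm with hc
  set c₁ := (extChartAt (𝓡 p) n.1).symm with hc₁
  set c₂ := (extChartAt (𝓡 q) n.2).symm with hc₂
  have hcc (y : EuclideanSpace ℝ (Fin p) × EuclideanSpace ℝ (Fin q)) : c y = (c₁ y.1, c₂ y.2) := by
    rw [hc, extChartAt_prod]
    rfl
  set z := extChartAt ((𝓡 p).prod (𝓡 q)) n n with hz
  have hzt : z ∈ (extChartAt ((𝓡 p).prod (𝓡 q)) n).target := mem_extChartAt_target n
  have hcz : c z = n := extChartAt_to_inv n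
  have hT : ∀ᶠ y in 𝓝 z, y ∈ (extChartAt ((𝓡 p).prod (𝓡 q)) n).target :=
    (isOpen_extChartAt_target n).mem_nhds hzt
  have hcl {y} (hy : y ∈ (extChartAt ((𝓡 p).prod (𝓡 q)) n).target) :
      IsLocalDiffeomorphAt 𝓘(ℝ, EuclideanSpace ℝ (Fin p) × EuclideanSpace ℝ (Fin q))
        ((𝓡 p).prod (𝓡 q)) ∞ c y :=
    isLocalDiffeomorphAt_extChartAt_symm ((𝓡 p).prod (𝓡 q)) n hy
  have hmem {y} (hy : y ∈ (extChartAt ((𝓡 p).prod (𝓡 q)) n).target) :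
      y.1 ∈ (extChartAt (𝓡 p) n.1).target ∧ y.2 ∈ (extChartAt (𝓡 q) n.2).target := by
    rw [extChartAt_prod] at hy
    exact hy
  have hc₁l {y} (hy : y ∈ (extChartAt ((𝓡 p).prod (𝓡 q)) n).target) :
      IsLocalDiffeomorphAt 𝓘(ℝ, EuclideanSpace ℝ (Fin p)) (𝓡 p) ∞ c₁ y.1 :=
    isLocalDiffeomorphAt_extChartAt_symm (𝓡 p) n.1 (hmem hy).1
  have hc₂l {y} (hy : y ∈ (extChartAt ((𝓡 p).prod (𝓡 q)) n).target) :
      IsLocalDiffeomorphAt 𝓘(ℝ, EuclideanSpace ℝ (Fin q)) (𝓡 q) ∞ c₂ y.2 :=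
    isLocalDiffeomorphAt_extChartAt_symm (𝓡 q) n.2 (hmem hy).2
  have hcomp {y} (hy : y ∈ (extChartAt ((𝓡 p).prod (𝓡 q)) n).target) :
      IsLocalDiffeomorphAt 𝓘(ℝ, EuclideanSpace ℝ (Fin p) × EuclideanSpace ℝ (Fin q)) I ∞
        (Φ₀ ∘ c) y := (hcl hy).comp I M (hΦ₀ _)
  have hdcomp {y} (hy : y ∈ (extChartAt ((𝓡 p).prod (𝓡 q)) n).target)
      (v : EuclideanSpace ℝ (Fin p) × EuclideanSpace ℝ (Fin q)) :
      mfderiv 𝓘(ℝ, EuclideanSpace ℝ (Fin p) × EuclideanSpace ℝ (Fin q)) I (Φ₀ ∘ c) y v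
        = mfderiv ((𝓡 p).prod (𝓡 q)) I Φ₀ (c y)
          (mfderiv 𝓘(ℝ, EuclideanSpace ℝ (Fin p) × EuclideanSpace ℝ (Fin q)) ((𝓡 p).prod (𝓡 q))
            c y v) := by
    rw [mfderiv_comp y ((hΦ₀ _).mdifferentiableAt (by simp)) ((hcl hy).mdifferentiableAt (by simp))]
    rfl
  have hdf {y} (hy : y ∈ (extChartAt ((𝓡 p).prod (𝓡 q)) n).target)
      (v : EuclideanSpace ℝ (Fin p) × EuclideanSpace ℝ (Fin q)) :
      mfderiv 𝓘(ℝ, EuclideanSpace ℝ (Fin p) × EuclideanSpace ℝ (Fin q)) J (f ∘ (Φ₀ ∘ c)) y v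
        = mfderiv I J f (Φ₀ (c y)) (mfderiv
          𝓘(ℝ, EuclideanSpace ℝ (Fin p) × EuclideanSpace ℝ (Fin q)) I (Φ₀ ∘ c) y v) := by
    rw [mfderiv_comp y (hf.contMDiff.mdifferentiableAt (by simp))
      ((hcomp hy).mdifferentiableAt (by simp))]
    rfl
  have hfst {y} (hy : y ∈ (extChartAt ((𝓡 p).prod (𝓡 q)) n).target)
      (v : EuclideanSpace ℝ (Fin p) × EuclideanSpace ℝ (Fin q)) :
      (mfderiv ((𝓡 p).prod (𝓡 q)) (𝓡 p) Prod.fst (c y)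
        (mfderiv 𝓘(ℝ, EuclideanSpace ℝ (Fin p) × EuclideanSpace ℝ (Fin q)) ((𝓡 p).prod (𝓡 q))
          c y v) : EuclideanSpace ℝ (Fin p))
        = mfderiv 𝓘(ℝ, EuclideanSpace ℝ (Fin p)) (𝓡 p) c₁ y.1 v.1 := by
    have h1 := mfderiv_comp y (mdifferentiableAt_fst (I := 𝓡 p) (I' := 𝓡 q) (x := c y))
      ((hcl hy).mdifferentiableAt (by simp))
    have h2 := mfderiv_eq_of_eventuallyEq_comp (J := 𝓡 p) (φ := Prod.fst ∘ c) (Ψ := c₁)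
      (j := Prod.fst) (y := y) (Eventually.of_forall fun y ↦ by simp [hcc])
      ((hc₁l hy).mdifferentiableAt (by simp)) differentiableAt_fst v
    rw [h1, fderiv_fst] at h2
    exact h2
  have hsnd {y} (hy : y ∈ (extChartAt ((𝓡 p).prod (𝓡 q)) n).target)
      (v : EuclideanSpace ℝ (Fin p) × EuclideanSpace ℝ (Fin q)) :
      (mfderiv ((𝓡 p).prod (𝓡 q)) (𝓡 q) Prod.snd (c y)
        (mfderiv 𝓘(ℝ, EuclideanSpace ℝ (Fin p) × EuclideanSpace ℝ (Fin q)) ((𝓡 p).prod (𝓡 q))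
          c y v) : EuclideanSpace ℝ (Fin q))
        = mfderiv 𝓘(ℝ, EuclideanSpace ℝ (Fin q)) (𝓡 q) c₂ y.2 v.2 := by
    have h1 := mfderiv_comp y (mdifferentiableAt_snd (I := 𝓡 p) (I' := 𝓡 q) (x := c y))
      ((hcl hy).mdifferentiableAt (by simp))
    have h2 := mfderiv_eq_of_eventuallyEq_comp (J := 𝓡 q) (φ := Prod.snd ∘ c) (Ψ := c₂)
      (j := Prod.snd) (y := y) (Eventually.of_forall fun y ↦ by simp [hcc])
      ((hc₂l hy).mdifferentiableAt (by simp)) differentiableAt_snd v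
    rw [h1, fderiv_snd] at h2
    exact h2
  have hleaf₁ {y} (hy : y ∈ (extChartAt ((𝓡 p).prod (𝓡 q)) n).target)
      (v : EuclideanSpace ℝ (Fin p)) :
      (mfderiv (𝓡 p) J (fun a ↦ f (Φ₀ (a, c₂ y.2))) (c₁ y.1)
        (mfderiv 𝓘(ℝ, EuclideanSpace ℝ (Fin p)) (𝓡 p) c₁ y.1 v) : E')
      = mfderiv I J f (Φ₀ (c y)) (mfderiv
          𝓘(ℝ, EuclideanSpace ℝ (Fin p) × EuclideanSpace ℝ (Fin q)) I (Φ₀ ∘ c) y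
            (v, (0 : EuclideanSpace ℝ (Fin q)))) := by
    have hs : ContMDiff (𝓡 p) J ∞ (fun a ↦ f (Φ₀ (a, c₂ y.2))) :=
      hf.contMDiff.comp (hΦ₀.contMDiff.comp (contMDiff_id.prodMk contMDiff_const))
    have h1 := mfderiv_comp y.1 (hs.mdifferentiableAt (x := c₁ y.1) (by simp))
      ((hc₁l hy).mdifferentiableAt (by simp))
    have h2 := mfderiv_slice_left (φ := f ∘ (Φ₀ ∘ c)) (y := y) (I := J)
      ((hf.contMDiff.mdifferentiableAt (by simp)).comp y ((hcomp hy).mdifferentiableAt (by simp))) v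
    have h3 : (fun s ↦ (f ∘ (Φ₀ ∘ c)) (s, y.2)) = (fun a ↦ f (Φ₀ (a, c₂ y.2))) ∘ c₁ := by
      funext s; simp [hcc]
    rw [h3, h1, hdf hy] at h2
    exact h2
  have hleaf₂ {y} (hy : y ∈ (extChartAt ((𝓡 p).prod (𝓡 q)) n).target)
      (v : EuclideanSpace ℝ (Fin q)) :
      (mfderiv (𝓡 q) J (fun b ↦ f (Φ₀ (c₁ y.1, b))) (c₂ y.2)
        (mfderiv 𝓘(ℝ, EuclideanSpace ℝ (Fin q)) (𝓡 q) c₂ y.2 v) : E')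
      = mfderiv I J f (Φ₀ (c y)) (mfderiv
          𝓘(ℝ, EuclideanSpace ℝ (Fin p) × EuclideanSpace ℝ (Fin q)) I (Φ₀ ∘ c) y
            ((0 : EuclideanSpace ℝ (Fin p)), v)) := by
    have hs : ContMDiff (𝓡 q) J ∞ (fun b ↦ f (Φ₀ (c₁ y.1, b))) :=
      hf.contMDiff.comp (hΦ₀.contMDiff.comp (contMDiff_const.prodMk contMDiff_id))
    have h1 := mfderiv_comp y.2 (hs.mdifferentiableAt (x := c₂ y.2) (by simp))
      ((hc₂l hy).mdifferentiableAt (by simp))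
    have h2 := mfderiv_slice_right (φ := f ∘ (Φ₀ ∘ c)) (y := y) (I := J)
      ((hf.contMDiff.mdifferentiableAt (by simp)).comp y ((hcomp hy).mdifferentiableAt (by simp))) v
    have h3 : (fun s ↦ (f ∘ (Φ₀ ∘ c)) (y.1, s)) = (fun b ↦ f (Φ₀ (c₁ y.1, b))) ∘ c₂ := by
      funext s; simp [hcc]
    rw [h3, h1, hdf hy] at h2
    exact h2
  have hxz : (Φ₀ ∘ c) z = Φ₀ n := by rw [Function.comp_apply, hcz]
  have main := parallel_tangentialEndomorphism_of_product (g := g) (K := K) hf (hcomp hzt)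
    (G₁ := g₁.pullbackForm c₁) (G₂ := g₂.pullbackForm c₂) ?_ ?_ ?_ V
  · rw [hxz] at main
    exact main hV u
  · filter_upwards [hT] with y hy u v
    rw [PseudoRiemannianMetric.pullbackForm_apply, hdcomp hy, hdcomp hy]
    refine (hmet (c y) _ _).trans ?_
    refine congrArg₂ (· + ·) (g₁.val_congr ?_ (hfst hy u) (hfst hy v))
      (g₂.val_congr ?_ (hsnd hy u) (hsnd hy v)) <;> rw [hcc]
  · filter_upwards [hT] with y hy v
    obtain ⟨a, ha⟩ := isInvariantSubmanifold_iff.1 (hinv (c₂ y.2)) (c₁ y.1)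
      (mfderiv 𝓘(ℝ, EuclideanSpace ℝ (Fin p)) (𝓡 p) c₁ y.1 v)
    obtain ⟨v', rfl⟩ := (hc₁l hy).mfderiv_surjective a
    exact ⟨v', (K.para_congr (congrArg (f ∘ Φ₀) (hcc y)) (hleaf₁ hy v).symm).trans
      ((show (_ : E') = _ from ha).trans (hleaf₁ hy v'))⟩
  · filter_upwards [hT] with y hy v w
    refine Eq.trans ?_ (isAntiInvariantSubmanifold_iff.1 (hanti (c₁ y.1)) (c₂ y.2)
      (mfderiv 𝓘(ℝ, EuclideanSpace ℝ (Fin q)) (𝓡 q) c₂ y.2 v)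
      (mfderiv 𝓘(ℝ, EuclideanSpace ℝ (Fin q)) (𝓡 q) c₂ y.2 w))
    exact K.metric.val_congr (congrArg (f ∘ Φ₀) (hcc y))
      (K.para_congr (congrArg (f ∘ Φ₀) (hcc y)) (hleaf₂ hy v).symm) (hleaf₂ hy w).symm

end ProductImpliesParallel

section ParallelImpliesProduct

open Filter

/-- A smooth family of nondegenerate symmetric bilinear forms on a vector space, as a metric. -/
def PseudoRiemannianMetric.ofContDiff {F : Type*} [NormedAddCommGroup F] [NormedSpace ℝ F]
    (B : F → F →L[ℝ] F →L[ℝ] ℝ) (hB : ContDiff ℝ ∞ B) (hsymm : ∀ x v w, B x v w = B x w v)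
    (hnondeg : ∀ x v, (∀ w, B x v w = 0) → v = 0) : PseudoRiemannianMetric 𝓘(ℝ, F) F where
  val x := B x
  symm := hsymm
  nondegenerate := hnondeg
  contMDiff := by
    intro x
    let s : Π x : F, TangentSpace 𝓘(ℝ, F) x →L[ℝ] TangentSpace 𝓘(ℝ, F) x →L[ℝ] ℝ := fun x ↦ B x
    change ContMDiffAt 𝓘(ℝ, F) (𝓘(ℝ, F).prod 𝓘(ℝ, F →L[ℝ] F →L[ℝ] ℝ)) ∞
      (fun x ↦ TotalSpace.mk' (F →L[ℝ] F →L[ℝ] ℝ) x (s x)) x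
    rw [contMDiffAt_section]
    refine (hB.contDiffAt.contMDiffAt (x := x)).congr_of_eventuallyEq
      (Eventually.of_forall fun y ↦ ?_)
    ext v w
    change ((trivializationAt (F →L[ℝ] F →L[ℝ] ℝ) (fun x : F ↦ TangentSpace 𝓘(ℝ, F) x →L[ℝ]
      TangentSpace 𝓘(ℝ, F) x →L[ℝ] ℝ) x) ⟨y, s y⟩).2 v w = s y v w
    simp [hom_trivializationAt_apply, ContinuousLinearMap.inCoordinates,
      Trivialization.linearMapAt_apply]
    have hy : y ∈ (chartAt F x).source ∩ (Trivial.trivialization F ℝ).baseSet :=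
      ⟨by rw [chartAt_self_eq]; trivial, trivial⟩
    exact congrArg (fun L : F →L[ℝ] ℝ ↦ L w) (if_pos hy)

section ModelProd

variable {E₁ : Type*} [NormedAddCommGroup E₁] [NormedSpace ℝ E₁]
  {E₂ : Type*} [NormedAddCommGroup E₂] [NormedSpace ℝ E₂]
  {E : Type*} [NormedAddCommGroup E] [NormedSpace ℝ E]
  {H : Type*} [TopologicalSpace H] {I : ModelWithCorners ℝ E H}
  {M : Type*} [TopologicalSpace M] [ChartedSpace H M]

lemma isLocalDiffeomorphAt_prod_iff {Φ : E₁ × E₂ → M} {z : E₁ × E₂} :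
    IsLocalDiffeomorphAt (𝓘(ℝ, E₁).prod 𝓘(ℝ, E₂)) I ∞ Φ z
      ↔ IsLocalDiffeomorphAt 𝓘(ℝ, E₁ × E₂) I ∞ Φ z := by
  rw [← modelWithCornersSelf_prod, ← chartedSpaceSelf_prod]

lemma mfderiv_prod_eq {Φ : E₁ × E₂ → M} {z : E₁ × E₂} :
    (mfderiv (𝓘(ℝ, E₁).prod 𝓘(ℝ, E₂)) I Φ z : E₁ × E₂ →L[ℝ] E)
      = mfderiv 𝓘(ℝ, E₁ × E₂) I Φ z := by
  rw [← modelWithCornersSelf_prod, ← chartedSpaceSelf_prod]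

end ModelProd

variable {E : Type*} [NormedAddCommGroup E] [NormedSpace ℝ E] [FiniteDimensional ℝ E]
  {H : Type*} [TopologicalSpace H] {I : ModelWithCorners ℝ E H}
  {M : Type*} [TopologicalSpace M] [ChartedSpace H M] [IsManifold I ∞ M]
  {E' : Type*} [NormedAddCommGroup E'] [NormedSpace ℝ E'] [FiniteDimensional ℝ E']
  {H' : Type*} [TopologicalSpace H'] {J : ModelWithCorners ℝ E' H'}
  {N : Type*} [TopologicalSpace N] [ChartedSpace H' N] [IsManifold J ∞ N]
  {g : PseudoRiemannianMetric I M} {K : ParaKahlerStructure J N} {f : M → N}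

/-- On a `𝒫R`-submanifold the tangential endomorphism satisfies `P³ = P`, and agrees with `𝒫` on
the image of `P²`. -/
lemma IsPRSubmanifold.tangentialEndomorphism_spec (hf : IsIsometricImmersion g K.metric f)
    (hPR : IsPRSubmanifold I K f) (x : M) (v : TangentSpace I x) :
    tangentialEndomorphism g K f x (tangentialEndomorphism g K f x
        (tangentialEndomorphism g K f x v)) = tangentialEndomorphism g K f x v ∧
      (tangentialEndomorphism g K f x (tangentialEndomorphism g K f x v) = v →
        K.para (f x) (mfderiv I J f x v) = mfderiv I J f x (tangentialEndomorphism g K f x v)) := by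
  obtain ⟨D, D', -, -, h⟩ := hPR
  obtain ⟨hcompl, hD, hD'⟩ := h x
  have key (a b : TangentSpace I x) (hab : K.para (f x) (mfderiv I J f x a) = mfderiv I J f x b) :
      tangentialEndomorphism g K f x a = b := by
    refine g.ext_val fun w ↦ ?_
    rw [val_tangentialEndomorphism, hab, hf.isometric]
  have h1 (a : TangentSpace I x) (ha : a ∈ D x) : ∃ b ∈ D x,
      K.para (f x) (mfderiv I J f x a) = mfderiv I J f x b := by
    have : K.para (f x) (mfderiv I J f x a) ∈ (D x).map (mfderiv I J f x).toLinearMap := by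
      rw [← hD]
      exact ⟨_, ⟨a, ha, rfl⟩, rfl⟩
    obtain ⟨b, hb, hab⟩ := this
    exact ⟨b, hb, hab.symm⟩
  have h2 (a : TangentSpace I x) (ha : a ∈ D' x) : tangentialEndomorphism g K f x a = 0 := by
    refine g.nondegenerate x _ fun w ↦ ?_
    rw [val_tangentialEndomorphism]
    exact hD' ⟨_, ⟨a, ha, rfl⟩, rfl⟩ _ ⟨w, rfl⟩
  obtain ⟨a, ha, a', ha', rfl⟩ : ∃ a ∈ D x, ∃ a' ∈ D' x, a + a' = v := by
    have : v ∈ D x ⊔ D' x := by rw [hcompl.sup_eq_top]; trivial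
    exact Submodule.mem_sup.1 this
  obtain ⟨b, hb, hab⟩ := h1 a ha
  have hba : K.para (f x) (mfderiv I J f x b) = mfderiv I J f x a := by
    rw [← hab, K.para_para]
  rw [map_add, h2 a' ha', add_zero, key a b hab, key b a hba, key a b hab]
  refine ⟨rfl, fun h ↦ ?_⟩
  rw [← h, hab]

end ParallelImpliesProduct

section ParallelImpliesProduct

open Filter

variable {n : ℕ} {M : Type*} [TopologicalSpace M] [ChartedSpace (EuclideanSpace ℝ (Fin n)) M]
  [IsManifold (𝓡 n) ∞ M]
  {E' : Type*} [NormedAddCommGroup E'] [NormedSpace ℝ E'] [FiniteDimensional ℝ E']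
  {H' : Type*} [TopologicalSpace H'] {J : ModelWithCorners ℝ E' H'}
  {N : Type*} [TopologicalSpace N] [ChartedSpace H' N] [IsManifold J ∞ N]
  {g : PseudoRiemannianMetric (𝓡 n) M} {K : ParaKahlerStructure J N} {f : M → N}

/-- Parametrizations by products which are adapted to the square of a parallel tangential
endomorphism. -/
lemma exists_adapted_parametrization (hf : IsIsometricImmersion g K.metric f)
    (hcube : ∀ x v, tangentialEndomorphism g K f x (tangentialEndomorphism g K f x
      (tangentialEndomorphism g K f x v)) = tangentialEndomorphism g K f x v)
    (hpar : g.IsParallel (tangentialEndomorphism g K f)) (x : M) :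
    ∃ (p q : ℕ) (Φ : EuclideanSpace ℝ (Fin p) × EuclideanSpace ℝ (Fin q) → M),
      x ∈ Set.range Φ ∧ Function.Injective Φ ∧
      (∀ y, IsLocalDiffeomorphAt 𝓘(ℝ, EuclideanSpace ℝ (Fin p) × EuclideanSpace ℝ (Fin q))
        (𝓡 n) ∞ Φ y) ∧
      ∀ y (v : EuclideanSpace ℝ (Fin p) × EuclideanSpace ℝ (Fin q)),
        coordEndo (𝓡 n) Φ (tangentialEndomorphism g K f) y
          (coordEndo (𝓡 n) Φ (tangentialEndomorphism g K f) y v) = (v.1, 0) := by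
  set z₀ := extChartAt (𝓡 n) x x with hz₀
  set Ψ := (extChartAt (𝓡 n) x).symm with hΨdef
  set A := coordEndo (𝓡 n) Ψ (tangentialEndomorphism g K f) with hAdef
  have hT : ∀ᶠ z in 𝓝 z₀, z ∈ (extChartAt (𝓡 n) x).target :=
    (isOpen_extChartAt_target x).mem_nhds (mem_extChartAt_target x)
  have hΨ {z} (hz : z ∈ (extChartAt (𝓡 n) x).target) :
      IsLocalDiffeomorphAt 𝓘(ℝ, EuclideanSpace ℝ (Fin n)) (𝓡 n) ∞ Ψ z :=
    isLocalDiffeomorphAt_extChartAt_symm (𝓡 n) x hz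
  have hA {z} (hz : z ∈ (extChartAt (𝓡 n) x).target) : ContDiffAt ℝ ∞ A z :=
    contDiffAt_coordEndo_tangentialEndomorphism hf.contMDiff (hΨ hz)
  have hA3 {z} (hz : z ∈ (extChartAt (𝓡 n) x).target) (v) : A z (A z (A z v)) = A z v := by
    apply (hΨ hz).mfderiv_injective
    simp only [hAdef, mfderiv_coordEndo (hΨ hz), hcube]
  have hC {z} (hz : z ∈ (extChartAt (𝓡 n) x).target) :=
    exists_fderiv_comp_self_eq (G := g.pullbackForm Ψ) (A := A)
      ((g.contDiffAt_pullbackForm (hΨ hz).contMDiffAt).differentiableAt (by simp))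
      ((hA hz).differentiableAt (by simp))
      (Eventually.of_forall fun y v w ↦ g.pullbackForm_symm Ψ y v w)
      (g.isInvertible_pullbackForm (hΨ hz)) (coordEndo_tangentialEndomorphism_skew (hΨ hz))
      ((g.parallel_iff_covDefect (hΨ hz) (fun v w ↦ val_tangentialEndomorphism_left _ v w)
        ((hA hz).differentiableAt (by simp))).1 fun V hV u ↦ hpar V _ hV u)
  obtain ⟨p, q, Θ, hsrc, hz₀Θ, hΘ, hΘs, hΘd, hQ⟩ := exists_straightening
    (ρ := fun z ↦ A z ∘L A z) (z₀ := z₀) (hT.mono fun z hz ↦ (hA hz).clm_comp (hA hz))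
    (hT.mono fun z hz v ↦ by simp [hA3 hz])
    (hT.mono fun z hz u v hu hv ↦ by
      obtain ⟨C, hCs, hC0, hC⟩ := hC hz
      have hu' : A z (A z u) = 0 := hu
      have hv' : A z (A z v) = 0 := hv
      rw [hC, hC, hu', hv', hC0, hC0, hCs])
    (hT.mono fun z hz u v hu hv ↦ by
      obtain ⟨C, hCs, hC0, hC⟩ := hC hz
      have hu' : A z (A z u) = u := hu
      have hv' : A z (A z v) = v := hv
      rw [hC, hC, hu', hv', hCs]) hT
  have hΘt (y) : Θ y ∈ Θ.target := Θ.map_source (by rw [hsrc]; trivial)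
  have hΘl (y) : IsLocalDiffeomorphAt
      𝓘(ℝ, EuclideanSpace ℝ (Fin p) × EuclideanSpace ℝ (Fin q))
      𝓘(ℝ, EuclideanSpace ℝ (Fin n)) ∞ Θ y :=
    ⟨{ toPartialEquiv := Θ.toPartialEquiv
       open_source := Θ.open_source
       open_target := Θ.open_target
       contMDiffOn_toFun := hΘ.contMDiff.contMDiffOn
       contMDiffOn_invFun := hΘs.contMDiffOn }, by rw [hsrc]; trivial, fun _ _ ↦ rfl⟩
  have hl (y) : IsLocalDiffeomorphAt 𝓘(ℝ, EuclideanSpace ℝ (Fin p) × EuclideanSpace ℝ (Fin q))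
      (𝓡 n) ∞ (Ψ ∘ Θ) y := (hΘl y).comp _ _ (hΨ (hQ _ (hΘt y)))
  refine ⟨p, q, Ψ ∘ Θ, ⟨Θ.symm z₀, ?_⟩, ?_, hl, fun y v ↦ ?_⟩
  · rw [Function.comp_apply, Θ.right_inv hz₀Θ]
    exact extChartAt_to_inv x
  · intro a b hab
    have h1 := (extChartAt (𝓡 n) x).symm.injOn (hQ _ (hΘt a)) (hQ _ (hΘt b)) hab
    exact Θ.injOn (by rw [hsrc]; trivial) (by rw [hsrc]; trivial) h1
  · have hz := hQ _ (hΘt y)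
    have hd (w : EuclideanSpace ℝ (Fin p) × EuclideanSpace ℝ (Fin q)) : mfderiv 𝓘(ℝ, EuclideanSpace ℝ (Fin p) × EuclideanSpace ℝ (Fin q)) (𝓡 n)
        (Ψ ∘ Θ) y w = mfderiv 𝓘(ℝ, EuclideanSpace ℝ (Fin n)) (𝓡 n) Ψ (Θ y) (fderiv ℝ Θ y w) := by
      rw [mfderiv_comp y ((hΨ hz).mdifferentiableAt (by simp)) ((hΘl y).mdifferentiableAt (by simp)),
        mfderiv_eq_fderiv]
      rfl
    apply (hl y).mfderiv_injective
    rw [mfderiv_coordEndo (hl y), mfderiv_coordEndo (hl y), hd, hd, ← hΘd y v.1 v.2]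
    have h2 : A (Θ y) (A (Θ y) (fderiv ℝ Θ y v)) = (A (Θ y) ∘L A (Θ y)) (fderiv ℝ Θ y (v.1, v.2)) :=
      rfl
    rw [← h2, mfderiv_coordEndo (hΨ hz), mfderiv_coordEndo (hΨ hz)]
    rfl

end ParallelImpliesProduct

section ParallelImpliesProduct

open Filter

variable {n : ℕ} {M : Type*} [TopologicalSpace M] [ChartedSpace (EuclideanSpace ℝ (Fin n)) M]
  [IsManifold (𝓡 n) ∞ M]
  {E' : Type*} [NormedAddCommGroup E'] [NormedSpace ℝ E'] [FiniteDimensional ℝ E']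
  {H' : Type*} [TopologicalSpace H'] {J : ModelWithCorners ℝ E' H'}
  {N : Type*} [TopologicalSpace N] [ChartedSpace H' N] [IsManifold J ∞ N]
  {g : PseudoRiemannianMetric (𝓡 n) M} {K : ParaKahlerStructure J N} {f : M → N}

/-- A `𝒫R`-submanifold with parallel tangential endomorphism is a `𝒫R`-product. -/
theorem IsPRSubmanifold.isPRProduct (hf : IsIsometricImmersion g K.metric f)
    (hPR : IsPRSubmanifold (𝓡 n) K f) (hpar : g.IsParallel (tangentialEndomorphism g K f)) :
    IsPRProduct g K f := by
  intro x
  obtain ⟨p, q, Φ, hx, hinj, hl, hAA⟩ := exists_adapted_parametrization hf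
    (fun x v ↦ (hPR.tangentialEndomorphism_spec hf x v).1) hpar x
  set A := coordEndo (𝓡 n) Φ (tangentialEndomorphism g K f) with hAdef
  have hA3 (y v) : A y (A y (A y v)) = A y v := by
    apply (hl y).mfderiv_injective
    simp only [hAdef, mfderiv_coordEndo (hl y), (hPR.tangentialEndomorphism_spec hf _ _).1]
  have hA₁ (y) (v : EuclideanSpace ℝ (Fin p)) : (A y (v, 0)).2 = 0 := by
    rw [← hA3, hAA]
  have hA₂ (y) (w : EuclideanSpace ℝ (Fin q)) : A y (0, w) = 0 := by
    rw [← hA3, hAA]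
    have h1 : A y (A y (A y (0, w))) = 0 := by rw [hAA y (0, w)]; exact map_zero _
    rw [hAA] at h1
    exact h1
  have hA (y) : ContDiffAt ℝ ∞ A y :=
    contDiffAt_coordEndo_tangentialEndomorphism hf.contMDiff (hl y)
  have hG : ContDiff ℝ ∞ (g.pullbackForm Φ) :=
    contDiff_iff_contDiffAt.2 fun y ↦ g.contDiffAt_pullbackForm (hl y).contMDiffAt
  have hGd : Differentiable ℝ (g.pullbackForm Φ) := hG.differentiable (by simp)
  have h₀ (y) (v : EuclideanSpace ℝ (Fin p)) (w : EuclideanSpace ℝ (Fin q)) :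
      g.pullbackForm Φ y (v, 0) (0, w) = 0 := by
    have h1 : ((v, 0) : EuclideanSpace ℝ (Fin p) × EuclideanSpace ℝ (Fin q))
        = A y (A y (v, 0)) := (hAA y (v, 0)).symm
    rw [h1, hAdef, coordEndo_tangentialEndomorphism_skew (hl y), ← hAdef, hA₂, map_zero, neg_zero]
  have hder (y) := fderiv_eq_zero_of_covDefect (hGd y) ((hA y).differentiableAt (by simp))
    (Eventually.of_forall fun y v w ↦ g.pullbackForm_symm Φ y v w)
    (Eventually.of_forall h₀) (Eventually.of_forall hA₁) (hA₂ y) (fun v ↦ hAA y (v, 0))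
    ((g.parallel_iff_covDefect (hl y) (fun v w ↦ val_tangentialEndomorphism_left _ v w)
      ((hA y).differentiableAt (by simp))).1 fun V hV u ↦ hpar V _ hV u)
  have hprod := eq_product_of_fderiv_eq_zero hGd (g.pullbackForm_symm Φ) h₀
    (fun y ↦ (hder y).1) (fun y ↦ (hder y).2)
  have hnondeg {y} {v : EuclideanSpace ℝ (Fin p) × EuclideanSpace ℝ (Fin q)}
      (h : ∀ w, g.pullbackForm Φ y v w = 0) : v = 0 :=
    (g.isInvertible_pullbackForm (hl y)).injective
      ((ContinuousLinearMap.ext h).trans (map_zero _).symm)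
  have hsplit (a : EuclideanSpace ℝ (Fin p) × EuclideanSpace ℝ (Fin q)) :
      a = (a.1, 0) + (0, a.2) := by simp
  let i₁ := ContinuousLinearMap.inl ℝ (EuclideanSpace ℝ (Fin p)) (EuclideanSpace ℝ (Fin q))
  let i₂ := ContinuousLinearMap.inr ℝ (EuclideanSpace ℝ (Fin p)) (EuclideanSpace ℝ (Fin q))
  let g₁ : PseudoRiemannianMetric (𝓡 p) (EuclideanSpace ℝ (Fin p)) := .ofContDiff
    (fun x ↦ (g.pullbackForm Φ (x, 0)).bilinearComp i₁ i₁)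
    (contDiff_iff_contDiffAt.2 fun x ↦ contDiffAt_of_apply fun u ↦ contDiffAt_of_apply fun v ↦
      (((hG.comp (contDiff_prodMk_left 0)).clm_apply contDiff_const).clm_apply
        contDiff_const).contDiffAt)
    (fun x v w ↦ g.pullbackForm_symm Φ _ _ _)
    (fun x v hv ↦ congrArg Prod.fst (hnondeg (y := (x, 0)) (v := (v, 0)) fun w ↦ by
      rw [hsplit w, (g.pullbackForm Φ _ _).map_add, h₀, add_zero]
      exact hv w.1))
  let g₂ : PseudoRiemannianMetric (𝓡 q) (EuclideanSpace ℝ (Fin q)) := .ofContDiff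
    (fun x ↦ (g.pullbackForm Φ (0, x)).bilinearComp i₂ i₂)
    (contDiff_iff_contDiffAt.2 fun x ↦ contDiffAt_of_apply fun u ↦ contDiffAt_of_apply fun v ↦
      (((hG.comp (contDiff_prodMk_right 0)).clm_apply contDiff_const).clm_apply
        contDiff_const).contDiffAt)
    (fun x v w ↦ g.pullbackForm_symm Φ _ _ _)
    (fun x v hv ↦ congrArg Prod.snd (hnondeg (y := (0, x)) (v := (0, v)) fun w ↦ by
      rw [hsplit w, (g.pullbackForm Φ _ _).map_add, g.pullbackForm_symm, h₀, zero_add]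
      exact hv w.2))
  have hmd (y) : MDifferentiableAt 𝓘(ℝ, EuclideanSpace ℝ (Fin p) × EuclideanSpace ℝ (Fin q)) J
      (f ∘ Φ) y :=
    (hf.contMDiff.mdifferentiableAt (by simp)).comp y ((hl y).mdifferentiableAt (by simp))
  have hdf (y) (v : EuclideanSpace ℝ (Fin p) × EuclideanSpace ℝ (Fin q)) :
      mfderiv 𝓘(ℝ, EuclideanSpace ℝ (Fin p) × EuclideanSpace ℝ (Fin q)) J (f ∘ Φ) y v
        = mfderiv (𝓡 n) J f (Φ y) (mfderiv
          𝓘(ℝ, EuclideanSpace ℝ (Fin p) × EuclideanSpace ℝ (Fin q)) (𝓡 n) Φ y v) := by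
    rw [mfderiv_comp y (hf.contMDiff.mdifferentiableAt (by simp))
      ((hl y).mdifferentiableAt (by simp))]
    rfl
  have hleaf₁ (a b) (v : EuclideanSpace ℝ (Fin p)) :
      mfderiv (𝓡 p) J (fun a ↦ f (Φ (a, b))) a v = mfderiv (𝓡 n) J f (Φ (a, b)) (mfderiv
          𝓘(ℝ, EuclideanSpace ℝ (Fin p) × EuclideanSpace ℝ (Fin q)) (𝓡 n) Φ (a, b)
          (v, (0 : EuclideanSpace ℝ (Fin q)))) :=
    (mfderiv_slice_left (φ := f ∘ Φ) (y := (a, b)) (hmd _) v).trans (hdf _ _)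
  have hleaf₂ (a b) (v : EuclideanSpace ℝ (Fin q)) :
      mfderiv (𝓡 q) J (fun b ↦ f (Φ (a, b))) b v = mfderiv (𝓡 n) J f (Φ (a, b)) (mfderiv
          𝓘(ℝ, EuclideanSpace ℝ (Fin p) × EuclideanSpace ℝ (Fin q)) (𝓡 n) Φ (a, b)
          ((0 : EuclideanSpace ℝ (Fin p)), v)) :=
    (mfderiv_slice_right (φ := f ∘ Φ) (y := (a, b)) (hmd _) v).trans (hdf _ _)
  refine ⟨p, q, EuclideanSpace ℝ (Fin p), inferInstance, inferInstance, inferInstance,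
    inferInstance, inferInstance, EuclideanSpace ℝ (Fin q), inferInstance, inferInstance,
    inferInstance, inferInstance, inferInstance, g₁, g₂, Φ, hx, hinj,
    fun y ↦ isLocalDiffeomorphAt_prod_iff.2 (hl y), fun y v w ↦ ?_, fun b ↦ ?_, fun a ↦ ?_⟩
  · rw [mfderiv_fst, mfderiv_snd]
    refine Eq.trans ?_ (hprod y v w)
    exact g.val_congr rfl (congrArg (fun L : _ →L[ℝ] EuclideanSpace ℝ (Fin n) ↦ L v)
      mfderiv_prod_eq) (congrArg (fun L : _ →L[ℝ] EuclideanSpace ℝ (Fin n) ↦ L w) mfderiv_prod_eq)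
  · have key (a) (v : EuclideanSpace ℝ (Fin p)) : ∃ v' : EuclideanSpace ℝ (Fin p),
        K.para (f (Φ (a, b))) (mfderiv (𝓡 p) J (fun a ↦ f (Φ (a, b))) a v)
          = mfderiv (𝓡 p) J (fun a ↦ f (Φ (a, b))) a v' := by
      refine ⟨(A (a, b) (v, 0)).1, ?_⟩
      have h1 : (((A (a, b) (v, 0)).1, 0) : EuclideanSpace ℝ (Fin p) × EuclideanSpace ℝ (Fin q))
          = A (a, b) (v, 0) := Prod.ext rfl (hA₁ _ _).symm
      rw [hleaf₁, hleaf₁, h1, mfderiv_coordEndo (hl _)]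
      refine (hPR.tangentialEndomorphism_spec hf _ _).2 ?_
      rw [← mfderiv_coordEndo (hl _), ← mfderiv_coordEndo (hl _)]
      exact congrArg _ (hAA (a, b) (v, 0))
    exact isInvariantSubmanifold_iff.2 key
  · have key (b) (v w : EuclideanSpace ℝ (Fin q)) : K.metric.val (f (Φ (a, b)))
        (K.para (f (Φ (a, b))) (mfderiv (𝓡 q) J (fun b ↦ f (Φ (a, b))) b v))
        (mfderiv (𝓡 q) J (fun b ↦ f (Φ (a, b))) b w) = 0 := by
      rw [hleaf₂, hleaf₂, ← val_tangentialEndomorphism (g := g), ← mfderiv_coordEndo (hl _),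
        ← g.pullbackForm_apply, ← hAdef, hA₂, map_zero, zero_apply]
    exact isAntiInvariantSubmanifold_iff.2 key

end ParallelImpliesProduct

end

theorem proposition3p5 {n m : ℕ}
    {M : Type*} [TopologicalSpace M] [T2Space M] [SecondCountableTopology M]
    [ChartedSpace (EuclideanSpace ℝ (Fin n)) M] [IsManifold (𝓡 n) ∞ M]
    {N : Type*} [TopologicalSpace N] [T2Space N] [SecondCountableTopology N]
    [ChartedSpace (EuclideanSpace ℝ (Fin m)) N] [IsManifold (𝓡 m) ∞ N]
    (g : PseudoRiemannianMetric (𝓡 n) M) (K : ParaKahlerStructure (𝓡 m) N)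
    (f : M → N) (hf : IsIsometricImmersion g K.metric f)
    (hPR : IsPRSubmanifold (𝓡 n) K f) :
    IsPRProduct g K f ↔ g.IsParallel (tangentialEndomorphism g K f) := by
  exact ⟨fun h ↦ h.isParallel hf, fun h ↦ hPR.isPRProduct hf h⟩
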